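/- Let $G$ be a finite group, let $M$ be a closed (compact, without boundary) smooth $n$-manifold with a smooth action of $G$, and let $f\colon M\to\mathbb R$ be an equivariant Morse function, i.e. a smooth function with $f(\sigma x)=f(x)$ for all $\sigma\in G$ whose Hessian at every critical point is nondegenerate. Equivariant homotopy equivalence means $G$-homotopy equivalence: there is a $G$-equivariant map in the other direction which is an inverse up to homotopies through $G$-equivariant maps. 1. If $a<b$ and $f$ has no critical values in $[a,b]$, then the inclusion $f^{-1}(-\infty,a]\to f^{-1}(-\infty,b]$ is an equivariant homotopy equivalence. 2. Suppose that $a<c$ and that $c$ is the only critical value of $f$ in $[a,c]$, with critical points $p_1,\dots,p_k$. Then there are arbitrarily small open coordinate balls $B_i$ around $p_i$, permuted by $G$ (if $\sigma p_i=p_j$ then $\sigma B_i=B_j$), such that $f^{-1}(-\infty,a]\subset f^{-1}(-\infty,c]\setminus\bigcup_i B_i$ and this inclusion is an equivariant homotopy equivalence. 3. Suppose that $c<b$ and that $c$ is the only critical value of $f$ in $[c,b]$, with critical points $p_1,\dots,p_k$. Then there are arbitrarily small closed coordinate balls $\bar B_i$ around $p_i$, permuted by $G$, such that $f^{-1}(-\infty,c]\cup\bigcup_i\bar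 B_i\subset f^{-1}(-\infty,b]$ and this inclusion is an equivariant homotopy equivalence. 4. Suppose that $a<c<b$ and that $c$ is the only critical value of $f$ in $[a,b]$, with critical points $p_1,\dots,p_k$. Let $g$ be any smooth $G$-invariant Riemannian metric on $M$. For a critical point $p$, let $\mathscr D(p)$ be its descending manifold, i.e. the set of points lying on flow lines of $-\nabla f$ that tend to $p$ as $t\to-\infty$; let $T_p\mathscr D\subset T_pM$ be its tangent space at $p$ (the velocities at $p$ of curves in $\mathscr D(p)$ through $p$), and let $D(T_p\mathscr D)$ and $S(T_p\mathscr D)$ be its closed unit disc and unit sphere for $g$. The group $G$ acts on $\bigsqcup_i D(T_{p_i}\mathscr D)$ and on $\bigsqcup_i S(T_{p_i}\mathscr D)$ through the derivatives $d\sigma\colon T_pM\to T_{\sigma p}M$. Then there are a $G$-equivariant attaching map $\varphi\colon\bigsqcup_i S(T_{p_i}\mathscr D)\to f^{-1}(-\infty,a]$ and an equivariant homotopy equivalence $$f^{-1}(-\infty,a]\cup_{\varphi}\bigsqcup_i D(T_{p_i}\mathscr D)\;\simeq\; f^{-1}(-\infty,b]$$ whose restriction to $f^{-1}(-\infty,a]$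 is the inclusion into $f^{-1}(-\infty,b]$. -/

import Mathlib

open scoped Manifold ContDiff Topology

set_option linter.unusedSectionVars false

namespace EquivariantMorse

/-! ### Equivariant homotopy theory of `G`-spaces -/

section GSpaces

/-- A `G`-equivariant continuous map. -/
structure EquivariantMap (G X Y : Type*) [TopologicalSpace X] [TopologicalSpace Y]
    [SMul G X] [SMul G Y] extends C(X, Y) where
  map_smul' : ∀ (σ : G) (x : X), toFun (σ • x) = σ • toFun x

/-- Two continuous maps are equivariantly homotopic if there is a homotopy between them all of
whose stages are equivariant. -/
def EquivariantlyHomotopic (G : Type*) {X Y : Type*} [TopologicalSpace X] [TopologicalSpace Y]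
    [SMul G X] [SMul G Y] (F₀ F₁ : C(X, Y)) : Prop :=
  ∃ H : F₀.Homotopy F₁, ∀ (t : unitInterval) (σ : G) (x : X), H (t, σ • x) = σ • H (t, x)

/-- An equivariant map is an equivariant homotopy equivalence if it has an equivariant inverse up
to equivariant homotopy. -/
def IsEquivariantHomotopyEquiv {G X Y : Type*} [TopologicalSpace X] [TopologicalSpace Y]
    [SMul G X] [SMul G Y] (F : EquivariantMap G X Y) : Prop :=
  ∃ K : EquivariantMap G Y X,
    EquivariantlyHomotopic G (K.toContinuousMap.comp F.toContinuousMap) (ContinuousMap.id X) ∧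
    EquivariantlyHomotopic G (F.toContinuousMap.comp K.toContinuousMap) (ContinuousMap.id Y)

/-- The inclusion of `G`-invariant subspaces, as an equivariant map. -/
def inclusionMap {G X : Type*} [TopologicalSpace X] [Group G] [MulAction G X]
    {Z Y : SubMulAction G X} (h : (Z : Set X) ⊆ Y) : EquivariantMap G Z Y where
  toFun x := ⟨x.1, h x.2⟩
  continuous_toFun := continuous_subtype_val.subtype_mk _
  map_smul' _ _ := rfl

/-- `Z ⊆ Y` are `G`-invariant subsets of `X`, and the inclusion `Z → Y` is an equivariant homotopy
equivalence. -/
def InclusionIsEquivariantHomotopyEquiv (G : Type*) {X : Type*} [TopologicalSpace X] [Group G]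
    [MulAction G X] (Z Y : Set X) : Prop :=
  ∃ (Z' Y' : SubMulAction G X) (h : (Z' : Set X) ⊆ Y'),
    (Z' : Set X) = Z ∧ (Y' : Set X) = Y ∧ IsEquivariantHomotopyEquiv (inclusionMap h)

/-- The relation on `X ⊔ D` gluing `i a ∈ D` to `φ a ∈ X`, for `a ∈ A`. -/
inductive AttachRel {A D X : Type*} (i : A → D) (φ : A → X) : X ⊕ D → X ⊕ D → Prop
  | glue (a : A) : AttachRel i φ (Sum.inr (i a)) (Sum.inl (φ a))

/-- The space `X ∪_φ D` obtained by attaching `D` to `X` along `φ : A → X`, where `i : A → D`;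
it carries the quotient topology. -/
def Adjunction {G A D X : Type*} [TopologicalSpace A] [TopologicalSpace D] [TopologicalSpace X]
    [SMul G A] [SMul G D] [SMul G X] (i : EquivariantMap G A D) (φ : EquivariantMap G A X) :
    Type _ :=
  Quot (AttachRel i.toFun φ.toFun)

namespace Adjunction

variable {G A D X : Type*} [TopologicalSpace A] [TopologicalSpace D] [TopologicalSpace X]

instance [SMul G A] [SMul G D] [SMul G X] (i : EquivariantMap G A D) (φ : EquivariantMap G A X) :
    TopologicalSpace (Adjunction i φ) :=
  inferInstanceAs (TopologicalSpace (Quot (AttachRel i.toFun φ.toFun)))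

/-- The canonical map `X → X ∪_φ D`. -/
def base [SMul G A] [SMul G D] [SMul G X] (i : EquivariantMap G A D) (φ : EquivariantMap G A X)
    (x : X) : Adjunction i φ :=
  Quot.mk _ (Sum.inl x)

/-- The group acts on `X ∪_φ D` through its actions on `X` and on `D`. -/
instance [Group G] [MulAction G A] [MulAction G D] [MulAction G X] (i : EquivariantMap G A D)
    (φ : EquivariantMap G A X) : MulAction G (Adjunction i φ) where
  smul σ := Quot.map (Sum.map (σ • ·) (σ • ·)) (by
    rintro _ _ ⟨a⟩
    have h := AttachRel.glue (i := i.toFun) (φ := φ.toFun) (σ • a)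
    rw [i.map_smul', φ.map_smul'] at h
    exact h)
  one_smul x := by
    induction x using Quot.ind with
    | mk x =>
      refine congrArg (Quot.mk _) ?_
      cases x <;> simp
  mul_smul σ τ x := by
    induction x using Quot.ind with
    | mk x =>
      refine congrArg (Quot.mk _) ?_
      cases x <;> simp [mul_smul]

end Adjunction

end GSpaces

/-! ### Smooth `G`-manifolds and equivariant Morse functions -/

/-- The action of `G` on the smooth `n`-manifold `M` is by smooth maps. -/
class SmoothAction (n : ℕ) (G M : Type*) [Group G] [TopologicalSpace M]
    [ChartedSpace (EuclideanSpace ℝ (Fin n)) M] [MulAction G M] : Prop where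
  smooth : ∀ σ : G, ContMDiff (𝓡 n) (𝓡 n) ∞ (fun x : M => σ • x)

section Morse

variable (n : ℕ) {M : Type*} [TopologicalSpace M] [ChartedSpace (EuclideanSpace ℝ (Fin n)) M]

/-- The critical point set `{p | df_p = 0}`. -/
def criticalPoints (f : M → ℝ) : Set M :=
  {p | mfderiv (𝓡 n) 𝓘(ℝ, ℝ) f p = 0}

/-- The critical points with critical value `c`. -/
def criticalPointsAt (f : M → ℝ) (c : ℝ) : Set M :=
  {p | p ∈ criticalPoints n f ∧ f p = c}

/-- The critical values. -/
def criticalValues (f : M → ℝ) : Set ℝ :=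
  f '' criticalPoints n f

/-- The Hessian of `f` at a critical point `p`, as a bilinear form on `T_p M`: the second derivative
at `p` of `f` in the chart at `p`, which is the chart by which `T_p M` is identified with `ℝⁿ`. -/
noncomputable def hessian (f : M → ℝ) (p : M) :
    TangentSpace (𝓡 n) p →L[ℝ] TangentSpace (𝓡 n) p →L[ℝ] ℝ :=
  fderiv ℝ (fderiv ℝ (f ∘ (extChartAt (𝓡 n) p).symm)) (extChartAt (𝓡 n) p p)

/-- Equivariant Morse functions: smooth `G`-invariant functions whose Hessian at every critical
point is nondegenerate. -/
structure IsEquivariantMorse (G : Type*) [Group G] [MulAction G M] (f : M → ℝ) : Prop where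
  smooth : ContMDiff (𝓡 n) 𝓘(ℝ, ℝ) ∞ f
  invariant : ∀ (σ : G) (x : M), f (σ • x) = f x
  nondegenerate : ∀ p ∈ criticalPoints n f, ∀ v : TangentSpace (𝓡 n) p,
    (∀ w : TangentSpace (𝓡 n) p, hessian n f p v w = 0) → v = 0

/-- `B` is an open coordinate ball around `p`: a Euclidean ball centred at `p` in a smooth chart. -/
def IsOpenCoordinateBall (p : M) (B : Set M) : Prop :=
  ∃ e ∈ IsManifold.maximalAtlas (𝓡 n) ∞ M, p ∈ e.source ∧ ∃ r : ℝ, 0 < r ∧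
    Metric.closedBall (e p) r ⊆ e.target ∧ B = e.symm '' Metric.ball (e p) r

/-- `B` is a closed coordinate ball around `p`. -/
def IsClosedCoordinateBall (p : M) (B : Set M) : Prop :=
  ∃ e ∈ IsManifold.maximalAtlas (𝓡 n) ∞ M, p ∈ e.source ∧ ∃ r : ℝ, 0 < r ∧
    Metric.closedBall (e p) r ⊆ e.target ∧ B = e.symm '' Metric.closedBall (e p) r

end Morse

/-- The sublevel set `f⁻¹(-∞, a]` of an equivariant Morse function, as a `G`-space. -/
def sublevel {n : ℕ} {G M : Type*} [TopologicalSpace M]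
    [ChartedSpace (EuclideanSpace ℝ (Fin n)) M] [Group G] [MulAction G M] {f : M → ℝ}
    (hf : IsEquivariantMorse n G f) (a : ℝ) : SubMulAction G M where
  carrier := {x | f x ≤ a}
  smul_mem' σ x hx := by
    change f (σ • x) ≤ a
    rw [hf.invariant]
    exact hx

lemma mdifferentiableAt_smul {n : ℕ} {G M : Type*} [Group G] [TopologicalSpace M]
    [ChartedSpace (EuclideanSpace ℝ (Fin n)) M] [MulAction G M] [SmoothAction n G M]
    (σ : G) (x : M) : MDifferentiableAt (𝓡 n) (𝓡 n) (fun x : M => σ • x) x :=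
  (SmoothAction.smooth σ).mdifferentiableAt (by simp)

/-! ### Invariant metrics, descending manifolds and their tangent spaces -/

section Descending

variable {n : ℕ} {M : Type*} [TopologicalSpace M] [ChartedSpace (EuclideanSpace ℝ (Fin n)) M]
  [IsManifold (𝓡 n) ∞ M]

/-- Smooth Riemannian metrics on `M`. -/
abbrev SmoothMetric (n : ℕ) (M : Type*) [TopologicalSpace M]
    [ChartedSpace (EuclideanSpace ℝ (Fin n)) M] [IsManifold (𝓡 n) ∞ M] :=
  Bundle.ContMDiffRiemannianMetric (𝓡 n) ∞ (EuclideanSpace ℝ (Fin n))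
    (fun x : M => TangentSpace (𝓡 n) x)

/-- The metric is `G`-invariant: `G` acts by isometries. -/
def IsInvariantMetric (G : Type*) [Group G] [MulAction G M] (g : SmoothMetric n M) : Prop :=
  ∀ (σ : G) (p : M) (v w : TangentSpace (𝓡 n) p),
    g.inner (σ • p) (mfderiv (𝓡 n) (𝓡 n) (fun x : M => σ • x) p v)
      (mfderiv (𝓡 n) (𝓡 n) (fun x : M => σ • x) p w) = g.inner p v w

/-- `γ` is a flow line of the negative gradient field: `γ' = -∇f(γ)`, that is,
`⟨γ'(t), w⟩ = -df(w)` for all `t` and all tangent vectors `w` at `γ t`. -/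
def IsDescendingFlowLine (g : SmoothMetric n M) (f : M → ℝ) (γ : ℝ → M) : Prop :=
  ∀ t : ℝ, MDifferentiableAt 𝓘(ℝ, ℝ) (𝓡 n) γ t ∧
    ∀ w : TangentSpace (𝓡 n) (γ t),
      g.inner (γ t) (mfderiv 𝓘(ℝ, ℝ) (𝓡 n) γ t (1 : ℝ)) w =
        -(mfderiv (𝓡 n) 𝓘(ℝ, ℝ) f (γ t) w : ℝ)

/-- The descending manifold `𝒟(p)`: the points on flow lines of `-∇f` that emanate from `p`. -/
def descendingManifold (g : SmoothMetric n M) (f : M → ℝ) (p : M) : Set M :=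
  {x | ∃ γ : ℝ → M, IsDescendingFlowLine g f γ ∧ γ 0 = x ∧
    Filter.Tendsto γ Filter.atBot (𝓝 p)}

/-- The descending tangent space `T_p 𝒟(p)`, as a set of tangent vectors of `M` at `p`: the
velocities `γ'(0)` of curves `γ` in `𝒟(p)` with `γ 0 = p`. -/
def descendingTangentSpace (g : SmoothMetric n M) (f : M → ℝ) (p : M) :
    Set (TangentSpace (𝓡 n) p) :=
  {v | ∃ γ : ℝ → M, MDifferentiableAt 𝓘(ℝ, ℝ) (𝓡 n) γ 0 ∧
    (∀ t, γ t ∈ descendingManifold g f p) ∧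
    (⟨γ 0, mfderiv 𝓘(ℝ, ℝ) (𝓡 n) γ 0 (1 : ℝ)⟩ : TangentBundle (𝓡 n) M) = ⟨p, v⟩}

variable {G : Type*} [Group G] [MulAction G M] [SmoothAction n G M]

/-- `G` acts on the tangent bundle by the derivatives `σ • (p, v) = (σ p, dσ_p v)`. -/
noncomputable instance : MulAction G (TangentBundle (𝓡 n) M) where
  smul σ x := tangentMap (𝓡 n) (𝓡 n) (fun y : M => σ • y) x
  one_smul x := by
    have h : (fun y : M => (1 : G) • y) = id := funext fun y => one_smul G y
    change tangentMap (𝓡 n) (𝓡 n) (fun y : M => (1 : G) • y) x = x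
    rw [h, tangentMap_id]
    rfl
  mul_smul σ τ x := by
    have h : (fun y : M => (σ * τ) • y) = (fun y : M => σ • y) ∘ (fun y : M => τ • y) :=
      funext fun y => mul_smul σ τ y
    change tangentMap (𝓡 n) (𝓡 n) (fun y : M => (σ * τ) • y) x = _
    rw [h, tangentMap_comp_at x (mdifferentiableAt_smul σ _) (mdifferentiableAt_smul τ _)]
    rfl

lemma mfderiv_smul_comp {f : M → ℝ} (hf : IsEquivariantMorse n G f) (σ : G) (p : M)
    (v : TangentSpace (𝓡 n) p) :
    mfderiv (𝓡 n) 𝓘(ℝ, ℝ) f (σ • p) (mfderiv (𝓡 n) (𝓡 n) (fun x : M => σ • x) p v) =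
      mfderiv (𝓡 n) 𝓘(ℝ, ℝ) f p v := by
  have h : f ∘ (fun x : M => σ • x) = f := funext fun x => hf.invariant σ x
  have h2 := mfderiv_comp p (I' := 𝓡 n) (g := f) (f := fun x : M => σ • x)
    (hf.smooth.mdifferentiableAt (by simp)) (mdifferentiableAt_smul σ p)
  rw [h] at h2
  rw [h2]
  rfl

lemma mfderiv_smul_surjective (σ : G) (p : M) (w : TangentSpace (𝓡 n) (σ • p)) :
    ∃ v : TangentSpace (𝓡 n) p, mfderiv (𝓡 n) (𝓡 n) (fun x : M => σ • x) p v = w := by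
  obtain ⟨q, rfl⟩ : ∃ q, p = σ⁻¹ • q := ⟨σ • p, (inv_smul_smul σ p).symm⟩
  have h : (fun x : M => σ • x) ∘ (fun x : M => σ⁻¹ • x) = id :=
    funext fun x => smul_inv_smul σ x
  have h2 := mfderiv_comp q (I' := 𝓡 n) (g := fun x : M => σ • x)
    (f := fun x : M => σ⁻¹ • x) (mdifferentiableAt_smul σ _) (mdifferentiableAt_smul σ⁻¹ _)
  rw [h, mfderiv_id] at h2
  exact ⟨mfderiv (𝓡 n) (𝓡 n) (fun x : M => σ⁻¹ • x) q w,
    (congrArg (fun L => L w) h2).symm⟩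

lemma smul_mem_criticalPoints {f : M → ℝ} (hf : IsEquivariantMorse n G f) (σ : G) {p : M}
    (hp : p ∈ criticalPoints n f) : σ • p ∈ criticalPoints n f := by
  refine ContinuousLinearMap.ext fun w => ?_
  obtain ⟨v, rfl⟩ := mfderiv_smul_surjective (n := n) σ p w
  have h : mfderiv (𝓡 n) 𝓘(ℝ, ℝ) f p = 0 := hp
  refine (mfderiv_smul_comp hf σ p v).trans ?_
  rw [h]
  rfl

lemma mfderiv_smul_curve (σ : G) {γ : ℝ → M} {t : ℝ}
    (h : MDifferentiableAt 𝓘(ℝ, ℝ) (𝓡 n) γ t) :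
    mfderiv 𝓘(ℝ, ℝ) (𝓡 n) (fun s => σ • γ s) t (1 : ℝ) =
      mfderiv (𝓡 n) (𝓡 n) (fun x : M => σ • x) (γ t)
        (mfderiv 𝓘(ℝ, ℝ) (𝓡 n) γ t (1 : ℝ)) := by
  have h2 := mfderiv_comp t (I' := 𝓡 n) (g := fun x : M => σ • x) (f := γ)
    (mdifferentiableAt_smul σ _) h
  exact congrArg (fun L => L (1 : ℝ)) h2

lemma smul_mem_descendingManifold {f : M → ℝ} (hf : IsEquivariantMorse n G f)
    {g : SmoothMetric n M} (hg : IsInvariantMetric G g) (σ : G) {p x : M}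
    (hx : x ∈ descendingManifold g f p) : σ • x ∈ descendingManifold g f (σ • p) := by
  obtain ⟨γ, hγ, rfl, hlim⟩ := hx
  refine ⟨fun t => σ • γ t, fun t => ⟨?_, fun w => ?_⟩, rfl, ?_⟩
  · exact (mdifferentiableAt_smul σ (γ t)).comp t (hγ t).1
  · obtain ⟨v, rfl⟩ := mfderiv_smul_surjective (n := n) σ (γ t) w
    rw [mfderiv_smul_curve σ (hγ t).1]
    refine (hg σ (γ t) _ v).trans (((hγ t).2 v).trans ?_)
    exact congrArg Neg.neg (mfderiv_smul_comp hf σ (γ t) v).symm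
  · exact ((mdifferentiableAt_smul (n := n) σ p).continuousAt.tendsto).comp hlim

lemma smul_mem_descendingTangentSpace {f : M → ℝ} (hf : IsEquivariantMorse n G f)
    {g : SmoothMetric n M} (hg : IsInvariantMetric G g) (σ : G) {p : M}
    {v : TangentSpace (𝓡 n) p} (hv : v ∈ descendingTangentSpace g f p) :
    mfderiv (𝓡 n) (𝓡 n) (fun x : M => σ • x) p v ∈ descendingTangentSpace g f (σ • p) := by
  obtain ⟨γ, hγ, hD, hvel⟩ := hv
  refine ⟨fun t => σ • γ t, (mdifferentiableAt_smul σ (γ 0)).comp 0 hγ,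
    fun t => smul_mem_descendingManifold hf hg σ (hD t), ?_⟩
  have h := congrArg (tangentMap (𝓡 n) (𝓡 n) (fun x : M => σ • x)) hvel
  refine Eq.trans ?_ h
  rw [mfderiv_smul_curve σ hγ]
  rfl

/-- The disjoint union `⋃ D(T_p 𝒟)`, over the critical points `p` with critical value `c`, of the
closed unit discs in the descending tangent spaces, as a `G`-invariant subspace of the tangent
bundle. -/
noncomputable def descendingDiscs {f : M → ℝ} (hf : IsEquivariantMorse n G f)
    {g : SmoothMetric n M} (hg : IsInvariantMetric G g) (c : ℝ) :
    SubMulAction G (TangentBundle (𝓡 n) M) where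
  carrier := {x | x.proj ∈ criticalPointsAt n f c ∧ x.2 ∈ descendingTangentSpace g f x.proj ∧
    g.inner x.proj x.2 x.2 ≤ 1}
  smul_mem' σ x hx :=
    ⟨⟨smul_mem_criticalPoints hf σ hx.1.1, (hf.invariant σ x.proj).trans hx.1.2⟩,
      smul_mem_descendingTangentSpace hf hg σ hx.2.1,
      (hg σ x.proj x.2 x.2).trans_le hx.2.2⟩

/-- The disjoint union `⋃ S(T_p 𝒟)` of the unit spheres in the descending tangent spaces at the
critical points `p` with critical value `c`. -/
noncomputable def descendingSpheres {f : M → ℝ} (hf : IsEquivariantMorse n G f)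
    {g : SmoothMetric n M} (hg : IsInvariantMetric G g) (c : ℝ) :
    SubMulAction G (TangentBundle (𝓡 n) M) where
  carrier := {x | x.proj ∈ criticalPointsAt n f c ∧ x.2 ∈ descendingTangentSpace g f x.proj ∧
    g.inner x.proj x.2 x.2 = 1}
  smul_mem' σ x hx :=
    ⟨⟨smul_mem_criticalPoints hf σ hx.1.1, (hf.invariant σ x.proj).trans hx.1.2⟩,
      smul_mem_descendingTangentSpace hf hg σ hx.2.1,
      (hg σ x.proj x.2 x.2).trans hx.2.2⟩

lemma descendingSpheres_subset {f : M → ℝ} (hf : IsEquivariantMorse n G f)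
    {g : SmoothMetric n M} (hg : IsInvariantMetric G g) (c : ℝ) :
    (descendingSpheres hf hg c : Set (TangentBundle (𝓡 n) M)) ⊆ descendingDiscs hf hg c :=
  fun _ hx => ⟨hx.1, hx.2.1, hx.2.2.le⟩

/-- The `G`-space `f⁻¹(-∞, a] ∪_φ ⋃ D(T_p 𝒟)`, obtained by attaching the unit discs in the
descending tangent spaces at the critical points with critical value `c` along an equivariant map
`φ` defined on their unit spheres. -/
abbrev CellAttachment {f : M → ℝ} (hf : IsEquivariantMorse n G f)
    {g : SmoothMetric n M} (hg : IsInvariantMetric G g) (a c : ℝ)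
    (φ : EquivariantMap G (descendingSpheres hf hg c) (sublevel hf a)) : Type _ :=
  Adjunction (inclusionMap (descendingSpheres_subset hf hg c)) φ

end Descending

end EquivariantMorse

open EquivariantMorse

/-! Everything is done by flows of equivariant vector fields. If `Z ⊆ Y` are forward invariant and a
function decreases strictly on a compact set containing `Y \ Z`, then one time `T` carries all of
`Y` into `Z`. The time-`T` map is then an inverse of the inclusion up to equivariant homotopy
(`inclusionMap_isEquivariantHomotopyEquiv`, `exists_time_of_deriv_neg`). Suitable fields exist
because "`f` decreases, and the field is prescribed near the critical points" is a convex condition,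
so it survives partitions of unity and averaging over the finite group (`exists_gradientLike`).

No Morse lemma is used. Averaging charts over the group gives charts around the critical points in
which the action is linear. Simultaneous diagonalisation of the Hessian and an invariant form makes
the action isometric, commuting with the reflection `signL` that represents the Hessian; in small
balls `f` is C¹-close to its quadratic part (`MorseCharts`, `exists_morseCharts`).

Statement 1 is immediate. For 2 and 3 a radial term is added to the linear field so that, in a shell
around radius `R / 2`, the squared radius has derivative exactly `-4 (f - c)`. Orbits then cannot
enter the balls below the critical level and cannot leave them above it, so the sets in question are
forward invariant.

For 4, `f` is replaced by a function `h` with the same sublevel sets at `a` and `b` which is exactly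
quadratic near the critical points at level `c`, where the flow is made linear (`LevelModel`). The
flow carries `h⁻¹(-∞, b]` into a low sublevel set together with small neighbourhoods of the critical
points, and contracting the positive coordinates of the latter gives a low sublevel set together
with descending discs. Flowing the low part on into `f⁻¹(-∞, a]` produces the attaching map
(`exists_attachingMap_of_flow`, `exists_cellAttachment`).

The discs of the statement are unit discs for `g` in the tangent space of the descending manifold of
`-∇f`, whereas the discs above are round discs in the negative coordinates of a chart.
`MorseCharts.mem_descendingTangentSpace_iff` identifies the two linear spaces: the descending
manifold lies in arbitrarily thin cones around the negative directions, and a Lyapunov–Perron fixed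
point argument yields points of it with any prescribed small unstable coordinates. These two facts
give the tangent space without constructing the descending manifold as a submanifold. The map
`discMap` then rescales each ray so that the `g`-unit sphere becomes a round sphere. -/

namespace EquivariantMorse

/-! ### Homotopy equivalences from flows -/

section FlowTopology

open Set Topology

/-- Forward invariant subsets `Z ⊆ Y` such that the flow carries `Y` into `Z` in finite time are
equivariantly homotopy equivalent. -/
theorem inclusionMap_isEquivariantHomotopyEquiv {G X : Type*} [TopologicalSpace X] [Group G]
    [MulAction G X] {Z Y : SubMulAction G X} (h : (Z : Set X) ⊆ Y) {Φ : ℝ → X → X}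
    (hΦ : Continuous fun p : ℝ × X => Φ p.1 p.2) (h0 : ∀ x, Φ 0 x = x)
    (hG : ∀ t (σ : G) x, Φ t (σ • x) = σ • Φ t x) {T : ℝ} (hT : 0 ≤ T)
    (hZ : ∀ t, 0 ≤ t → ∀ x ∈ Z, Φ t x ∈ Z) (hY : ∀ t, 0 ≤ t → ∀ x ∈ Y, Φ t x ∈ Y)
    (hYZ : ∀ x ∈ Y, Φ T x ∈ Z) : IsEquivariantHomotopyEquiv (inclusionMap h) := by
  have hpos : ∀ t : unitInterval, 0 ≤ (1 - (t : ℝ)) * T := fun t =>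
    mul_nonneg (by linarith [t.2.2]) hT
  -- Both composites are restrictions of the time-`T` map, and `Φ ((1 - t) * T)` joins them to the
  -- identity inside the forward invariant sets.
  refine ⟨⟨⟨fun y => ⟨Φ T y, hYZ y y.2⟩, ?_⟩, fun σ y => Subtype.ext (hG T σ y)⟩, ?_, ?_⟩
  · exact (hΦ.comp (continuous_const.prodMk continuous_subtype_val)).subtype_mk _
  · refine ⟨⟨⟨fun p => ⟨Φ ((1 - (p.1 : ℝ)) * T) p.2, hZ _ (hpos p.1) _ p.2.2⟩, ?_⟩, ?_, ?_⟩, ?_⟩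
    · exact (hΦ.comp (f := fun p : unitInterval × Z => ((1 - (p.1 : ℝ)) * T, (p.2 : X)))
        (by fun_prop)).subtype_mk _
    · intro x
      refine Subtype.ext ?_
      change Φ ((1 - ((0 : unitInterval) : ℝ)) * T) x = Φ T x
      simp
    · intro x
      refine Subtype.ext ?_
      change Φ ((1 - ((1 : unitInterval) : ℝ)) * T) x = x
      simp [h0]
    · exact fun t σ x => Subtype.ext (hG _ σ x)
  · refine ⟨⟨⟨fun p => ⟨Φ ((1 - (p.1 : ℝ)) * T) p.2, hY _ (hpos p.1) _ p.2.2⟩, ?_⟩, ?_, ?_⟩, ?_⟩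
    · exact (hΦ.comp (f := fun p : unitInterval × Y => ((1 - (p.1 : ℝ)) * T, (p.2 : X)))
        (by fun_prop)).subtype_mk _
    · intro x
      refine Subtype.ext ?_
      change Φ ((1 - ((0 : unitInterval) : ℝ)) * T) x = Φ T x
      simp
    · intro x
      refine Subtype.ext ?_
      change Φ ((1 - ((1 : unitInterval) : ℝ)) * T) x = x
      simp [h0]
    · exact fun t σ x => Subtype.ext (hG _ σ x)

/-- Criterion for `Y` to be obtained from `A` by attaching `D` along `S`. The disc `D` is embedded
in `Y` by `θ`, with `S` the part of `D` in `L`; the flow carries `L` into `A` in time `T`, and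
the flow followed by the deformation `κ` carries `Y` into `L ∪ θ(D)`. -/
theorem exists_attachingMap_of_flow {G S D M : Type*} [TopologicalSpace S] [TopologicalSpace D]
    [TopologicalSpace M] [Group G] [MulAction G S] [MulAction G D] [MulAction G M] [T2Space M]
    [CompactSpace D] (i : EquivariantMap G S D) {A Y : SubMulAction G M} {L : Set M}
    (hL : IsClosed L) {Φ : ℝ → M → M}
    (hΦ : Continuous fun p : ℝ × M => Φ p.1 p.2) (h0 : ∀ x, Φ 0 x = x)
    (hadd : ∀ s t x, Φ (s + t) x = Φ s (Φ t x))
    (hG : ∀ t (σ : G) x, Φ t (σ • x) = σ • Φ t x) {T : ℝ} (hT : 0 ≤ T)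
    {θ : D → M} (hθ : Continuous θ) (hinj : Function.Injective θ)
    (hθG : ∀ (σ : G) d, θ (σ • d) = σ • θ d) (hLG : ∀ (σ : G), ∀ x ∈ L, σ • x ∈ L)
    (hAL : (A : Set M) ⊆ L) (hLY : L ⊆ (Y : Set M))
    (hA : ∀ t, 0 ≤ t → ∀ x ∈ A, Φ t x ∈ A)
    (hLt : ∀ t, 0 ≤ t → ∀ x ∈ L, Φ t x ∈ L) (hY : ∀ t, 0 ≤ t → ∀ x ∈ Y, Φ t x ∈ Y)
    (hLA : ∀ x ∈ L, Φ T x ∈ A) (hθY : ∀ d, θ d ∈ Y)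
    (hθL : ∀ d, θ d ∈ L ↔ d ∈ range i.toFun)
    (horb : ∀ t, 0 ≤ t → ∀ d, Φ t (θ d) ∈ L ∪ range θ)
    {κ : ℝ → M → M} (hκ : Continuous fun p : ℝ × M => κ p.1 p.2) (hκ0 : ∀ x, κ 0 x = x)
    (hκG : ∀ t (σ : G) x, κ t (σ • x) = σ • κ t x)
    (hκY : ∀ t ∈ Icc (0 : ℝ) 1, ∀ x ∈ Y, κ t x ∈ Y)
    (hκ1 : ∀ x ∈ Y, κ 1 (Φ T x) ∈ L ∪ range θ) (hκA : ∀ x ∈ A, κ 1 x = x)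
    (hκθ : ∀ t, 0 ≤ t → ∀ d, κ 1 (Φ t (θ d)) = Φ t (θ d)) :
    ∃ (φ : EquivariantMap G S A) (J : EquivariantMap G (Adjunction i φ) Y),
      IsEquivariantHomotopyEquiv J ∧ ∀ x : A, (J.toFun (Adjunction.base i φ x) : M) = x := by
  have hcΦ : ∀ t, Continuous (Φ t) := fun t => hΦ.comp (continuous_const.prodMk continuous_id)
  have hcκ : ∀ t, Continuous (κ t) := fun t => hκ.comp (continuous_const.prodMk continuous_id)
  have hiL : ∀ s, θ (i.toFun s) ∈ L := fun s => (hθL _).2 ⟨s, rfl⟩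
  -- The boundary of the disc lies only in `L`, so it is pushed into `A` by the flow.
  let φ : EquivariantMap G S A :=
    { toFun := fun s => ⟨Φ T (θ (i.toFun s)), hLA _ (hiL s)⟩
      continuous_toFun := ((hcΦ T).comp (hθ.comp i.continuous_toFun)).subtype_mk _
      map_smul' := fun σ s => Subtype.ext (by
        change Φ T (θ (i.toFun (σ • s))) = σ • Φ T (θ (i.toFun s))
        rw [i.map_smul', hθG, hG]) }
  let mk : A ⊕ D → Adjunction i φ := Quot.mk _
  have hmk : Continuous mk := continuous_quot_mk
  have hquot : IsQuotientMap mk := isQuotientMap_quot_mk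
  have hmkG : ∀ (σ : G) (x : A ⊕ D), σ • mk x = mk (Sum.map (σ • ·) (σ • ·) x) := fun _ _ => rfl
  have hglue : ∀ s, mk (Sum.inr (i.toFun s)) = mk (Sum.inl (φ.toFun s)) := fun s =>
    Quot.sound (AttachRel.glue s)
  -- The disc is pushed by the same time `T`, which makes `J` compatible with the gluing while it
  -- remains the inclusion on `A`.
  let J : EquivariantMap G (Adjunction i φ) Y :=
    { toFun := Quot.lift (Sum.elim (fun x => ⟨x.1, hLY (hAL x.2)⟩)
        (fun d => ⟨Φ T (θ d), hY T hT _ (hθY d)⟩)) (by rintro _ _ ⟨s⟩; rfl)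
      continuous_toFun := by
        refine hquot.continuous_iff.2 (continuous_sum_dom.2 ⟨?_, ?_⟩)
        · exact continuous_subtype_val.subtype_mk _
        · exact ((hcΦ T).comp hθ).subtype_mk _
      map_smul' := fun σ x => by
        induction x using Quot.ind with
        | mk x =>
          cases x with
          | inl x => rfl
          | inr d => exact Subtype.ext ((congrArg (Φ T) (hθG σ d)).trans (hG T σ (θ d))) }
  let V : Set M := L ∪ range θ
  classical
  -- On `L` this is the flow into `A`, on the disc the inverse of `θ`. The two prescriptions agree
  -- on the overlap because the attaching map is `Φ T ∘ θ`.
  let k : V → Adjunction i φ := fun z =>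
    if h : z.1 ∈ L then mk (Sum.inl ⟨Φ T z.1, hLA _ h⟩)
    else mk (Sum.inr (z.2.resolve_left h).choose)
  have hkL : ∀ (z : V) (h : z.1 ∈ L), k z = mk (Sum.inl ⟨Φ T z.1, hLA _ h⟩) := fun z h => dif_pos h
  have hkθ : ∀ (z : V) (d : D), θ d = z.1 → k z = mk (Sum.inr d) := by
    rintro ⟨_, hz⟩ d rfl
    by_cases h : θ d ∈ L
    · obtain ⟨s, rfl⟩ := (hθL d).1 h
      rw [hkL _ h, hglue]
    · have h1 : k ⟨θ d, hz⟩ = mk (Sum.inr (hz.resolve_left h).choose) := dif_neg h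
      rw [h1, hinj (hz.resolve_left h).choose_spec]
  have hkc : Continuous k := by
    -- As `L` is closed and `D` compact, `L ∪ θ(D)` carries the quotient topology from `L ⊔ D`, so
    -- continuity of `k` can be checked on the two pieces.
    let q : L ⊕ D → V := Sum.elim (fun x => ⟨x.1, Or.inl x.2⟩) (fun d => ⟨θ d, Or.inr ⟨d, rfl⟩⟩)
    have hq : IsQuotientMap q := by
      have hc : Continuous q := by
        refine continuous_sum_dom.2 ⟨?_, ?_⟩
        · exact continuous_subtype_val.subtype_mk _
        · exact hθ.subtype_mk _
      refine IsClosedMap.isQuotientMap ?_ hc ?_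
      · refine isClosedMap_sum.2 ⟨?_, ?_⟩
        · intro K hK
          have h1 := hL.isClosedMap_subtype_val K hK
          have h2 : (fun a => q (Sum.inl a)) '' K = Subtype.val ⁻¹' (Subtype.val '' K) := by
            ext z
            constructor
            · rintro ⟨x, hx, rfl⟩
              exact ⟨x, hx, rfl⟩
            · rintro ⟨x, hx, hxz⟩
              exact ⟨x, hx, Subtype.ext hxz⟩
          rw [h2]
          exact h1.preimage continuous_subtype_val
        · exact (hθ.subtype_mk _).isClosedMap
      · rintro ⟨z, hz | ⟨d, rfl⟩⟩
        · exact ⟨Sum.inl ⟨z, hz⟩, rfl⟩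
        · exact ⟨Sum.inr d, rfl⟩
    rw [hq.continuous_iff]
    have h1 : k ∘ q = Sum.elim (fun x => mk (Sum.inl ⟨Φ T x.1, hLA _ x.2⟩))
        (fun d => mk (Sum.inr d)) := by
      funext x
      cases x with
      | inl x => exact hkL _ x.2
      | inr d => exact hkθ _ d rfl
    rw [h1]
    refine continuous_sum_dom.2 ⟨?_, ?_⟩
    · exact hmk.comp (continuous_inl.comp (((hcΦ T).comp continuous_subtype_val).subtype_mk _))
    · exact hmk.comp continuous_inr
  have hkG : ∀ (σ : G) (z w : V), w.1 = σ • z.1 → k w = σ • k z := by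
    rintro σ ⟨z, hz⟩ ⟨w, hw⟩ h
    simp only at h
    subst h
    rcases hz with hz' | ⟨d, rfl⟩
    · have hz : z ∈ V := Or.inl hz'
      rw [hkL ⟨z, hz⟩ hz', hkL ⟨σ • z, hw⟩ (hLG σ z hz'), hmkG]
      exact congrArg (fun y => mk (Sum.inl y)) (Subtype.ext (hG T σ z))
    · have hz : θ d ∈ V := Or.inr ⟨d, rfl⟩
      rw [hkθ ⟨θ d, hz⟩ d rfl, hkθ ⟨σ • θ d, hw⟩ (σ • d) (hθG σ d), hmkG]
      rfl
  have hJk : ∀ z : V, (J.toFun (k z) : M) = Φ T z.1 := by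
    rintro ⟨z, hz⟩
    rcases hz with hz' | ⟨d, rfl⟩
    · have hz : z ∈ V := Or.inl hz'
      rw [hkL ⟨z, hz⟩ hz']
      rfl
    · have hz : θ d ∈ V := Or.inr ⟨d, rfl⟩
      rw [hkθ ⟨θ d, hz⟩ d rfl]
      rfl
  -- The inverse flows, collapses into `L ∪ θ(D)` and then applies `k`.
  let K : EquivariantMap G Y (Adjunction i φ) :=
    { toFun := fun y => k ⟨κ 1 (Φ T y), hκ1 y y.2⟩
      continuous_toFun := hkc.comp
        (((hcκ 1).comp ((hcΦ T).comp continuous_subtype_val)).subtype_mk _)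
      map_smul' := fun σ y => by
        refine hkG σ _ _ ?_
        change κ 1 (Φ T (σ • (y : M))) = σ • κ 1 (Φ T y)
        rw [hG, hκG] }
  have hpos : ∀ t : unitInterval, 0 ≤ (1 - (t : ℝ)) * (T + T) := fun t =>
    mul_nonneg (by linarith [t.2.2]) (by linarith)
  have hpos' : ∀ t : unitInterval, 0 ≤ (1 - (t : ℝ)) * T := fun t =>
    mul_nonneg (by linarith [t.2.2]) (by linarith)
  refine ⟨φ, J, ⟨K, ?_, ?_⟩, fun x => rfl⟩
  -- The composite `K ∘ J` amounts to flowing for time `T + T`: `κ 1` fixes the orbits of the disc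
  -- and the points of `A`. The homotopy shrinks this time to zero, and on the disc the orbit is
  -- read through `k`. The two formulas match on the boundary since the flow maps commute.
  · let H : unitInterval × Adjunction i φ → Adjunction i φ := fun p => Quot.lift
      (Sum.elim (fun x : A => mk (Sum.inl ⟨Φ ((1 - (p.1 : ℝ)) * (T + T)) x, hA _ (hpos p.1) x x.2⟩))
        (fun d => k ⟨Φ ((1 - (p.1 : ℝ)) * (T + T)) (θ d), horb _ (hpos p.1) d⟩)) (by
        rintro _ _ ⟨s⟩
        refine (hkL _ (hLt _ (hpos p.1) _ (hiL s))).trans ?_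
        refine congrArg (fun y => mk (Sum.inl y)) (Subtype.ext ?_)
        change Φ T (Φ _ (θ (i.toFun s))) = Φ _ (Φ T (θ (i.toFun s)))
        rw [← hadd, ← hadd, add_comm]) p.2
    have hH : Continuous H := by
      -- The unit interval is locally compact, so the product with it preserves the quotient map.
      refine hquot.continuous_lift_prod_right ?_
      rw [← (Homeomorph.prodSumDistrib (X := unitInterval) (Y := A) (Z := D)).symm.comp_continuous_iff']
      refine continuous_sum_dom.2 ⟨?_, ?_⟩
      · refine hmk.comp (continuous_inl.comp (Continuous.subtype_mk (hΦ.comp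
          (f := fun p : unitInterval × A => ((1 - (p.1 : ℝ)) * (T + T), (p.2 : M))) (by fun_prop)) _))
      · refine hkc.comp (Continuous.subtype_mk (hΦ.comp
          (f := fun p : unitInterval × D => ((1 - (p.1 : ℝ)) * (T + T), θ p.2)) (by fun_prop)) _)
    refine ⟨⟨⟨H, hH⟩, ?_, ?_⟩, ?_⟩
    · intro x
      induction x using Quot.ind with
      | mk x =>
        cases x with
        | inl x =>
          change mk (Sum.inl _) = k ⟨κ 1 (Φ T x.1), _⟩
          have h1 : κ 1 (Φ T x.1) = Φ T x.1 := hκA _ (hA T hT _ x.2)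
          have h2 : κ 1 (Φ T x.1) ∈ L := by
            rw [h1]
            exact hAL (hA T hT _ x.2)
          rw [hkL _ h2]
          refine congrArg (fun y => mk (Sum.inl y)) (Subtype.ext ?_)
          change Φ ((1 - ((0 : unitInterval) : ℝ)) * (T + T)) x = Φ T (κ 1 (Φ T x))
          rw [h1, ← hadd]
          simp
        | inr d =>
          change k _ = k _
          refine congrArg k (Subtype.ext ?_)
          change Φ ((1 - ((0 : unitInterval) : ℝ)) * (T + T)) (θ d) = κ 1 (Φ T (Φ T (θ d)))
          rw [← hadd, hκθ _ (by linarith)]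
          simp
    · intro x
      induction x using Quot.ind with
      | mk x =>
        cases x with
        | inl x =>
          refine congrArg (fun y => mk (Sum.inl y)) (Subtype.ext ?_)
          change Φ ((1 - ((1 : unitInterval) : ℝ)) * (T + T)) x = x
          simp [h0]
        | inr d =>
          refine hkθ _ d ?_
          change θ d = Φ ((1 - ((1 : unitInterval) : ℝ)) * (T + T)) (θ d)
          simp [h0]
    · intro t σ x
      induction x using Quot.ind with
      | mk x =>
        cases x with
        | inl x =>
          exact congrArg (fun y => mk (Sum.inl y)) (Subtype.ext (hG _ σ x))
        | inr d =>
          refine hkG σ _ _ ?_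
          change Φ _ (θ (σ • d)) = σ • Φ _ (θ d)
          rw [hθG, hG]
  · -- `J ∘ K = Φ_T ∘ κ₁ ∘ Φ_T`
    have hmem : ∀ (t : unitInterval) (y : Y), Φ ((1 - (t : ℝ)) * T) (κ (1 - (t : ℝ))
        (Φ ((1 - (t : ℝ)) * T) y)) ∈ Y := fun t y =>
      hY _ (hpos' t) _ (hκY _ ⟨by linarith [t.2.2], by linarith [t.2.1]⟩ _ (hY _ (hpos' t) _ y.2))
    refine ⟨⟨⟨fun p => ⟨_, hmem p.1 p.2⟩, ?_⟩, ?_, ?_⟩, ?_⟩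
    · refine Continuous.subtype_mk ?_ _
      have h1 : Continuous fun p : unitInterval × Y => Φ ((1 - (p.1 : ℝ)) * T) (p.2 : M) :=
        hΦ.comp (f := fun p : unitInterval × Y => ((1 - (p.1 : ℝ)) * T, (p.2 : M))) (by fun_prop)
      have h2 : Continuous fun p : unitInterval × Y => κ (1 - (p.1 : ℝ)) (Φ ((1 - (p.1 : ℝ)) * T) (p.2 : M)) :=
        hκ.comp (f := fun p : unitInterval × Y => (1 - (p.1 : ℝ), Φ ((1 - (p.1 : ℝ)) * T) (p.2 : M)))
          (by fun_prop)
      exact hΦ.comp (f := fun p : unitInterval × Y => ((1 - (p.1 : ℝ)) * T,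
        κ (1 - (p.1 : ℝ)) (Φ ((1 - (p.1 : ℝ)) * T) (p.2 : M)))) (by fun_prop)
    · intro y
      refine Subtype.ext ?_
      change _ = ((J.toFun (k _) : Y) : M)
      rw [hJk]
      simp
    · intro y
      refine Subtype.ext ?_
      simp [h0, hκ0]
    · intro t σ y
      refine Subtype.ext ?_
      change Φ _ (κ _ (Φ _ (σ • (y : M)))) = σ • Φ _ (κ _ (Φ _ (y : M)))
      rw [hG, hκG, hG]

end FlowTopology

end EquivariantMorse

namespace EquivariantMorse

/-- The model space `ℝⁿ`. -/
abbrev Euc (n : ℕ) : Type := EuclideanSpace ℝ (Fin n)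

/-! ### Vector fields in charts, and flows -/

section Flow

open Set Filter

variable {n : ℕ} {M : Type*} [TopologicalSpace M] [ChartedSpace (Euc n) M]
  [IsManifold (𝓡 n) ∞ M]

/-- A vector field is smooth. -/
abbrev SmoothField (X : (x : M) → TangentSpace (𝓡 n) x) : Prop :=
  ContMDiff (𝓡 n) (𝓡 n).tangent ∞ (fun x => (⟨x, X x⟩ : TangentBundle (𝓡 n) M))

lemma mdifferentiable_of_mem_maximalAtlas {e : OpenPartialHomeomorph M (Euc n)}
    (he : e ∈ IsManifold.maximalAtlas (𝓡 n) ∞ M) : e.MDifferentiable (𝓡 n) (𝓡 n) :=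
  ⟨(contMDiffOn_of_mem_maximalAtlas he).mdifferentiableOn (by simp),
    (contMDiffOn_symm_of_mem_maximalAtlas he).mdifferentiableOn (by simp)⟩

/-- The expression of the vector field `X` in the chart `e`. -/
noncomputable def chartField (e : OpenPartialHomeomorph M (Euc n))
    (X : (x : M) → TangentSpace (𝓡 n) x) (y : Euc n) : Euc n :=
  mfderiv (𝓡 n) (𝓡 n) e (e.symm y) (X (e.symm y))

variable {e : OpenPartialHomeomorph M (Euc n)} (he : e ∈ IsManifold.maximalAtlas (𝓡 n) ∞ M)
  {X : (x : M) → TangentSpace (𝓡 n) x}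

include he

lemma isInvertible_mfderiv_chart {x : M} (hx : x ∈ e.source) :
    (mfderiv (𝓡 n) (𝓡 n) e x).IsInvertible :=
  ⟨(mdifferentiable_of_mem_maximalAtlas he).mfderiv hx, rfl⟩

lemma isInvertible_mfderiv_chart_symm {y : Euc n} (hy : y ∈ e.target) :
    (mfderiv (𝓡 n) (𝓡 n) e.symm y).IsInvertible :=
  ⟨(mdifferentiable_of_mem_maximalAtlas he).symm.mfderiv hy, rfl⟩

lemma mfderiv_chart_symm_chart {x : M} (hx : x ∈ e.source) (v : TangentSpace (𝓡 n) x) :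
    mfderiv (𝓡 n) (𝓡 n) e.symm (e x) (mfderiv (𝓡 n) (𝓡 n) e x v) = v :=
  congrArg (fun L => L v) ((mdifferentiable_of_mem_maximalAtlas he).symm_comp_deriv hx)

lemma mfderiv_chart_chart_symm {y : Euc n} (hy : y ∈ e.target)
    (v : TangentSpace (𝓡 n) y) :
    mfderiv (𝓡 n) (𝓡 n) e (e.symm y) (mfderiv (𝓡 n) (𝓡 n) e.symm y v) = v :=
  congrArg (fun L => L v) ((mdifferentiable_of_mem_maximalAtlas he).comp_symm_deriv hy)

/-- The chart expression is the pullback of `X` along `e.symm`, because the derivatives of `e` and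
`e.symm` are mutually inverse. -/
lemma contDiffAt_chartField (hX : SmoothField X) {y : Euc n} (hy : y ∈ e.target) :
    ContDiffAt ℝ ∞ (chartField e X) y := by
  have h1 : ContMDiffAt (𝓡 n) (𝓡 n).tangent ∞ (fun y => (⟨y, VectorField.mpullback (𝓡 n) (𝓡 n)
      e.symm X y⟩ : TangentBundle (𝓡 n) (Euc n))) y :=
    ContMDiffAt.mpullback_vectorField_preimage (hX (e.symm y))
      (contMDiffAt_symm_of_mem_maximalAtlas he hy) (isInvertible_mfderiv_chart_symm he hy)
      (by simp)
  have h2 := contMDiffAt_vectorSpace_iff_contDiffAt.1 h1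
  refine h2.congr_of_eventuallyEq ?_
  filter_upwards [e.open_target.mem_nhds hy] with z hz
  change _ = (mfderiv (𝓡 n) (𝓡 n) e.symm z).inverse (X (e.symm z))
  obtain ⟨A, hA⟩ := isInvertible_mfderiv_chart_symm he hz
  have h3 := mfderiv_chart_symm_chart he (e.map_target hz) (X (e.symm z))
  rw [e.right_inv hz] at h3
  rw [← h3, ← hA, ContinuousLinearMap.inverse_equiv]
  exact (A.symm_apply_apply _).symm

/-- Together with `hasDerivAt_chart` this transports integral curves between a chart and the
manifold, so that ODE arguments take place in `ℝⁿ`. -/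
lemma hasMFDerivAt_chart_symm {y : ℝ → Euc n} {t : ℝ}
    (hy : HasDerivAt y (chartField e X (y t)) t) (ht : y t ∈ e.target) :
    HasMFDerivAt 𝓘(ℝ, ℝ) (𝓡 n) (fun s => e.symm (y s)) t
      ((1 : ℝ →L[ℝ] ℝ).smulRight (X (e.symm (y t)))) := by
  have h1 : HasMFDerivAt 𝓘(ℝ, ℝ) (𝓡 n) y t
      ((1 : ℝ →L[ℝ] ℝ).smulRight (chartField e X (y t))) :=
    hasMFDerivAt_iff_hasFDerivAt.2 hy.hasFDerivAt
  have h2 := ((mdifferentiable_of_mem_maximalAtlas he).mdifferentiableAt_symm ht).hasMFDerivAt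
  refine (h2.comp t h1).congr_mfderiv ?_
  ext
  change mfderiv (𝓡 n) (𝓡 n) e.symm (y t) ((1 : ℝ) • chartField e X (y t)) =
    (1 : ℝ) • X (e.symm (y t))
  rw [one_smul, one_smul]
  have h3 := mfderiv_chart_symm_chart he (e.map_target ht) (X (e.symm (y t)))
  rw [e.right_inv ht] at h3
  exact h3

lemma hasDerivAt_chart {γ : ℝ → M} {t : ℝ}
    (hγ : HasMFDerivAt 𝓘(ℝ, ℝ) (𝓡 n) γ t ((1 : ℝ →L[ℝ] ℝ).smulRight (X (γ t))))
    (ht : γ t ∈ e.source) :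
    HasDerivAt (fun s => e (γ s)) (chartField e X (e (γ t))) t := by
  have h2 := ((mdifferentiable_of_mem_maximalAtlas he).mdifferentiableAt ht).hasMFDerivAt
  have h3 : HasFDerivAt (fun s => e (γ s)) ((mfderiv (𝓡 n) (𝓡 n) e (γ t)).comp
      ((1 : ℝ →L[ℝ] ℝ).smulRight (X (γ t))) : ℝ →L[ℝ] Euc n) t :=
    hasMFDerivAt_iff_hasFDerivAt.1 (h2.comp t hγ)
  refine hasDerivAt_iff_hasFDerivAt.2 (h3.congr_fderiv ?_)
  ext1
  change mfderiv (𝓡 n) (𝓡 n) e (γ t) ((1 : ℝ) • X (γ t)) = (1 : ℝ) • chartField e X (e (γ t))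
  rw [one_smul, one_smul, chartField, e.left_inv ht]

omit he

lemma hasDerivAt_comp_curve {γ : ℝ → M} {t : ℝ} {h : M → ℝ}
    (hγ : HasMFDerivAt 𝓘(ℝ, ℝ) (𝓡 n) γ t ((1 : ℝ →L[ℝ] ℝ).smulRight (X (γ t))))
    (hh : MDifferentiableAt (𝓡 n) 𝓘(ℝ, ℝ) h (γ t)) :
    HasDerivAt (fun s => h (γ s)) (mfderiv (𝓡 n) 𝓘(ℝ, ℝ) h (γ t) (X (γ t)) : ℝ) t := by
  have h3 : HasFDerivAt (fun s => h (γ s)) ((mfderiv (𝓡 n) 𝓘(ℝ, ℝ) h (γ t)).comp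
      ((1 : ℝ →L[ℝ] ℝ).smulRight (X (γ t))) : ℝ →L[ℝ] ℝ) t :=
    hasMFDerivAt_iff_hasFDerivAt.1 (hh.hasMFDerivAt.comp t hγ)
  refine hasDerivAt_iff_hasFDerivAt.2 (h3.congr_fderiv ?_)
  ext1
  change mfderiv (𝓡 n) 𝓘(ℝ, ℝ) h (γ t) ((1 : ℝ) • X (γ t)) =
    (1 : ℝ) • (mfderiv (𝓡 n) 𝓘(ℝ, ℝ) h (γ t) (X (γ t)) : ℝ)
  rw [one_smul, one_smul]

/-- `Φ` is the flow of the vector field `X`. -/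
structure IsFlow (X : (x : M) → TangentSpace (𝓡 n) x) (Φ : ℝ → M → M) : Prop where
  continuous : Continuous fun p : ℝ × M => Φ p.1 p.2
  zero : ∀ x, Φ 0 x = x
  add : ∀ s t x, Φ (s + t) x = Φ s (Φ t x)
  curve : ∀ x, IsMIntegralCurve (I := 𝓡 n) (fun t => Φ t x) X

variable [T2Space M]

lemma integralCurve_eq (hX : SmoothField X) {γ γ' : ℝ → M} (hγ : IsMIntegralCurve (I := 𝓡 n) γ X)
    (hγ' : IsMIntegralCurve (I := 𝓡 n) γ' X) {t : ℝ} (h : γ t = γ' t) : γ = γ' :=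
  isMIntegralCurve_Ioo_eq_of_contMDiff_boundaryless (t₀ := t) (hX.of_le (by simp)) hγ hγ' h

lemma IsFlow.eq_of_curve (hX : SmoothField X) {Φ : ℝ → M → M} (hΦ : IsFlow X Φ) {γ : ℝ → M}
    (hγ : IsMIntegralCurve (I := 𝓡 n) γ X) (t : ℝ) : γ t = Φ t (γ 0) :=
  congrFun (integralCurve_eq hX hγ (hΦ.curve (γ 0)) (t := 0) (hΦ.zero _).symm) t

/-- Picard–Lindelöf in a chart gives solutions continuous in time and initial value; time and
neighbourhood are shrunk until they stay in the target of the chart. -/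
lemma exists_local_flow (hX : SmoothField X) (x₀ : M) :
    ∃ U ∈ 𝓝 x₀, ∃ ε > 0, ∃ α : M × ℝ → M, ContinuousOn α (U ×ˢ Ioo (-ε) ε) ∧
      ∀ x ∈ U, α (x, 0) = x ∧ IsMIntegralCurveOn (I := 𝓡 n) (fun t => α (x, t)) X (Ioo (-ε) ε) := by
  let e := chartAt (Euc n) x₀
  have he : e ∈ IsManifold.maximalAtlas (𝓡 n) ∞ M := IsManifold.chart_mem_maximalAtlas x₀
  have hx₀ : x₀ ∈ e.source := mem_chart_source _ x₀
  have hF : ContDiffAt ℝ 1 (chartField e X) (e x₀) :=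
    (contDiffAt_chartField he hX (e.map_source hx₀)).of_le (by simp)
  obtain ⟨ε, hε, a, r, L, K, hr, hpl⟩ := IsPicardLindelof.of_contDiffAt_one hF
  obtain ⟨α, hα, hαc⟩ := (hpl 0).exists_forall_mem_closedBall_eq_hasDerivWithinAt_continuousOn
  simp only [zero_sub, zero_add] at hαc hα
  have h1 : (Metric.closedBall (e x₀) r ×ˢ Icc (-ε) ε) ∈ 𝓝 (e x₀, (0 : ℝ)) :=
    prod_mem_nhds (Metric.closedBall_mem_nhds _ hr) (Icc_mem_nhds (by linarith) hε)
  have h2 : ContinuousAt α (e x₀, 0) := hαc.continuousAt h1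
  have h3 : α (e x₀, 0) = e x₀ := (hα _ (Metric.mem_closedBall_self r.2)).1
  have h4 : α ⁻¹' e.target ∈ 𝓝 (e x₀, (0 : ℝ)) :=
    h2 (e.open_target.mem_nhds (by rw [h3]; exact e.map_source hx₀))
  obtain ⟨U, hU, I, hI, hUI⟩ := mem_nhds_prod_iff.1 (inter_mem h4 h1)
  obtain ⟨δ, hδ, hδI⟩ := Metric.mem_nhds_iff.1 hI
  rw [Real.ball_eq_Ioo, zero_sub, zero_add] at hδI
  have hsub : ∀ x ∈ e.source ∩ e ⁻¹' U, ∀ t ∈ Ioo (-δ) δ,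
      (e x, t) ∈ α ⁻¹' e.target ∩ Metric.closedBall (e x₀) r ×ˢ Icc (-ε) ε := fun x hx t ht =>
    hUI ⟨hx.2, hδI ht⟩
  refine ⟨e.source ∩ e ⁻¹' U, inter_mem (e.open_source.mem_nhds hx₀)
    ((e.continuousAt hx₀) hU), min ε δ, lt_min hε hδ, fun p => e.symm (α (e p.1, p.2)), ?_, ?_⟩
  · refine e.continuousOn_symm.comp (hαc.comp (t := Metric.closedBall (e x₀) r ×ˢ Icc (-ε) ε)
      (f := fun p : M × ℝ => (e p.1, p.2)) ?_ ?_) ?_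
    · exact (e.continuousOn.comp continuousOn_fst fun p hp => hp.1.1).prodMk continuousOn_snd
    · intro p hp
      exact (hsub p.1 hp.1 p.2 (Ioo_subset_Ioo (neg_le_neg (min_le_right _ _))
        (min_le_right _ _) hp.2)).2
    · intro p hp
      exact (hsub p.1 hp.1 p.2 (Ioo_subset_Ioo (neg_le_neg (min_le_right _ _))
        (min_le_right _ _) hp.2)).1
  · intro x hx
    have hx0 := hsub x hx 0 ⟨by linarith, hδ⟩
    refine ⟨?_, fun t ht => ?_⟩
    · change e.symm (α (e x, 0)) = x
      rw [(hα _ hx0.2.1).1, e.left_inv hx.1]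
    · have ht' := hsub x hx t (Ioo_subset_Ioo (neg_le_neg (min_le_right _ _))
        (min_le_right _ _) ht)
      have ht'' : t ∈ Ioo (-ε) ε := Ioo_subset_Ioo (neg_le_neg (min_le_left _ _))
        (min_le_left _ _) ht
      exact (hasMFDerivAt_chart_symm he (((hα _ hx0.2.1).2 t ht'.2.2).hasDerivAt
        (Icc_mem_nhds ht''.1 ht''.2)) ht'.1).hasMFDerivWithinAt

/-- A smooth vector field on a compact manifold has a global flow. -/
theorem exists_isFlow [CompactSpace M] (hX : SmoothField X) : ∃ Φ : ℝ → M → M, IsFlow X Φ := by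
  classical
  choose U hU ε hε α hαc hα using fun x₀ : M => exists_local_flow hX x₀
  obtain ⟨s, -, hs⟩ := isCompact_univ.elim_nhds_subcover (fun x => interior (U x)) fun x _ => interior_mem_nhds.2 (hU x)
  -- Finitely many flow boxes have a common existence time, and a uniform existence time lets every
  -- integral curve be continued to all of `ℝ`.
  obtain ⟨δ, hδ, hδs⟩ : ∃ δ > 0, ∀ x ∈ s, δ ≤ ε x := by
    clear hs
    induction s using Finset.induction_on with
    | empty => exact ⟨1, one_pos, by simp⟩
    | insert a s _ ih =>
      obtain ⟨δ, hδ, h⟩ := ih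
      refine ⟨min δ (ε a), lt_min hδ (hε a), fun x hx => ?_⟩
      rcases Finset.mem_insert.1 hx with rfl | hx
      · exact min_le_right _ _
      · exact (min_le_left _ _).trans (h x hx)
  have hX1 : ContMDiff (𝓡 n) (𝓡 n).tangent 1
    (fun x => (⟨x, X x⟩ : TangentBundle (𝓡 n) M)) := hX.of_le (by simp)
  have hloc : ∀ x : M, ∃ γ : ℝ → M, γ 0 = x ∧ IsMIntegralCurveOn (I := 𝓡 n) γ X (Ioo (-δ) δ) := by
    intro x
    obtain ⟨x₀, hx₀, hx⟩ := mem_iUnion₂.1 (hs (mem_univ x))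
    exact ⟨fun t => α x₀ (x, t), (hα x₀ x (interior_subset hx)).1,
      (hα x₀ x (interior_subset hx)).2.mono
      (Ioo_subset_Ioo (neg_le_neg (hδs x₀ hx₀)) (hδs x₀ hx₀))⟩
  choose γ hγ0 hγ using fun x => exists_isMIntegralCurve_of_isMIntegralCurveOn hX1 hδ hloc x
  have hadd : ∀ s t x, γ x (s + t) = γ (γ x t) s := by
    intro s t x
    have h1 := (hγ x).comp_add t
    have h2 := integralCurve_eq hX h1 (hγ (γ x t)) (t := 0) (by simp [hγ0])
    exact congrFun h2 s
  -- For short times the global curves agree by uniqueness with the local flows, which are jointly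
  -- continuous.
  have hsmall : ContinuousOn (fun p : ℝ × M => γ p.2 p.1) (Ioo (-δ) δ ×ˢ univ) := by
    rintro ⟨t, x⟩ ⟨ht, -⟩
    refine ContinuousAt.continuousWithinAt ?_
    -- a neighbourhood of `x` lies in one of the local flow boxes
    obtain ⟨x₁, hx₁, hx⟩ := mem_iUnion₂.1 (hs (mem_univ x))
    have hα' : ∀ y ∈ U x₁, ∀ r ∈ Ioo (-δ) δ, γ y r = α x₁ (y, r) := fun y hy =>
      isMIntegralCurveOn_Ioo_eqOn_of_contMDiff_boundaryless (t₀ := 0) ⟨by linarith, hδ⟩ hX1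
        ((hγ y).isMIntegralCurveOn _) ((hα x₁ y hy).2.mono
          (Ioo_subset_Ioo (neg_le_neg (hδs x₁ hx₁)) (hδs x₁ hx₁)))
        ((hγ0 y).trans (hα x₁ y hy).1.symm)
    have h1 : ContinuousAt (fun p : ℝ × M => α x₁ (p.2, p.1)) (t, x) :=
      ContinuousAt.comp (f := Prod.swap) (g := α x₁) ((hαc x₁).continuousAt
        (prod_mem_nhds (mem_interior_iff_mem_nhds.1 hx)
          (Ioo_mem_nhds (by linarith [ht.1, hδs x₁ hx₁]) (ht.2.trans_le (hδs x₁ hx₁)))))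
        continuous_swap.continuousAt
    refine h1.congr ?_
    filter_upwards [prod_mem_nhds (Ioo_mem_nhds ht.1 ht.2) (mem_interior_iff_mem_nhds.1 hx)]
      with p hp
    exact (hα' p.2 hp.2 p.1 hp.1).symm
  refine ⟨fun t x => γ x t, ?_, hγ0, hadd, hγ⟩
  -- The flow for time `t` is the flow for time `t / 2` applied twice, so the interval of joint
  -- continuity can be doubled repeatedly.
  have hscale : ∀ k : ℕ, ContinuousOn (fun p : ℝ × M => γ p.2 p.1)
      (Ioo (-(δ * 2 ^ k)) (δ * 2 ^ k) ×ˢ univ) := by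
    intro k
    induction k with
    | zero => simpa using hsmall
    | succ k ih =>
      have h1 : ∀ p : ℝ × M, γ p.2 p.1 = γ (γ p.2 (p.1 / 2)) (p.1 / 2) := fun p => by
        rw [← hadd]
        ring_nf
      have hm : ∀ t : ℝ, t ∈ Ioo (-(δ * 2 ^ (k + 1))) (δ * 2 ^ (k + 1)) →
          t / 2 ∈ Ioo (-(δ * 2 ^ k)) (δ * 2 ^ k) := by
        rintro t ⟨h1, h2⟩
        rw [pow_succ] at h1 h2
        constructor <;> linarith
      rw [funext h1]
      have h2 : ContinuousOn (fun p : ℝ × M => γ p.2 (p.1 / 2))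
          (Ioo (-(δ * 2 ^ (k + 1))) (δ * 2 ^ (k + 1)) ×ˢ univ) :=
        ih.comp (f := fun p : ℝ × M => (p.1 / 2, p.2)) (by fun_prop)
          fun p hp => ⟨hm _ hp.1, mem_univ _⟩
      exact ih.comp (f := fun p : ℝ × M => (p.1 / 2, γ p.2 (p.1 / 2)))
        ((by fun_prop : ContinuousOn (fun p : ℝ × M => p.1 / 2) _).prodMk h2)
        fun p hp => ⟨hm _ hp.1, mem_univ _⟩
  rw [continuous_iff_continuousAt]
  rintro ⟨t, x⟩
  obtain ⟨k, hk⟩ := pow_unbounded_of_one_lt (|t| / δ) (one_lt_two)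
  have hk' : |t| < δ * 2 ^ k := by
    rw [div_lt_iff₀ hδ] at hk
    linarith
  exact (hscale k).continuousAt (prod_mem_nhds (Ioo_mem_nhds (abs_lt.1 hk').1 (abs_lt.1 hk').2)
    univ_mem)

end Flow

end EquivariantMorse

namespace EquivariantMorse

/-! ### Simultaneous diagonalisation -/

section Diagonal

open scoped RealInnerProductSpace

variable {n : ℕ}

/-- The diagonal operator with entries `d`. -/
noncomputable def diagL (d : Fin n → ℝ) : Euc n →L[ℝ] Euc n :=
  LinearMap.toContinuousLinearMap
    { toFun := fun y => WithLp.toLp 2 fun i => d i * y i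
      map_add' := fun x y => by ext i; simp [mul_add]
      map_smul' := fun c x => by ext i; simp [mul_left_comm] }

@[simp]
lemma diagL_apply (d : Fin n → ℝ) (y : Euc n) (i : Fin n) : diagL d y i = d i * y i := rfl

/-- The invertible diagonal operator with nonzero entries `d`. -/
noncomputable def diagEquiv (d : Fin n → ℝ) (hd : ∀ i, d i ≠ 0) : Euc n ≃L[ℝ] Euc n :=
  ContinuousLinearEquiv.equivOfInverse (diagL d) (diagL fun i => (d i)⁻¹)
    (fun y => by ext i; simp [hd i]) (fun y => by ext i; simp [hd i])

lemma inner_eq_sum (y z : Euc n) : ⟪y, z⟫ = ∑ i, y i * z i := by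
  simp [PiLp.inner_apply, mul_comm]

lemma inner_diagL (d : Fin n → ℝ) (y z : Euc n) : ⟪diagL d y, z⟫ = ∑ i, d i * y i * z i := by
  simp [inner_eq_sum]

/-- A symmetric bilinear form is diagonal in an orthonormal basis. -/
lemma exists_orthonormal_diagonalization (B : Euc n →L[ℝ] Euc n →L[ℝ] ℝ)
    (hB : ∀ v w, B v w = B w v) : ∃ (b : OrthonormalBasis (Fin n) ℝ (Euc n)) (d : Fin n → ℝ),
    ∀ v w, B v w = ∑ i, d i * b.repr v i * b.repr w i := by
  let T := InnerProductSpace.continuousLinearMapOfBilin (𝕜 := ℝ) B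
  have hT : ∀ v w, ⟪T v, w⟫ = B v w := fun v w =>
    InnerProductSpace.continuousLinearMapOfBilin_apply B v w
  have hsymm : T.toLinearMap.IsSymmetric := fun v w => by
    change ⟪T v, w⟫ = ⟪v, T w⟫
    rw [hT, hB, ← hT, real_inner_comm]
  have hn : Module.finrank ℝ (Euc n) = n := by simp
  refine ⟨hsymm.eigenvectorBasis hn, hsymm.eigenvalues hn, fun v w => ?_⟩
  rw [← hT, ← (hsymm.eigenvectorBasis hn).sum_inner_mul_inner]
  refine Finset.sum_congr rfl fun i _ => ?_
  have h1 : ⟪T v, hsymm.eigenvectorBasis hn i⟫ = ⟪v, T (hsymm.eigenvectorBasis hn i)⟫ := hsymm _ _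
  have h2 : T (hsymm.eigenvectorBasis hn i) =
      (hsymm.eigenvalues hn i : ℝ) • hsymm.eigenvectorBasis hn i := hsymm.apply_eigenvectorBasis hn i
  rw [h1, h2, inner_smul_right, OrthonormalBasis.repr_apply_apply,
    OrthonormalBasis.repr_apply_apply, real_inner_comm v]

/-- A positive definite and a nondegenerate symmetric form are simultaneously diagonalisable. -/
theorem exists_simultaneous_diagonalization (B H : Euc n →L[ℝ] Euc n →L[ℝ] ℝ)
    (hB : ∀ v w, B v w = B w v) (hpos : ∀ v, v ≠ 0 → 0 < B v v) (hH : ∀ v w, H v w = H w v)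
    (hnd : ∀ v, (∀ w, H v w = 0) → v = 0) :
    ∃ (L : Euc n ≃L[ℝ] Euc n) (d : Fin n → ℝ), (∀ i, d i ≠ 0) ∧
      (∀ v w, H v w = ∑ i, Real.sign (d i) * L v i * L w i) ∧
      ∀ v w, B v w = ∑ i, |d i|⁻¹ * L v i * L w i := by
  obtain ⟨b, ν, hb⟩ := exists_orthonormal_diagonalization B hB
  have hν : ∀ i, 0 < ν i := fun i => by
    have h := hpos (b i) (b.orthonormal.ne_zero i)
    rw [hb] at h
    have h2 : ∀ j, b.repr (b i) j = if i = j then 1 else 0 := fun j => by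
      simp [OrthonormalBasis.repr_self, eq_comm]
    simpa [h2] using h
  -- In the coordinates `S` the form `B` is the Euclidean inner product, so `H` can be diagonalised
  -- without disturbing `B`.
  let S : Euc n ≃L[ℝ] Euc n := b.repr.toContinuousLinearEquiv.trans
    (diagEquiv (fun i => √(ν i)) fun i => (Real.sqrt_pos.2 (hν i)).ne')
  have hS : ∀ v i, S v i = √(ν i) * b.repr v i := fun v i => rfl
  have hBS : ∀ v w, B v w = ⟪S v, S w⟫ := fun v w => by
    rw [hb, inner_eq_sum]
    refine Finset.sum_congr rfl fun i _ => ?_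
    rw [hS, hS]
    linear_combination (-(b.repr v i * b.repr w i)) * Real.mul_self_sqrt (hν i).le
  let H' : Euc n →L[ℝ] Euc n →L[ℝ] ℝ := H.bilinearComp (S.symm : Euc n →L[ℝ] Euc n)
    (S.symm : Euc n →L[ℝ] Euc n)
  have hH' : ∀ v w, H v w = H' (S v) (S w) := fun v w => by
    simp [H', ContinuousLinearMap.bilinearComp_apply]
  obtain ⟨c, d, hc⟩ := exists_orthonormal_diagonalization H' fun v w => by
    simp [H', ContinuousLinearMap.bilinearComp_apply, hH (S.symm v)]
  have hd : ∀ i, d i ≠ 0 := fun i hi => by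
    have h : S.symm (c i) = 0 := hnd _ fun w => by
      rw [hH', hc]
      refine Finset.sum_eq_zero fun j _ => ?_
      simp only [ContinuousLinearEquiv.apply_symm_apply, OrthonormalBasis.repr_self]
      by_cases hij : j = i
      · simp [hij, hi]
      · simp [hij]
    exact c.orthonormal.ne_zero i (by simpa using h)
  have hsq : ∀ i, √|d i| ≠ 0 := fun i => (Real.sqrt_pos.2 (abs_pos.2 (hd i))).ne'
  -- The factor `√|d i|` reduces the eigenvalues of `H` to their signs; the price is the weight `|d
  -- i|⁻¹` in `B`.
  let L : Euc n ≃L[ℝ] Euc n := S.trans (c.repr.toContinuousLinearEquiv.trans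
    (diagEquiv (fun i => √|d i|) hsq))
  have hL : ∀ v i, L v i = √|d i| * c.repr (S v) i := fun v i => rfl
  refine ⟨L, d, hd, fun v w => ?_, fun v w => ?_⟩
  · rw [hH', hc]
    refine Finset.sum_congr rfl fun i _ => ?_
    rw [hL, hL]
    have h1 := Real.mul_self_sqrt (abs_nonneg (d i))
    have h2 : Real.sign (d i) * |d i| = d i := by
      rcases lt_or_gt_of_ne (hd i) with h | h
      · rw [Real.sign_of_neg h, abs_of_neg h]; ring
      · rw [Real.sign_of_pos h, abs_of_pos h]; ring
    linear_combination (-(c.repr (S v) i * c.repr (S w) i)) * h2 -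
      Real.sign (d i) * c.repr (S v) i * c.repr (S w) i * h1
  · rw [hBS, ← c.repr.inner_map_map, inner_eq_sum]
    refine Finset.sum_congr rfl fun i _ => ?_
    rw [hL, hL]
    have h1 := Real.mul_self_sqrt (abs_nonneg (d i))
    have h2 : |d i|⁻¹ * |d i| = 1 := inv_mul_cancel₀ (abs_pos.2 (hd i)).ne'
    linear_combination (-(c.repr (S v) i * c.repr (S w) i)) * h2 -
      |d i|⁻¹ * c.repr (S v) i * c.repr (S w) i * h1

/-- An isomorphism between two simultaneously diagonalised pairs of forms is an isometry that
intertwines the signs. -/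
theorem isometry_of_simultaneous_diagonalization (R : Euc n ≃L[ℝ] Euc n) {d d' : Fin n → ℝ}
    (hd : ∀ i, d i ≠ 0) (hd' : ∀ i, d' i ≠ 0)
    (hH : ∀ v w, ∑ i, Real.sign (d' i) * R v i * R w i = ∑ i, Real.sign (d i) * v i * w i)
    (hB : ∀ v w, ∑ i, |d' i|⁻¹ * R v i * R w i = ∑ i, |d i|⁻¹ * v i * w i) :
    (∀ v, ‖R v‖ = ‖v‖) ∧
      ∀ v, diagL (fun i => Real.sign (d' i)) (R v) = R (diagL (fun i => Real.sign (d i)) v) := by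
  have hsign : ∀ a : ℝ, a ≠ 0 → Real.sign a = |a|⁻¹ * a := fun a ha => by
    rcases lt_or_gt_of_ne ha with h | h
    · rw [Real.sign_of_neg h, abs_of_neg h]; field_simp
    · rw [Real.sign_of_pos h, abs_of_pos h]; field_simp
  -- The diagonal operator `d` represents the first form with respect to the second, so a map
  -- preserving both forms intertwines these operators.
  have hcomm : ∀ v, diagL d' (R v) = R (diagL d v) := fun v => by
    have h1 : ∀ w, ∑ i, |d' i|⁻¹ * (diagL d' (R v) - R (diagL d v)) i * R w i = 0 := fun w => by
      have h2 := hB (diagL d v) w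
      have h3 := hH v w
      have h4 : ∑ i, |d i|⁻¹ * diagL d v i * w i = ∑ i, Real.sign (d i) * v i * w i :=
        Finset.sum_congr rfl fun i _ => by rw [hsign _ (hd i), diagL_apply]; ring
      have h5 : ∑ i, |d' i|⁻¹ * diagL d' (R v) i * R w i =
          ∑ i, Real.sign (d' i) * R v i * R w i :=
        Finset.sum_congr rfl fun i _ => by rw [hsign _ (hd' i), diagL_apply]; ring
      simp only [PiLp.sub_apply, mul_sub, sub_mul, Finset.sum_sub_distrib]
      rw [h5, h3, h2, h4, sub_self]
    have h2 := h1 (R.symm (diagL d' (R v) - R (diagL d v)))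
    rw [ContinuousLinearEquiv.apply_symm_apply] at h2
    rw [Finset.sum_eq_zero_iff_of_nonneg] at h2
    · refine sub_eq_zero.1 ?_
      ext i
      have h3 := h2 i (Finset.mem_univ i)
      rw [mul_assoc] at h3
      simpa using (mul_eq_zero.1 h3).resolve_left (inv_ne_zero (abs_pos.2 (hd' i)).ne')
    · intro i _
      rw [mul_assoc]
      exact mul_nonneg (inv_nonneg.2 (abs_nonneg _)) (mul_self_nonneg _)
  -- Intertwining `d` and `d'` gives the same for every function of them; the cases used are the
  -- sign and the absolute value.
  have hfun : ∀ (F : ℝ → ℝ) v, diagL (fun i => F (d' i)) (R v) = R (diagL (fun i => F (d i)) v) := by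
    intro F
    have hb : ∀ (k : Fin n → ℝ) j, diagL k (EuclideanSpace.basisFun (Fin n) ℝ j) =
        k j • EuclideanSpace.basisFun (Fin n) ℝ j := fun k j => by
      ext i
      by_cases hij : i = j
      · simp [hij]
      · simp [hij]
    have h1 : (diagL fun i => F (d' i)).toLinearMap ∘ₗ R.toLinearEquiv.toLinearMap =
        R.toLinearEquiv.toLinearMap ∘ₗ (diagL fun i => F (d i)).toLinearMap := by
      refine (EuclideanSpace.basisFun (Fin n) ℝ).toBasis.ext fun j => ?_
      rw [OrthonormalBasis.coe_toBasis]
      change diagL (fun i => F (d' i)) (R _) = R (diagL (fun i => F (d i)) _)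
      have h2 := hcomm (EuclideanSpace.basisFun (Fin n) ℝ j)
      rw [hb, map_smul] at h2
      rw [hb, map_smul]
      ext i
      have h3 := congrArg (fun z : Euc n => z i) h2
      simp only [diagL_apply, PiLp.smul_apply, smul_eq_mul] at h3 ⊢
      -- A nonzero matrix entry of `R` in place `(i, j)` forces `d' i = d j`.
      by_cases h4 : R (EuclideanSpace.basisFun (Fin n) ℝ j) i = 0
      · rw [h4]; ring
      · rw [mul_right_cancel₀ h4 h3]
    exact fun v => LinearMap.congr_fun h1 v
  refine ⟨fun v => ?_, hfun Real.sign⟩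
  -- Inserting the operator `|d|` in the weighted form cancels the weights and leaves the Euclidean
  -- norm.
  have h1 := hB (diagL (fun i => |d i|) v) v
  rw [← hfun (fun x => |x|) v] at h1
  simp only [diagL_apply] at h1
  have h2 : ∀ (k : Fin n → ℝ), (∀ i, k i ≠ 0) → ∀ v : Euc n,
      ∑ i, |k i|⁻¹ * (|k i| * v i) * v i = ‖v‖ ^ 2 := fun k hk v => by
    rw [← real_inner_self_eq_norm_sq, inner_eq_sum]
    refine Finset.sum_congr rfl fun i _ => ?_
    have := (abs_pos.2 (hk i)).ne'
    field_simp
  rw [h2 d hd, h2 d' hd'] at h1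
  exact (sq_eq_sq₀ (norm_nonneg _) (norm_nonneg _)).1 h1

end Diagonal

end EquivariantMorse

namespace EquivariantMorse

/-! ### Charts linearising the group action -/

section Linearization

open Set Filter

variable {n : ℕ} {M : Type*} [TopologicalSpace M] [ChartedSpace (Euc n) M]

/-- The second derivative of a composite at a critical point of the outer function. -/
lemma fderiv_fderiv_comp {F : Euc n → ℝ} {τ : Euc n → Euc n} {a : Euc n}
    (hτ : ContDiffAt ℝ 2 τ a) (hF : ContDiffAt ℝ 2 F (τ a)) (h0 : fderiv ℝ F (τ a) = 0)
    (v w : Euc n) : fderiv ℝ (fderiv ℝ (F ∘ τ)) a v w =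
      fderiv ℝ (fderiv ℝ F) (τ a) (fderiv ℝ τ a v) (fderiv ℝ τ a w) := by
  have h1 : fderiv ℝ (F ∘ τ) =ᶠ[𝓝 a] fun y => (fderiv ℝ F (τ y)).comp (fderiv ℝ τ y) := by
    filter_upwards [hτ.eventually (by simp), hτ.continuousAt.eventually (hF.eventually (by simp))]
      with y hy1 hy2
    exact fderiv_comp y (hy2.differentiableAt (by simp)) (hy1.differentiableAt (by simp))
  have h2 : HasFDerivAt (fderiv ℝ F) (fderiv ℝ (fderiv ℝ F) (τ a)) (τ a) :=
    ((hF.fderiv_right (m := 1) (by norm_num)).differentiableAt (by simp)).hasFDerivAt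
  have h3 : HasFDerivAt (fderiv ℝ τ) (fderiv ℝ (fderiv ℝ τ) a) a :=
    ((hτ.fderiv_right (m := 1) (by norm_num)).differentiableAt (by simp)).hasFDerivAt
  have h4 := (h2.comp a (hτ.differentiableAt (by simp)).hasFDerivAt).clm_comp h3
  rw [h1.fderiv_eq]
  erw [h4.fderiv]
  -- The term containing the second derivative of `τ` is multiplied by the derivative of `F` at the
  -- critical point, which vanishes.
  simp [h0]

/-- A smooth map to `ℝⁿ` with invertible derivative at `p` restricts to a chart around `p`. -/
lemma exists_chart_of_hasFDerivAt [IsManifold (𝓡 n) ∞ M] {Ψ : M → Euc n} {p : M} {O : Set M}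
    (hO : IsOpen O) (hp : p ∈ O) (hΨ : ContMDiffOn (𝓡 n) (𝓡 n) ∞ Ψ O) {A : Euc n ≃L[ℝ] Euc n}
    (hA : HasFDerivAt (fun y => Ψ ((chartAt (Euc n) p).symm y)) (A : Euc n →L[ℝ] Euc n)
      (chartAt (Euc n) p p)) :
    ∃ e ∈ IsManifold.maximalAtlas (𝓡 n) ∞ M, p ∈ e.source ∧ e.source ⊆ O ∧
      e.source.EqOn e Ψ ∧ ∀ v : Euc n, mfderiv (𝓡 n) (𝓡 n) e p v = A v := by
  set φ := chartAt (Euc n) p with hφ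
  have hφat : φ ∈ IsManifold.maximalAtlas (𝓡 n) ∞ M := IsManifold.chart_mem_maximalAtlas p
  have hpφ : p ∈ φ.source := mem_chart_source _ p
  set u : Euc n → Euc n := fun y => Ψ (φ.symm y) with hu
  have huc : ContDiffOn ℝ ∞ u (φ.target ∩ φ.symm ⁻¹' O) := by
    refine contMDiffOn_iff_contDiffOn.1 (hΨ.comp ((contMDiffOn_symm_of_mem_maximalAtlas hφat).mono
      inter_subset_left) fun y hy => hy.2)
  have hTo : IsOpen (φ.target ∩ φ.symm ⁻¹' O) := φ.symm.isOpen_inter_preimage hO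
  have hmem : φ p ∈ φ.target ∩ φ.symm ⁻¹' O :=
    ⟨φ.map_source hpφ, by rw [mem_preimage, φ.left_inv hpφ]; exact hp⟩
  have hat : ∀ y ∈ φ.target ∩ φ.symm ⁻¹' O, ContDiffAt ℝ ∞ u y := fun y hy =>
    huc.contDiffAt (hTo.mem_nhds hy)
  let h := (hat _ hmem).toOpenPartialHomeomorph u hA (by simp)
  have hh : ∀ y, h y = u y := fun y => rfl
  have hφh : φ p ∈ h.source := (hat _ hmem).mem_toOpenPartialHomeomorph_source hA (by simp)
  -- The inverse function theorem gives a smooth inverse only where the derivative is invertible;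
  -- `W` is the open set of such points.
  let W : Set (Euc n) := (φ.target ∩ φ.symm ⁻¹' O) ∩
    fderiv ℝ u ⁻¹' range ((↑) : (Euc n ≃L[ℝ] Euc n) → Euc n →L[ℝ] Euc n)
  have hW : IsOpen W :=
    (huc.continuousOn_fderiv_of_isOpen hTo (by simp)).isOpen_inter_preimage hTo
      ContinuousLinearEquiv.isOpen
  have hpW : φ p ∈ W := ⟨hmem, A, hA.fderiv.symm⟩
  let e := φ.trans (h.restr W)
  have hsrc : e.source = φ.source ∩ φ ⁻¹' (h.source ∩ W) := by
    rw [OpenPartialHomeomorph.trans_source, OpenPartialHomeomorph.restr_source, hW.interior_eq]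
  have hpe : p ∈ e.source := by
    rw [hsrc]
    exact ⟨hpφ, hφh, hpW⟩
  have heΨ : e.source.EqOn e Ψ := fun x hx => by
    rw [hsrc] at hx
    change Ψ (φ.symm (φ x)) = Ψ x
    rw [φ.left_inv hx.1]
  have hsO : e.source ⊆ O := fun x hx => by
    rw [hsrc] at hx
    have h1 := hx.2.2.1.2
    rwa [mem_preimage, φ.left_inv hx.1] at h1
  refine ⟨e, ?_, hpe, hsO, heΨ, fun v => ?_⟩
  · refine OpenPartialHomeomorph.mem_maximalAtlas_of_contMDiffOn e ((hΨ.mono hsO).congr heΨ) ?_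
    have hsymm : ContMDiffOn (𝓡 n) (𝓡 n) ∞ h.symm (h.restr W).target := by
      refine contMDiffOn_iff_contDiffOn.2 fun z hz => ?_
      rw [OpenPartialHomeomorph.restr_target, hW.interior_eq] at hz
      obtain ⟨B, hB⟩ := hz.2.2
      refine (h.contDiffAt_symm hz.1 (f₀' := B) ?_ (hat _ hz.2.1)).contDiffWithinAt
      rw [hB]
      exact ((hat _ hz.2.1).differentiableAt (by simp)).hasFDerivAt
    refine (contMDiffOn_symm_of_mem_maximalAtlas hφat).comp
      (hsymm.mono fun z hz => ?_) fun z hz => ?_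
    · rw [OpenPartialHomeomorph.trans_target] at hz
      exact hz.1
    · rw [OpenPartialHomeomorph.trans_target] at hz
      exact hz.2
  · have h1 : HasMFDerivAt (𝓡 n) (𝓡 n) u (φ p) (A : Euc n →L[ℝ] Euc n) :=
      hasMFDerivAt_iff_hasFDerivAt.2 hA
    -- The tangent space at `p` is identified with `ℝⁿ` through the preferred chart at `p`, whose
    -- derivative there is therefore the identity.
    have h2 : HasMFDerivAt (𝓡 n) (𝓡 n) φ p (ContinuousLinearMap.id ℝ _) := by
      have h3 := ((mdifferentiable_of_mem_maximalAtlas hφat).mdifferentiableAt hpφ).hasMFDerivAt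
      have h4 : mfderiv (𝓡 n) (𝓡 n) φ p = ContinuousLinearMap.id ℝ _ :=
        mfderiv_extChartAt_self (I := 𝓡 n) (x := p)
      rwa [h4] at h3
    have h3 : HasMFDerivAt (𝓡 n) (𝓡 n) e p ((A : Euc n →L[ℝ] Euc n).comp
        (ContinuousLinearMap.id ℝ (Euc n))) := h1.comp p h2
    exact congrArg (fun L => L v) h3.mfderiv

variable {G : Type*} [Group G] [MulAction G M]

/-- The derivative at `x` of the action of `σ`. -/
noncomputable def dact (σ : G) (x : M) : Euc n →L[ℝ] Euc n :=
  mfderiv (𝓡 n) (𝓡 n) (fun y : M => σ • y) x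

lemma dact_one (x : M) : dact (n := n) (1 : G) x = ContinuousLinearMap.id ℝ (Euc n) := by
  have h : (fun y : M => (1 : G) • y) = id := funext fun y => one_smul G y
  rw [dact, h]
  exact mfderiv_id

variable [SmoothAction n G M]

lemma dact_mul (σ τ : G) (x : M) :
    dact (n := n) (σ * τ) x = (dact σ (τ • x)).comp (dact τ x) := by
  have h : (fun y : M => (σ * τ) • y) = (fun y : M => σ • y) ∘ (fun y : M => τ • y) :=
    funext fun y => mul_smul σ τ y
  rw [dact, h]
  exact mfderiv_comp x (mdifferentiableAt_smul σ _) (mdifferentiableAt_smul τ _)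

lemma dact_inv_dact (σ : G) (x : M) (v : Euc n) : dact σ⁻¹ (σ • x) (dact σ x v) = v := by
  have h := dact_mul (n := n) σ⁻¹ σ x
  rw [inv_mul_cancel, dact_one] at h
  exact (congrArg (fun L => L v) h).symm

lemma dact_dact_inv (σ : G) (x : M) (v : Euc n) : dact σ x (dact σ⁻¹ (σ • x) v) = v := by
  have h := dact_inv_dact σ⁻¹ (σ • x) v
  rwa [inv_smul_smul, inv_inv] at h

/-- The derivative of the action as an isomorphism. -/
noncomputable def dactEquiv (σ : G) (x : M) : Euc n ≃L[ℝ] Euc n :=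
  ContinuousLinearEquiv.equivOfInverse (dact σ x) (dact σ⁻¹ (σ • x)) (dact_inv_dact σ x)
    (dact_dact_inv σ x)

@[simp]
lemma dactEquiv_apply (σ : G) (x : M) (v : Euc n) : dactEquiv σ x v = dact σ x v := rfl

/-- Since `dact` is expressed in the preferred charts at source and target, it is an ordinary
derivative. -/
lemma hasFDerivAt_action_in_charts (σ : G) (p : M) :
    HasFDerivAt (fun y => chartAt (Euc n) (σ • p) (σ • (chartAt (Euc n) p).symm y))
      (dact (n := n) σ p) (chartAt (Euc n) p p) := by
  have h := (mdifferentiableAt_smul (n := n) σ p).hasMFDerivAt.2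
  simp only [mfld_simps] at h
  have h' : HasFDerivWithinAt
      (fun y => chartAt (Euc n) (σ • p) (σ • (chartAt (Euc n) p).symm y))
      (dact (n := n) σ p) univ (chartAt (Euc n) p p) := h
  exact hasFDerivWithinAt_univ.1 h'

/-- The average over the group of the charts at the translates of `p`, a map which linearises
the action. -/
noncomputable def linearizer (G : Type*) [Group G] [MulAction G M] [Fintype G] (p x : M) : Euc n :=
  (Fintype.card G : ℝ)⁻¹ • ∑ σ : G, dact σ⁻¹ (σ • p)
    (chartAt (Euc n) (σ • p) (σ • x) - chartAt (Euc n) (σ • p) (σ • p))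

variable [Fintype G]

omit [SmoothAction n G M] in
lemma linearizer_self (p : M) : linearizer (n := n) G p p = 0 := by
  simp [linearizer]

/-- A reindexing `σ ↦ σ τ` of the sum. The base point moves along with `x`, so a whole orbit of
critical points is treated at once and stabilisers play no separate role. -/
lemma linearizer_smul (τ : G) (p x : M) :
    linearizer (n := n) G (τ • p) (τ • x) = dact τ p (linearizer G p x) := by
  rw [linearizer, linearizer, map_smul, map_sum]
  congr 1
  refine Fintype.sum_equiv (Equiv.mulRight τ) _ _ fun σ => ?_
  simp only [Equiv.coe_mulRight, ← mul_smul]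
  have h := dact_mul (n := n) τ (σ * τ)⁻¹ ((σ * τ) • p)
  rw [inv_smul_smul, show τ * (σ * τ)⁻¹ = σ⁻¹ by group] at h
  rw [h]
  rfl

/-- Each summand is the action of `σ` followed by its linearised inverse and has derivative the
identity, hence so has the average. The inverse function theorem thus makes the average a chart. -/
lemma hasFDerivAt_linearizer (p : M) :
    HasFDerivAt (fun y => linearizer (n := n) G p ((chartAt (Euc n) p).symm y))
      (ContinuousLinearMap.id ℝ (Euc n)) (chartAt (Euc n) p p) := by
  have h1 : HasFDerivAt (fun y => linearizer (n := n) G p ((chartAt (Euc n) p).symm y))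
      ((Fintype.card G : ℝ)⁻¹ • ∑ σ : G, (dact σ⁻¹ (σ • p)).comp (dact (n := n) σ p))
      (chartAt (Euc n) p p) := by
    refine HasFDerivAt.fun_const_smul (HasFDerivAt.fun_sum (u := Finset.univ)
      (A := fun (σ : G) y => dact (n := n) σ⁻¹ (σ • p) (chartAt (Euc n) (σ • p)
        (σ • (chartAt (Euc n) p).symm y) - chartAt (Euc n) (σ • p) (σ • p))) fun σ _ => ?_) _
    exact (dact (n := n) σ⁻¹ (σ • p)).hasFDerivAt.comp (chartAt (Euc n) p p)
      ((hasFDerivAt_action_in_charts σ p).sub_const _)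
  refine h1.congr_fderiv ?_
  ext1 v
  have h2 : ∀ σ : G, ((dact σ⁻¹ (σ • p)).comp (dact (n := n) σ p)) v = v := fun σ =>
    dact_inv_dact σ p v
  rw [smul_apply, sum_apply, Finset.sum_congr rfl
    fun σ _ => h2 σ, Finset.sum_const, Finset.card_univ, ← Nat.cast_smul_eq_nsmul ℝ, smul_smul,
    inv_mul_cancel₀ (by simp), one_smul]
  rfl

lemma exists_contMDiffOn_linearizer [IsManifold (𝓡 n) ∞ M] (p : M) :
    ∃ O : Set M, IsOpen O ∧ p ∈ O ∧
      ContMDiffOn (𝓡 n) (𝓡 n) ∞ (linearizer (n := n) G p) O := by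
  refine ⟨⋂ σ : G, (fun x : M => σ • x) ⁻¹' (chartAt (Euc n) (σ • p)).source,
    isOpen_iInter_of_finite fun σ => (chartAt (Euc n) (σ • p)).open_source.preimage
      (SmoothAction.smooth (n := n) σ).continuous, mem_iInter.2 fun σ => mem_chart_source _ _, ?_⟩
  have h1 : ∀ σ : G, ContMDiffOn (𝓡 n) (𝓡 n) ∞ (fun x => dact σ⁻¹ (σ • p)
      (chartAt (Euc n) (σ • p) (σ • x) - chartAt (Euc n) (σ • p) (σ • p)))
      (⋂ σ : G, (fun x : M => σ • x) ⁻¹' (chartAt (Euc n) (σ • p)).source) := fun σ => by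
    have h2 : ContMDiffOn (𝓡 n) (𝓡 n) ∞ (fun x : M => chartAt (Euc n) (σ • p) (σ • x))
        (⋂ σ : G, (fun x : M => σ • x) ⁻¹' (chartAt (Euc n) (σ • p)).source) :=
      (contMDiffOn_of_mem_maximalAtlas (IsManifold.chart_mem_maximalAtlas (σ • p))).comp
        (SmoothAction.smooth σ).contMDiffOn fun x hx => mem_iInter.1 hx σ
    have h3 : ContDiff ℝ ∞ fun y : Euc n =>
        dact (n := n) σ⁻¹ (σ • p) (y - chartAt (Euc n) (σ • p) (σ • p)) :=
      (dact (n := n) σ⁻¹ (σ • p)).contDiff.comp (contDiff_id.sub contDiff_const)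
    exact h3.contMDiff.comp_contMDiffOn h2
  exact ((contDiff_const_smul (n := ∞) ((Fintype.card G : ℝ)⁻¹)).contMDiff).comp_contMDiffOn
    (contMDiffOn_finsetSum fun σ _ => h1 σ)

end Linearization

end EquivariantMorse

namespace EquivariantMorse

/-! ### Equivariant Morse charts -/

section MorseCharts

open Set Filter
open scoped RealInnerProductSpace

variable {n : ℕ}

lemma two_le_infty : (2 : ℕ∞ω) ≤ ∞ := by
  exact WithTop.coe_le_coe.2 (le_top : (2 : ℕ∞) ≤ ⊤)

/-- The reflection with the signs of the nonzero numbers `d`. -/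
noncomputable abbrev signL (d : Fin n → ℝ) : Euc n →L[ℝ] Euc n := diagL fun i => Real.sign (d i)

lemma inner_diagL_comm (d : Fin n → ℝ) (y z : Euc n) : ⟪diagL d y, z⟫ = ⟪y, diagL d z⟫ := by
  rw [real_inner_comm (diagL d z), inner_diagL, inner_diagL]
  exact Finset.sum_congr rfl fun i _ => by ring

lemma sign_mul_self {a : ℝ} (ha : a ≠ 0) : Real.sign a * Real.sign a = 1 := by
  rcases lt_or_gt_of_ne ha with h | h
  · rw [Real.sign_of_neg h]; norm_num
  · rw [Real.sign_of_pos h]; norm_num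

lemma signL_signL {d : Fin n → ℝ} (hd : ∀ i, d i ≠ 0) (y : Euc n) : signL d (signL d y) = y := by
  ext i
  rw [diagL_apply, diagL_apply, ← mul_assoc, sign_mul_self (hd i), one_mul]

lemma norm_signL {d : Fin n → ℝ} (hd : ∀ i, d i ≠ 0) (y : Euc n) : ‖signL d y‖ = ‖y‖ := by
  refine (sq_eq_sq₀ (norm_nonneg _) (norm_nonneg _)).1 ?_
  rw [← real_inner_self_eq_norm_sq, ← real_inner_self_eq_norm_sq, inner_diagL_comm,
    signL_signL hd]

/-- Quadratic approximation near a critical point. -/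
lemma exists_ball_approx {F : Euc n → ℝ} {T : Set (Euc n)} (hT : IsOpen T) (h0T : 0 ∈ T)
    (hF : ContDiffOn ℝ ∞ F T) (h0 : fderiv ℝ F 0 = 0) {d : Fin n → ℝ}
    (hd : ∀ v w, fderiv ℝ (fderiv ℝ F) 0 v w = ⟪diagL d v, w⟫) {ε : ℝ} (hε : 0 < ε) :
    ∃ δ > 0, Metric.ball 0 δ ⊆ T ∧ ∀ y ∈ Metric.ball (0 : Euc n) δ,
      |F y - F 0 - ⟪diagL d y, y⟫ / 2| ≤ ε * ‖y‖ ^ 2 ∧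
      ∀ w, |fderiv ℝ F y w - ⟪diagL d y, w⟫| ≤ ε * ‖y‖ * ‖w‖ := by
  have hat : ∀ y ∈ T, ContDiffAt ℝ ∞ F y := fun y hy => hF.contDiffAt (hT.mem_nhds hy)
  have h1 : HasFDerivAt (fderiv ℝ F) (fderiv ℝ (fderiv ℝ F) 0) 0 :=
    (((hat 0 h0T).fderiv_right (m := 1) (by simpa [one_add_one_eq_two] using two_le_infty)).differentiableAt (by simp)).hasFDerivAt
  obtain ⟨δ, hδ, hball⟩ := Metric.mem_nhds_iff.1
    (inter_mem (h1.isLittleO.def hε) (hT.mem_nhds h0T))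
  have hder : ∀ y ∈ Metric.ball (0 : Euc n) δ, ∀ w,
      |fderiv ℝ F y w - ⟪diagL d y, w⟫| ≤ ε * ‖y‖ * ‖w‖ := by
    intro y hy w
    have h2 : ‖fderiv ℝ F y - fderiv ℝ F 0 - fderiv ℝ (fderiv ℝ F) 0 (y - 0)‖ ≤ ε * ‖y - 0‖ :=
      (hball hy).1
    rw [h0, sub_zero, sub_zero] at h2
    rw [← hd, ← Real.norm_eq_abs]
    exact ((fderiv ℝ F y - fderiv ℝ (fderiv ℝ F) 0 y).le_opNorm w).trans
      (mul_le_mul_of_nonneg_right h2 (norm_nonneg _))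
  refine ⟨δ, hδ, fun y hy => (hball hy).2, fun y hy => ⟨?_, hder y hy⟩⟩
  -- The estimate for the values follows from the one for derivatives, by the mean value inequality
  -- for the remainder `k` on the ball of radius `‖y‖`, where its derivative is at most `ε * ‖y‖`.
  let k : Euc n → ℝ := fun y => F y - ⟪diagL d y, y⟫ / 2
  let k' : Euc n → Euc n →L[ℝ] ℝ := fun y => fderiv ℝ F y - innerSL ℝ (diagL d y)
  have hsub : Metric.closedBall (0 : Euc n) ‖y‖ ⊆ Metric.ball 0 δ :=
    Metric.closedBall_subset_ball (by simpa using hy)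
  have hk : ∀ z ∈ Metric.closedBall (0 : Euc n) ‖y‖,
      HasFDerivWithinAt k (k' z) (Metric.closedBall 0 ‖y‖) z := by
    intro z hz
    have h2 : HasFDerivAt F (fderiv ℝ F z) z :=
      ((hat z (hball (hsub hz)).2).differentiableAt (by simp)).hasFDerivAt
    have h3 := ((diagL d).hasFDerivAt (x := z)).inner ℝ (hasFDerivAt_id z)
    have h4 := h2.sub (h3.mul_const (2⁻¹ : ℝ))
    refine (h4.congr_fderiv ?_).hasFDerivWithinAt
    ext w
    have h5 : ⟪diagL d w, z⟫ = ⟪diagL d z, w⟫ := by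
      rw [inner_diagL_comm, real_inner_comm]
    simp [k', h5]
    ring
  have hbound : ∀ z ∈ Metric.closedBall (0 : Euc n) ‖y‖, ‖k' z‖ ≤ ε * ‖y‖ := by
    intro z hz
    refine ContinuousLinearMap.opNorm_le_bound _ (by positivity) fun w => ?_
    refine (hder z (hsub hz) w).trans ?_
    have h2 : ‖z‖ ≤ ‖y‖ := by simpa using hz
    gcongr
  have h2 := (convex_closedBall (0 : Euc n) ‖y‖).norm_image_sub_le_of_norm_hasFDerivWithin_le
    hk hbound (Metric.mem_closedBall_self (norm_nonneg y)) (by simp : y ∈ _)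
  have h3 : k y - k 0 = F y - F 0 - ⟪diagL d y, y⟫ / 2 := by
    simp only [k, map_zero, inner_zero_left]
    ring
  rw [h3, sub_zero, Real.norm_eq_abs] at h2
  rw [pow_two, ← mul_assoc]
  exact h2

variable {M : Type*} [TopologicalSpace M] [ChartedSpace (Euc n) M]

/-- The derivative of the chart `e` at `p`. -/
noncomputable def dchart (e : OpenPartialHomeomorph M (Euc n)) (p : M) : Euc n →L[ℝ] Euc n :=
  mfderiv (𝓡 n) (𝓡 n) e p

/-- The derivative of the inverse of the chart `e` at `y`. -/
noncomputable def dchartSymm (e : OpenPartialHomeomorph M (Euc n)) (y : Euc n) :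
    Euc n →L[ℝ] Euc n :=
  mfderiv (𝓡 n) (𝓡 n) e.symm y

/-- A family of positive definite forms on the tangent spaces which the group preserves. -/
structure InvariantForm (G : Type*) [Group G] [MulAction G M]
    (B : M → Euc n →L[ℝ] Euc n →L[ℝ] ℝ) : Prop where
  symm : ∀ p v w, B p v w = B p w v
  pos : ∀ p v, v ≠ 0 → 0 < B p v v
  invariant : ∀ (σ : G) p v w, B (σ • p) (dact σ p v) (dact σ p w) = B p v w

/-- Disjoint charts around the critical points of `f`, onto the ball of radius `R`, in which the
group acts by isometries and `f` is close to a standard quadratic form, and which diagonalise the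
form `B` and the Hessian. -/
structure MorseCharts (G : Type*) [Group G] [MulAction G M] (f : M → ℝ)
    (B : M → Euc n →L[ℝ] Euc n →L[ℝ] ℝ) (ε R : ℝ) where
  e : M → OpenPartialHomeomorph M (Euc n)
  d : M → Fin n → ℝ
  rot : G → M → Euc n →L[ℝ] Euc n
  R_pos : 0 < R
  d_ne : ∀ p ∈ criticalPoints n f, ∀ i, d p i ≠ 0
  mem_atlas : ∀ p ∈ criticalPoints n f, e p ∈ IsManifold.maximalAtlas (𝓡 n) ∞ M
  mem_source : ∀ p ∈ criticalPoints n f, p ∈ (e p).source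
  apply_self : ∀ p ∈ criticalPoints n f, e p p = 0
  target_eq : ∀ p ∈ criticalPoints n f, (e p).target = Metric.ball 0 R
  disjoint : ∀ p ∈ criticalPoints n f, ∀ q ∈ criticalPoints n f, p ≠ q →
    Disjoint (e p).source (e q).source
  smul_mem : ∀ (σ : G), ∀ p ∈ criticalPoints n f, ∀ x ∈ (e p).source,
    σ • x ∈ (e (σ • p)).source
  smul_apply : ∀ (σ : G), ∀ p ∈ criticalPoints n f, ∀ x ∈ (e p).source,
    e (σ • p) (σ • x) = rot σ p (e p x)
  rot_norm : ∀ (σ : G), ∀ p ∈ criticalPoints n f, ∀ y, ‖rot σ p y‖ = ‖y‖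
  rot_sign : ∀ (σ : G), ∀ p ∈ criticalPoints n f, ∀ y,
    signL (d (σ • p)) (rot σ p y) = rot σ p (signL (d p) y)
  approx_value : ∀ p ∈ criticalPoints n f, ∀ y ∈ Metric.ball (0 : Euc n) R,
    |f ((e p).symm y) - f p - ⟪signL (d p) y, y⟫ / 2| ≤ ε * ‖y‖ ^ 2
  approx_deriv : ∀ p ∈ criticalPoints n f, ∀ y ∈ Metric.ball (0 : Euc n) R, ∀ w,
    |fderiv ℝ (fun z => f ((e p).symm z)) y w - ⟪signL (d p) y, w⟫| ≤ ε * ‖y‖ * ‖w‖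
  form_eq : ∀ p ∈ criticalPoints n f, ∀ v w : Euc n,
    B p v w = ∑ i, |d p i|⁻¹ * dchart (e p) p v i * dchart (e p) p w i
  hessian_eq : ∀ p ∈ criticalPoints n f, ∀ v w : Euc n,
    hessian n f p v w = ⟪signL (d p) (dchart (e p) p v), dchart (e p) p w⟫

variable [IsManifold (𝓡 n) ∞ M] {f : M → ℝ}

lemma contDiffOn_comp_chart_symm (hf : ContMDiff (𝓡 n) 𝓘(ℝ, ℝ) ∞ f)
    {e : OpenPartialHomeomorph M (Euc n)} (he : e ∈ IsManifold.maximalAtlas (𝓡 n) ∞ M) :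
    ContDiffOn ℝ ∞ (fun y => f (e.symm y)) e.target :=
  contMDiffOn_iff_contDiffOn.1 (hf.comp_contMDiffOn (contMDiffOn_symm_of_mem_maximalAtlas he))

lemma fderiv_comp_chart_symm (hf : ContMDiff (𝓡 n) 𝓘(ℝ, ℝ) ∞ f)
    {e : OpenPartialHomeomorph M (Euc n)} (he : e ∈ IsManifold.maximalAtlas (𝓡 n) ∞ M)
    {y : Euc n} (hy : y ∈ e.target) (v : Euc n) :
    fderiv ℝ (fun y => f (e.symm y)) y v =
      mfderiv (𝓡 n) 𝓘(ℝ, ℝ) f (e.symm y) (mfderiv (𝓡 n) (𝓡 n) e.symm y v) := by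
  have h := mfderiv_comp y (hf.mdifferentiableAt (x := e.symm y) (by simp))
    ((mdifferentiable_of_mem_maximalAtlas he).mdifferentiableAt_symm hy)
  have h2 : mfderiv (𝓡 n) 𝓘(ℝ, ℝ) (f ∘ e.symm) y = fderiv ℝ (fun y => f (e.symm y)) y :=
    mfderiv_eq_fderiv
  rw [h] at h2
  exact (congrArg (fun L => L v) h2).symm

lemma fderiv_comp_chart_symm_eq_zero (hf : ContMDiff (𝓡 n) 𝓘(ℝ, ℝ) ∞ f)
    {e : OpenPartialHomeomorph M (Euc n)} (he : e ∈ IsManifold.maximalAtlas (𝓡 n) ∞ M)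
    {y : Euc n} (hy : y ∈ e.target) :
    fderiv ℝ (fun y => f (e.symm y)) y = 0 ↔ e.symm y ∈ criticalPoints n f := by
  constructor
  · intro h
    refine ContinuousLinearMap.ext fun v => ?_
    have h1 := fderiv_comp_chart_symm hf he hy (mfderiv (𝓡 n) (𝓡 n) e (e.symm y) v)
    have h2 := mfderiv_chart_symm_chart he (e.map_target hy) v
    rw [e.right_inv hy] at h2
    refine (congrArg (fun u => mfderiv (𝓡 n) 𝓘(ℝ, ℝ) f (e.symm y) u) h2).symm.trans
      (h1.symm.trans ?_)
    rw [h]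
    rfl
  · intro h
    ext v
    rw [fderiv_comp_chart_symm hf he hy]
    have h1 : mfderiv (𝓡 n) 𝓘(ℝ, ℝ) f (e.symm y) = 0 := h
    rw [h1]
    rfl

lemma hessian_symm (hf : ContMDiff (𝓡 n) 𝓘(ℝ, ℝ) ∞ f) (p : M) (v w : Euc n) :
    hessian n f p v w = hessian n f p w v := by
  have he := IsManifold.chart_mem_maximalAtlas (I := 𝓡 n) (n := ∞) p
  have h : ContDiffAt ℝ ∞ (fun y => f ((chartAt (Euc n) p).symm y)) (chartAt (Euc n) p p) :=
    (contDiffOn_comp_chart_symm hf he).contDiffAt ((chartAt (Euc n) p).open_target.mem_nhds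
      ((chartAt (Euc n) p).map_source (mem_chart_source _ p)))
  exact (h.isSymmSndFDerivAt (by simpa using two_le_infty)) v w

/-- The Hessian computed in another chart. -/
lemma fderiv_fderiv_chart (hf : ContMDiff (𝓡 n) 𝓘(ℝ, ℝ) ∞ f)
    {e : OpenPartialHomeomorph M (Euc n)} (he : e ∈ IsManifold.maximalAtlas (𝓡 n) ∞ M)
    {p : M} (hp : p ∈ criticalPoints n f) (hpe : p ∈ e.source) {A : Euc n ≃L[ℝ] Euc n}
    (hA : ∀ v, dchart e p v = A v) (v w : Euc n) :
    fderiv ℝ (fderiv ℝ fun y => f (e.symm y)) (e p) v w =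
      hessian n f p (A.symm v) (A.symm w) := by
  set φ := chartAt (Euc n) p with hφ
  have hφa : φ ∈ IsManifold.maximalAtlas (𝓡 n) ∞ M := IsManifold.chart_mem_maximalAtlas p
  have hpφ : p ∈ φ.source := mem_chart_source _ p
  have hnhds : e.target ∩ e.symm ⁻¹' φ.source ∈ 𝓝 (e p) :=
    (e.symm.isOpen_inter_preimage φ.open_source).mem_nhds
      ⟨e.map_source hpe, by rw [mem_preimage, e.left_inv hpe]; exact hpφ⟩
  have hτ : ContDiffAt ℝ ∞ (fun y => φ (e.symm y)) (e p) := by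
    refine (contMDiffOn_iff_contDiffOn.1 ((contMDiffOn_of_mem_maximalAtlas hφa).comp
      ((contMDiffOn_symm_of_mem_maximalAtlas he).mono (inter_subset_left
        (t := e.symm ⁻¹' φ.source))) fun y hy => hy.2)).contDiffAt hnhds
  have h1 : (fun y => f (e.symm y)) =ᶠ[𝓝 (e p)]
      (fun y => f (φ.symm y)) ∘ fun y => φ (e.symm y) := by
    filter_upwards [hnhds] with y hy
    simp only [Function.comp_apply]
    rw [φ.left_inv hy.2]
  have hep : φ (e.symm (e p)) = φ p := by rw [e.left_inv hpe]
  have hF : ContDiffAt ℝ ∞ (fun y => f (φ.symm y)) (φ (e.symm (e p))) := by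
    rw [hep]
    exact (contDiffOn_comp_chart_symm hf hφa).contDiffAt
      (φ.open_target.mem_nhds (φ.map_source hpφ))
  have h0 : fderiv ℝ (fun y => f (φ.symm y)) (φ (e.symm (e p))) = 0 := by
    rw [hep, fderiv_comp_chart_symm_eq_zero hf hφa (φ.map_source hpφ), φ.left_inv hpφ]
    exact hp
  -- The preferred chart has derivative the identity at `p`, so the transition map differentiates to
  -- the inverse of the derivative of `e`.
  have hder : ∀ v, fderiv ℝ (fun y => φ (e.symm y)) (e p) v = A.symm v := by
    intro v
    have h2 : HasMFDerivAt (𝓡 n) (𝓡 n) (fun y => φ (e.symm y)) (e p)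
        ((dchart φ (e.symm (e p))).comp (dchartSymm e (e p))) := by
      refine HasMFDerivAt.comp (e p) ?_
        ((mdifferentiable_of_mem_maximalAtlas he).mdifferentiableAt_symm
          (e.map_source hpe)).hasMFDerivAt
      rw [e.left_inv hpe]
      exact ((mdifferentiable_of_mem_maximalAtlas hφa).mdifferentiableAt hpφ).hasMFDerivAt
    have h2' : HasFDerivAt (fun y => φ (e.symm y))
        ((dchart φ (e.symm (e p))).comp (dchartSymm e (e p))) (e p) :=
      hasMFDerivAt_iff_hasFDerivAt.1 h2
    have h3 := h2'.fderiv
    rw [h3]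
    have h4 : mfderiv (𝓡 n) (𝓡 n) φ p = ContinuousLinearMap.id ℝ _ :=
      mfderiv_extChartAt_self (I := 𝓡 n) (x := p)
    have h5 : ∀ x, x = p → ∀ u : Euc n, (mfderiv (𝓡 n) (𝓡 n) φ x u : Euc n) = u := by
      rintro x rfl u
      rw [h4]
      rfl
    refine (h5 _ (e.left_inv hpe) (mfderiv (𝓡 n) (𝓡 n) e.symm (e p) v)).trans ?_
    have h6 := mfderiv_chart_symm_chart he hpe (A.symm v : Euc n)
    have h8 : dchart e p (A.symm v) = v := by rw [hA, A.apply_symm_apply]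
    exact (congrArg (fun u => mfderiv (𝓡 n) (𝓡 n) e.symm (e p) u) h8).symm.trans h6
  have h7 : fderiv ℝ (fderiv ℝ fun y => f (e.symm y)) (e p) =
      fderiv ℝ (fderiv ℝ ((fun y => f (φ.symm y)) ∘ fun y => φ (e.symm y))) (e p) :=
    h1.fderiv.fderiv_eq
  rw [h7, fderiv_fderiv_comp (hτ.of_le two_le_infty) (hF.of_le two_le_infty) h0, hder, hder, hep]
  rfl

variable {G : Type*} [Group G] [MulAction G M] [SmoothAction n G M]

/-- Differentiate `f = f ∘ σ` twice; at a critical point only the first derivative of the action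
enters. -/
lemma hessian_dact (hf : IsEquivariantMorse n G f) (σ : G) {p : M} (hp : p ∈ criticalPoints n f)
    (v w : Euc n) :
    hessian n f (σ • p) (dact σ p v) (dact σ p w) = hessian n f p v w := by
  set φ := chartAt (Euc n) p with hφ
  set ψ := chartAt (Euc n) (σ • p) with hψ
  have hφa : φ ∈ IsManifold.maximalAtlas (𝓡 n) ∞ M := IsManifold.chart_mem_maximalAtlas p
  have hψa : ψ ∈ IsManifold.maximalAtlas (𝓡 n) ∞ M := IsManifold.chart_mem_maximalAtlas (σ • p)
  have hpφ : p ∈ φ.source := mem_chart_source _ p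
  have hpψ : σ • p ∈ ψ.source := mem_chart_source _ _
  have hσ : ContMDiff (𝓡 n) (𝓡 n) ∞ fun x : M => σ • x := SmoothAction.smooth σ
  have hnhds : φ.target ∩ φ.symm ⁻¹' ((fun x : M => σ • x) ⁻¹' ψ.source) ∈ 𝓝 (φ p) :=
    (φ.symm.isOpen_inter_preimage (ψ.open_source.preimage hσ.continuous)).mem_nhds
      ⟨φ.map_source hpφ, by rw [mem_preimage, φ.left_inv hpφ]; exact hpψ⟩
  have hτ : ContDiffAt ℝ ∞ (fun y => ψ (σ • φ.symm y)) (φ p) := by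
    refine (contMDiffOn_iff_contDiffOn.1 ((contMDiffOn_of_mem_maximalAtlas hψa).comp
      (hσ.comp_contMDiffOn ((contMDiffOn_symm_of_mem_maximalAtlas hφa).mono (inter_subset_left
        (t := φ.symm ⁻¹' ((fun x : M => σ • x) ⁻¹' ψ.source))))) fun y hy => hy.2)).contDiffAt
      hnhds
  have h1 : (fun y => f (φ.symm y)) =ᶠ[𝓝 (φ p)]
      (fun y => f (ψ.symm y)) ∘ fun y => ψ (σ • φ.symm y) := by
    filter_upwards [hnhds] with y hy
    simp only [Function.comp_apply]
    rw [ψ.left_inv hy.2, hf.invariant]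
  have hep : ψ (σ • φ.symm (φ p)) = ψ (σ • p) := by rw [φ.left_inv hpφ]
  have hF : ContDiffAt ℝ ∞ (fun y => f (ψ.symm y)) (ψ (σ • φ.symm (φ p))) := by
    rw [hep]
    exact (contDiffOn_comp_chart_symm hf.smooth hψa).contDiffAt
      (ψ.open_target.mem_nhds (ψ.map_source hpψ))
  have h0 : fderiv ℝ (fun y => f (ψ.symm y)) (ψ (σ • φ.symm (φ p))) = 0 := by
    rw [hep, fderiv_comp_chart_symm_eq_zero hf.smooth hψa (ψ.map_source hpψ), ψ.left_inv hpψ]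
    exact smul_mem_criticalPoints hf σ hp
  have hder : fderiv ℝ (fun y => ψ (σ • φ.symm y)) (φ p) = dact σ p :=
    (hasFDerivAt_action_in_charts σ p).fderiv
  have h7 : fderiv ℝ (fderiv ℝ fun y => f (φ.symm y)) (φ p) =
      fderiv ℝ (fderiv ℝ ((fun y => f (ψ.symm y)) ∘ fun y => ψ (σ • φ.symm y))) (φ p) :=
    h1.fderiv.fderiv_eq
  have h8 := fderiv_fderiv_comp (hτ.of_le two_le_infty) (hF.of_le two_le_infty) h0 v w
  rw [← h7, hder, hep] at h8
  exact h8.symm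

/-- A chart at a critical point which linearises the action and normalises the Hessian. -/
lemma exists_morseChart [Fintype G] (hf : IsEquivariantMorse n G f) {p : M}
    (hp : p ∈ criticalPoints n f) (L : Euc n ≃L[ℝ] Euc n) (d : Fin n → ℝ)
    (hL : ∀ v w : Euc n, hessian n f p v w = ∑ i, Real.sign (d i) * L v i * L w i)
    {ε : ℝ} (hε : 0 < ε) :
    ∃ e ∈ IsManifold.maximalAtlas (𝓡 n) ∞ M, p ∈ e.source ∧ e p = 0 ∧
      (∀ x ∈ e.source, e x = L (linearizer G p x)) ∧
      (∀ v, dchart e p v = L v) ∧ ∃ δ > 0, Metric.ball 0 δ ⊆ e.target ∧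
      ∀ y ∈ Metric.ball (0 : Euc n) δ,
        |f (e.symm y) - f p - ⟪signL d y, y⟫ / 2| ≤ ε * ‖y‖ ^ 2 ∧
        ∀ w, |fderiv ℝ (fun z => f (e.symm z)) y w - ⟪signL d y, w⟫| ≤ ε * ‖y‖ * ‖w‖ := by
  obtain ⟨O, hO, hpO, hOs⟩ := exists_contMDiffOn_linearizer (n := n) (G := G) p
  have hder : HasFDerivAt (fun y => L (linearizer (n := n) G p ((chartAt (Euc n) p).symm y)))
      (L : Euc n →L[ℝ] Euc n) (chartAt (Euc n) p p) :=
    (L : Euc n →L[ℝ] Euc n).hasFDerivAt.comp (chartAt (Euc n) p p) (hasFDerivAt_linearizer p)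
  -- Following the linearising map by `L` keeps the action linear and reduces the Hessian to signs.
  obtain ⟨e, he, hpe, -, heq, hmf⟩ := exists_chart_of_hasFDerivAt
    (Ψ := fun x => L (linearizer (n := n) G p x)) hO hpO
    ((L : Euc n →L[ℝ] Euc n).contDiff.contMDiff.comp_contMDiffOn hOs) hder
  have hep : e p = 0 := by
    rw [heq hpe]
    simp only [linearizer_self, map_zero]
  refine ⟨e, he, hpe, hep, fun x hx => heq hx, hmf, ?_⟩
  have h0 : (0 : Euc n) ∈ e.target := hep ▸ e.map_source hpe
  have hs : e.symm 0 = p := by rw [← hep, e.left_inv hpe]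
  obtain ⟨δ, hδ, hball, happ⟩ := exists_ball_approx e.open_target h0
    (contDiffOn_comp_chart_symm hf.smooth he)
    ((fderiv_comp_chart_symm_eq_zero hf.smooth he h0).2 (by rw [hs]; exact hp))
    (d := fun i => Real.sign (d i)) (fun v w => by
      have h1 := fderiv_fderiv_chart hf.smooth he hp hpe hmf v w
      rw [hep] at h1
      rw [h1, hL, inner_diagL]
      simp) hε
  refine ⟨δ, hδ, hball, fun y hy => ?_⟩
  have h1 := happ y hy
  rw [hs] at h1
  exact h1

end MorseCharts

end EquivariantMorse

namespace EquivariantMorse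

/-! ### Finiteness of the critical set and existence of equivariant Morse charts -/

section MorseChartsExist

open Set Filter
open scoped RealInnerProductSpace

variable {n : ℕ} {M : Type*} [TopologicalSpace M] [ChartedSpace (Euc n) M]
  [IsManifold (𝓡 n) ∞ M] {f : M → ℝ} {G : Type*} [Group G] [MulAction G M] [SmoothAction n G M]
  [Fintype G]

/-- The linear normal form of an invariant form and the Hessian, and the charts realising it. -/
lemma exists_morseChart_of_form (hf : IsEquivariantMorse n G f)
    {B : M → Euc n →L[ℝ] Euc n →L[ℝ] ℝ} (hB : InvariantForm G B) {ε : ℝ} (hε : 0 < ε) (p : M) :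
    ∃ (L : Euc n ≃L[ℝ] Euc n) (d : Fin n → ℝ) (e : OpenPartialHomeomorph M (Euc n)) (δ : ℝ),
      0 < δ ∧ (p ∈ criticalPoints n f → (∀ i, d i ≠ 0) ∧
      (∀ v w : Euc n, hessian n f p v w = ∑ i, Real.sign (d i) * L v i * L w i) ∧
      (∀ v w, B p v w = ∑ i, |d i|⁻¹ * L v i * L w i) ∧
      e ∈ IsManifold.maximalAtlas (𝓡 n) ∞ M ∧ p ∈ e.source ∧ e p = 0 ∧
      (∀ x ∈ e.source, e x = L (linearizer G p x)) ∧
      (∀ v, dchart e p v = L v) ∧ Metric.ball 0 δ ⊆ e.target ∧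
      ∀ y ∈ Metric.ball (0 : Euc n) δ,
        |f (e.symm y) - f p - ⟪signL d y, y⟫ / 2| ≤ ε * ‖y‖ ^ 2 ∧
        ∀ w, |fderiv ℝ (fun z => f (e.symm z)) y w - ⟪signL d y, w⟫| ≤ ε * ‖y‖ * ‖w‖) := by
  by_cases hp : p ∈ criticalPoints n f
  · obtain ⟨L, d, hd, hH, hBL⟩ := exists_simultaneous_diagonalization (B p) (hessian n f p)
      (hB.symm p) (hB.pos p) (hessian_symm hf.smooth p) (hf.nondegenerate p hp)
    obtain ⟨e, he, hpe, hep, heL, hmf, δ, hδ, h1, h2⟩ := exists_morseChart hf hp L d hH hε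
    exact ⟨L, d, e, δ, hδ, fun _ => ⟨hd, hH, hBL, he, hpe, hep, heL, hmf, h1, h2⟩⟩
  · exact ⟨ContinuousLinearEquiv.refl ℝ _, 0, chartAt (Euc n) p, 1, one_pos, fun h => absurd h hp⟩

/-- The sum over the group of the pullbacks of the standard form in the preferred charts. -/
noncomputable def averagedForm (G : Type*) [Group G] [MulAction G M] [Fintype G] (p : M) :
    Euc n →L[ℝ] Euc n →L[ℝ] ℝ :=
  ∑ σ : G, (innerSL ℝ).bilinearComp (dact σ p) (dact σ p)

omit [IsManifold (𝓡 n) ∞ M] in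
lemma averagedForm_apply (p : M) (v w : Euc n) :
    averagedForm G p v w = ∑ σ : G, ⟪dact σ p v, dact σ p w⟫ := by
  simp [averagedForm]

-- Takes the place of an invariant metric where none is given, as in statements 1 to 3 and in the
-- finiteness of the critical set. It need not vary continuously with the point, since only its
-- values at critical points are used.
omit [IsManifold (𝓡 n) ∞ M] in
lemma invariantForm_averagedForm : InvariantForm G (averagedForm (M := M) (n := n) G) where
  symm p v w := by
    rw [averagedForm_apply, averagedForm_apply]
    exact Finset.sum_congr rfl fun σ _ => real_inner_comm _ _
  pos p v hv := by
    rw [averagedForm_apply]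
    refine Finset.sum_pos (fun σ _ => real_inner_self_pos.2 fun h => hv ?_) Finset.univ_nonempty
    rw [← dact_inv_dact σ p v, h, map_zero]
  invariant τ p v w := by
    rw [averagedForm_apply, averagedForm_apply]
    refine Fintype.sum_equiv (Equiv.mulRight τ) _ _ fun σ => ?_
    simp only [Equiv.coe_mulRight]
    rw [dact_mul]
    rfl

/-- In the direction `signL d y` the quadratic part has derivative `‖y‖²`, which an error of `ε
‖y‖²` cannot cancel. Hence critical points are isolated. -/
lemma eq_zero_of_fderiv_eq_zero {F : Euc n → ℝ} {d : Fin n → ℝ} (hd : ∀ i, d i ≠ 0) {ε : ℝ}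
    (hε : ε < 1) {y : Euc n} (hF : ∀ w, |fderiv ℝ F y w - ⟪signL d y, w⟫| ≤ ε * ‖y‖ * ‖w‖)
    (h : fderiv ℝ F y = 0) : y = 0 := by
  have h1 := hF (signL d y)
  rw [h, zero_apply, zero_sub, abs_neg, real_inner_self_eq_norm_sq,
    norm_signL hd, abs_of_nonneg (by positivity)] at h1
  by_contra hy
  have h2 : 0 < ‖y‖ := norm_pos_iff.2 hy
  nlinarith [mul_pos h2 h2]

/-- A Morse function on a compact manifold has finitely many critical points. -/
theorem finite_criticalPoints [CompactSpace M] (hf : IsEquivariantMorse n G f) :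
    (criticalPoints n f).Finite := by
  -- Critical points are isolated and the noncritical points form an open set; compactness does the
  -- rest.
  have hloc : ∀ x : M, ∃ U ∈ 𝓝 x, U ∩ criticalPoints n f ⊆ {x} := by
    intro x
    by_cases hx : x ∈ criticalPoints n f
    · obtain ⟨L, d, e, δ, hδ, h⟩ := exists_morseChart_of_form hf
        (invariantForm_averagedForm (n := n) (M := M) (G := G)) one_half_pos x
      obtain ⟨hd, -, -, he, hxe, hex, -, -, hsub, happ⟩ := h hx
      refine ⟨e.source ∩ e ⁻¹' Metric.ball 0 δ, inter_mem (e.open_source.mem_nhds hxe)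
        ((e.continuousAt hxe) (by rw [hex]; exact Metric.ball_mem_nhds _ hδ)), ?_⟩
      rintro q ⟨⟨hqe, hqδ⟩, hq⟩
      have h1 : e q = 0 := by
        refine eq_zero_of_fderiv_eq_zero hd (ε := 1 / 2) (by norm_num) (happ (e q) hqδ).2 ?_
        rw [fderiv_comp_chart_symm_eq_zero hf.smooth he (hsub hqδ), e.left_inv hqe]
        exact hq
      exact e.injOn hqe hxe (h1.trans hex.symm)
    · have he := IsManifold.chart_mem_maximalAtlas (I := 𝓡 n) (n := ∞) x
      set e := chartAt (Euc n) x
      have hxe : x ∈ e.source := mem_chart_source _ x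
      have hc := (contDiffOn_comp_chart_symm hf.smooth he).continuousOn_fderiv_of_isOpen
        e.open_target (by simp)
      have h1 : {y | fderiv ℝ (fun y => f (e.symm y)) y ≠ 0} ∈ 𝓝 (e x) :=
        (hc.continuousAt (e.open_target.mem_nhds (e.map_source hxe))).eventually_ne (by
          rw [Ne, fderiv_comp_chart_symm_eq_zero hf.smooth he (e.map_source hxe), e.left_inv hxe]
          exact hx)
      refine ⟨_, inter_mem (e.open_source.mem_nhds hxe) ((e.continuousAt hxe) h1), ?_⟩
      rintro q ⟨⟨hqe, hq⟩, hqc⟩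
      refine absurd ?_ hq
      rw [fderiv_comp_chart_symm_eq_zero hf.smooth he (e.map_source hqe), e.left_inv hqe]
      exact hqc
  choose U hU hUC using hloc
  obtain ⟨t, -, ht⟩ := isCompact_univ.elim_nhds_subcover U fun x _ => hU x
  refine t.finite_toSet.subset fun q hq => ?_
  obtain ⟨x, hx, hqx⟩ := mem_iUnion₂.1 (ht (mem_univ q))
  rwa [hUC x ⟨hqx, hq⟩]

/-- There are arbitrarily small systems of equivariant Morse charts. -/
theorem exists_morseCharts [CompactSpace M] [T2Space M] (hf : IsEquivariantMorse n G f)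
    {B : M → Euc n →L[ℝ] Euc n →L[ℝ] ℝ} (hB : InvariantForm G B) {ε : ℝ} (hε : 0 < ε)
    {U : M → Set M} (hU : ∀ p ∈ criticalPoints n f, U p ∈ 𝓝 p) {R₀ : ℝ} (hR₀ : 0 < R₀) :
    ∃ R ≤ R₀, ∃ c : MorseCharts G f B ε R, ∀ p ∈ criticalPoints n f, (c.e p).source ⊆ U p := by
  have hfin := finite_criticalPoints hf
  choose L d e δ hδ h using exists_morseChart_of_form hf hB hε
  choose hd hH hBL he hpe hep heL hmf hsub happ using h
  obtain ⟨D, hD, hDdisj⟩ := hfin.t2_separation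
  have hsmul : ∀ (σ : G) {p}, p ∈ criticalPoints n f → σ • p ∈ criticalPoints n f :=
    fun σ _ hp => smul_mem_criticalPoints hf σ hp
  -- Points near `p` must be carried by every `σ` into the chart around `σ • p`, where the
  -- linearising formula is valid; a finite group leaves a neighbourhood.
  have hV : ∀ p ∈ criticalPoints n f,
      U p ∩ D p ∩ ⋂ σ : G, (fun x : M => σ • x) ⁻¹' (e (σ • p)).source ∈ 𝓝 p := fun p hp =>
    inter_mem (inter_mem (hU p hp) ((hD p).2.mem_nhds (hD p).1)) (iInter_mem.2 fun σ =>
      (SmoothAction.smooth (n := n) σ).continuous.continuousAt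
        ((e (σ • p)).open_source.mem_nhds (hpe _ (hsmul σ hp))))
  have hr : ∀ p, ∃ r > 0, p ∈ criticalPoints n f → r ≤ δ p ∧ ∀ y ∈ Metric.ball (0 : Euc n) r,
      (e p).symm y ∈ U p ∩ D p ∩ ⋂ σ : G, (fun x : M => σ • x) ⁻¹' (e (σ • p)).source := by
    intro p
    by_cases hp : p ∈ criticalPoints n f
    · have h0 : (0 : Euc n) ∈ (e p).target := hep p hp ▸ (e p).map_source (hpe p hp)
      have hs : (e p).symm 0 = p := by rw [← hep p hp, (e p).left_inv (hpe p hp)]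
      have h1 := (e p).continuousAt_symm h0
      rw [ContinuousAt, hs] at h1
      obtain ⟨r, hr, hrV⟩ := Metric.mem_nhds_iff.1 (h1 (hV p hp))
      exact ⟨min r (δ p), lt_min hr (hδ p), fun _ => ⟨min_le_right _ _, fun y hy =>
        hrV (Metric.ball_subset_ball (min_le_left _ _) hy)⟩⟩
    · exact ⟨1, one_pos, fun h => absurd h hp⟩
  choose r hr hrV using hr
  obtain ⟨R, hR, hRR₀, hRr⟩ : ∃ R > 0, R ≤ R₀ ∧ ∀ p ∈ criticalPoints n f, R ≤ r p := by
    have hrp : ∀ p ∈ hfin.toFinset, 0 < r p := fun p _ => hr p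
    obtain ⟨R, hR, h⟩ : ∃ R > 0, ∀ p ∈ hfin.toFinset, R ≤ r p := by
      rcases hfin.toFinset.eq_empty_or_nonempty with h | h
      · exact ⟨1, one_pos, by simp [h]⟩
      · exact ⟨hfin.toFinset.inf' h r, (Finset.lt_inf'_iff h).2 hrp, fun p hp =>
          Finset.inf'_le _ hp⟩
    exact ⟨min R R₀, lt_min hR hR₀, min_le_right _ _, fun p hp =>
      (min_le_left _ _).trans (h p (hfin.mem_toFinset.2 hp))⟩
  have hball : ∀ p ∈ criticalPoints n f, Metric.ball (0 : Euc n) R ⊆ Metric.ball 0 (δ p) :=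
    fun p hp => Metric.ball_subset_ball ((hRr p hp).trans (hrV p hp).1)
  -- All charts are cut down to the same round ball. The action is isometric in these coordinates,
  -- so the chart domains are permuted.
  let e' : M → OpenPartialHomeomorph M (Euc n) := fun p =>
    (e p).restr ((e p).source ∩ e p ⁻¹' Metric.ball 0 R)
  have hopen : ∀ p, IsOpen ((e p).source ∩ e p ⁻¹' Metric.ball 0 R) := fun p =>
    (e p).isOpen_inter_preimage Metric.isOpen_ball
  have hsrc : ∀ p, (e' p).source = (e p).source ∩ e p ⁻¹' Metric.ball 0 R := fun p => by
    rw [OpenPartialHomeomorph.restr_source, (hopen p).interior_eq, ← inter_assoc, inter_self]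
  have hmemV : ∀ p ∈ criticalPoints n f, ∀ x ∈ (e' p).source,
      x ∈ U p ∩ D p ∩ ⋂ σ : G, (fun x : M => σ • x) ⁻¹' (e (σ • p)).source := by
    intro p hp x hx
    rw [hsrc] at hx
    have h1 := (hrV p hp).2 (e p x) (Metric.ball_subset_ball (hRr p hp) hx.2)
    rwa [(e p).left_inv hx.1] at h1
  let rot : G → M → Euc n →L[ℝ] Euc n := fun σ p =>
    (L (σ • p) : Euc n →L[ℝ] Euc n).comp ((dact σ p).comp ((L p).symm : Euc n →L[ℝ] Euc n))
  have hrot : ∀ σ p v, rot σ p (L p v) = L (σ • p) (dact σ p v) := fun σ p v => by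
    change L (σ • p) (dact σ p ((L p).symm (L p v))) = _
    rw [ContinuousLinearEquiv.symm_apply_apply]
  -- The action preserves both the Hessian and `B`, which are diagonalised in the coordinates at `p`
  -- and at `σ • p`.
  have hiso : ∀ (σ : G), ∀ p ∈ criticalPoints n f, (∀ v, ‖rot σ p v‖ = ‖v‖) ∧
      ∀ v, signL (d (σ • p)) (rot σ p v) = rot σ p (signL (d p) v) := by
    intro σ p hp
    have hR : ∀ v, (((L p).symm.trans (dactEquiv σ p)).trans (L (σ • p))) v = rot σ p v :=
      fun v => rfl
    have := isometry_of_simultaneous_diagonalization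
      (((L p).symm.trans (dactEquiv σ p)).trans (L (σ • p))) (hd p hp) (hd _ (hsmul σ hp))
      (fun v w => by
        have h1 := hessian_dact hf σ hp ((L p).symm v) ((L p).symm w)
        rw [hH p hp, hH _ (hsmul σ hp)] at h1
        simpa using h1)
      (fun v w => by
        have h1 := hB.invariant σ p ((L p).symm v) ((L p).symm w)
        rw [hBL p hp, hBL _ (hsmul σ hp)] at h1
        simpa using h1)
    exact this
  have happly : ∀ (σ : G), ∀ p ∈ criticalPoints n f, ∀ x ∈ (e' p).source,
      e (σ • p) (σ • x) = rot σ p (e p x) := by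
    intro σ p hp x hx
    rw [heL _ (hsmul σ hp) _ (mem_iInter.1 (hmemV p hp x hx).2 σ), linearizer_smul]
    rw [hsrc] at hx
    rw [heL p hp x hx.1, hrot]
  have hder : ∀ p ∈ criticalPoints n f, ∀ v, dchart (e' p) p v = L p v := hmf
  refine ⟨R, hRR₀, ⟨e', d, rot, hR, hd, ?_, ?_, ?_, ?_, ?_, ?_, ?_, ?_, ?_, ?_, ?_, ?_, ?_⟩, ?_⟩
  · exact fun p hp => restr_mem_maximalAtlas (contDiffGroupoid ∞ (𝓡 n)) (he p hp) (hopen p)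
  · intro p hp
    rw [hsrc]
    exact ⟨hpe p hp, by rw [mem_preimage, hep p hp]; exact Metric.mem_ball_self hR⟩
  · exact fun p hp => hep p hp
  · intro p hp
    rw [OpenPartialHomeomorph.restr_target, (hopen p).interior_eq]
    ext y
    constructor
    · rintro ⟨hy, -, hy2⟩
      rwa [mem_preimage, (e p).right_inv hy] at hy2
    · intro hy
      have h1 := hsub p hp (hball p hp hy)
      exact ⟨h1, (e p).map_target h1, by rwa [mem_preimage, (e p).right_inv h1]⟩
  · intro p hp q hq hpq
    exact (hDdisj hp hq hpq).mono (fun x hx => (hmemV p hp x hx).1.2)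
      fun x hx => (hmemV q hq x hx).1.2
  · intro σ p hp x hx
    rw [hsrc]
    refine ⟨mem_iInter.1 (hmemV p hp x hx).2 σ, ?_⟩
    rw [mem_preimage, happly σ p hp x hx, mem_ball_zero_iff, (hiso σ p hp).1]
    rw [hsrc] at hx
    exact mem_ball_zero_iff.1 hx.2
  · exact happly
  · exact fun σ p hp => (hiso σ p hp).1
  · exact fun σ p hp => (hiso σ p hp).2
  · exact fun p hp y hy => (happ p hp y (hball p hp hy)).1
  · exact fun p hp y hy => (happ p hp y (hball p hp hy)).2
  · intro p hp v w
    rw [hBL p hp]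
    simp only [hder p hp]
  · intro p hp v w
    rw [hH p hp, inner_diagL, hder p hp, hder p hp]
  · exact fun p hp x hx => (hmemV p hp x hx).1.1

end MorseChartsExist

end EquivariantMorse

namespace EquivariantMorse

/-! ### Equivariant gradient-like vector fields -/

section GradientLike

open Set Filter
open scoped RealInnerProductSpace

variable {n : ℕ} {M : Type*} [TopologicalSpace M] [ChartedSpace (Euc n) M]
  [IsManifold (𝓡 n) ∞ M]

/-- The differential of `f` at `x`. -/
noncomputable def dfun (f : M → ℝ) (x : M) : Euc n →L[ℝ] ℝ := mfderiv (𝓡 n) 𝓘(ℝ, ℝ) f x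

/-- The vector field on the source of the chart `e` whose expression in `e` is `W`. -/
noncomputable def fieldOfChart (e : OpenPartialHomeomorph M (Euc n)) (W : Euc n → Euc n) :
    (x : M) → TangentSpace (𝓡 n) x :=
  VectorField.mpullback (𝓡 n) (𝓡 n) e (fun y => (W y : TangentSpace (𝓡 n) y))

section

variable {e : OpenPartialHomeomorph M (Euc n)} (he : e ∈ IsManifold.maximalAtlas (𝓡 n) ∞ M)
  {W : Euc n → Euc n}

include he

lemma contMDiffOn_fieldOfChart (hW : ContDiffOn ℝ ∞ W e.target) :
    ContMDiffOn (𝓡 n) (𝓡 n).tangent ∞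
      (fun x => (⟨x, fieldOfChart e W x⟩ : TangentBundle (𝓡 n) M)) e.source := by
  intro x hx
  have hy := e.map_source hx
  refine (ContMDiffAt.mpullback_vectorField_preimage (n := ∞)
    (contMDiffAt_vectorSpace_iff_contDiffAt.2 (hW.contDiffAt (e.open_target.mem_nhds hy)))
    (contMDiffAt_of_mem_maximalAtlas he hx) (isInvertible_mfderiv_chart he hx)
    (by simp)).contMDiffWithinAt

lemma fieldOfChart_eq {x : M} (hx : x ∈ e.source) :
    fieldOfChart e W x = mfderiv (𝓡 n) (𝓡 n) e.symm (e x) (W (e x)) := by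
  change (mfderiv (𝓡 n) (𝓡 n) e x).inverse (W (e x)) = _
  obtain ⟨A, hA⟩ := isInvertible_mfderiv_chart he hx
  have h3 := mfderiv_chart_chart_symm he (e.map_source hx) (W (e x))
  rw [e.left_inv hx] at h3
  rw [← hA] at h3 ⊢
  rw [ContinuousLinearMap.inverse_equiv]
  exact (A.symm_apply_eq.2 h3.symm)

lemma dchart_fieldOfChart {x : M} (hx : x ∈ e.source) :
    dchart e x (fieldOfChart e W x) = W (e x) := by
  rw [fieldOfChart_eq he hx]
  have h3 := mfderiv_chart_chart_symm he (e.map_source hx) (W (e x))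
  rw [e.left_inv hx] at h3
  exact h3

variable {f : M → ℝ}

lemma dfun_eq_fderiv_chart (hf : ContMDiff (𝓡 n) 𝓘(ℝ, ℝ) ∞ f) {x : M} (hx : x ∈ e.source)
    (v : Euc n) : dfun f x v =
      fderiv ℝ (fun y => f (e.symm y)) (e x) (dchart e x v) := by
  rw [fderiv_comp_chart_symm hf he (e.map_source hx), e.left_inv hx]
  exact congrArg (fun u => mfderiv (𝓡 n) 𝓘(ℝ, ℝ) f x u) (mfderiv_chart_symm_chart he hx v).symm

lemma dfun_fieldOfChart (hf : ContMDiff (𝓡 n) 𝓘(ℝ, ℝ) ∞ f) {x : M} (hx : x ∈ e.source) :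
    dfun f x (fieldOfChart e W x) = fderiv ℝ (fun y => f (e.symm y)) (e x) (W (e x)) :=
  (dfun_eq_fderiv_chart he hf hx _).trans
    (congrArg (fderiv ℝ (fun y => f (e.symm y)) (e x)) (dchart_fieldOfChart he hx))

end

variable {f : M → ℝ} {G : Type*} [Group G] [MulAction G M] [SmoothAction n G M]

lemma dfun_dact (hf : IsEquivariantMorse n G f) (σ : G) (x : M) (v : Euc n) :
    dfun f (σ • x) (dact σ x v) = dfun f x v :=
  mfderiv_smul_comp hf σ x v

lemma MorseCharts.dchart_dact {B : M → Euc n →L[ℝ] Euc n →L[ℝ] ℝ} {ε R : ℝ}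
    (c : MorseCharts G f B ε R) (hf : IsEquivariantMorse n G f) (σ : G) {p : M}
    (hp : p ∈ criticalPoints n f) {x : M} (hx : x ∈ (c.e p).source) (v : Euc n) :
    dchart (c.e (σ • p)) (σ • x) (dact σ x v) = c.rot σ p (dchart (c.e p) x v) := by
  have hq := smul_mem_criticalPoints hf σ hp
  have h1 : HasMFDerivAt (𝓡 n) (𝓡 n) (fun z : M => c.e (σ • p) (σ • z)) x
      ((dchart (c.e (σ • p)) (σ • x)).comp (dact σ x)) :=
    HasMFDerivAt.comp x ((mdifferentiable_of_mem_maximalAtlas (c.mem_atlas _ hq)).mdifferentiableAt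
      (c.smul_mem σ p hp x hx)).hasMFDerivAt (mdifferentiableAt_smul σ x).hasMFDerivAt
  have h2 : HasMFDerivAt (𝓡 n) (𝓡 n) (fun z : M => c.rot σ p (c.e p z)) x
      ((c.rot σ p).comp (dchart (c.e p) x)) :=
    HasMFDerivAt.comp x (hasMFDerivAt_iff_hasFDerivAt.2 (c.rot σ p).hasFDerivAt)
      ((mdifferentiable_of_mem_maximalAtlas (c.mem_atlas _ hp)).mdifferentiableAt
        hx).hasMFDerivAt
  have h3 : (fun z : M => c.e (σ • p) (σ • z)) =ᶠ[𝓝 x] fun z => c.rot σ p (c.e p z) := by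
    filter_upwards [(c.e p).open_source.mem_nhds hx] with z hz using c.smul_apply σ p hp z hz
  exact congrArg (fun L => L v) (hasMFDerivAt_unique h1 (h2.congr_of_eventuallyEq h3))

/-- There is an equivariant vector field along which `f` decreases, with prescribed expressions in
Morse charts. -/
theorem exists_gradientLike [CompactSpace M] [T2Space M] [Fintype G]
    (hf : IsEquivariantMorse n G f)
    {B : M → Euc n →L[ℝ] Euc n →L[ℝ] ℝ} {ε R : ℝ} (c : MorseCharts G f B ε R)
    {W : M → Euc n → Euc n}
    (hWs : ∀ p ∈ criticalPoints n f, ContDiffOn ℝ ∞ (W p) (Metric.ball 0 R))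
    (hWG : ∀ (σ : G), ∀ p ∈ criticalPoints n f, ∀ y ∈ Metric.ball (0 : Euc n) R,
      W (σ • p) (c.rot σ p y) = c.rot σ p (W p y))
    (hWf : ∀ p ∈ criticalPoints n f, ∀ y ∈ Metric.ball (0 : Euc n) R, y ≠ 0 →
      fderiv ℝ (fun z => f ((c.e p).symm z)) y (W p y) < 0) {R' : ℝ} (hR' : R' < R) :
    ∃ X : (x : M) → TangentSpace (𝓡 n) x, SmoothField X ∧
      (∀ (σ : G) x, dact σ x (X x) = X (σ • x)) ∧
      (∀ p ∈ criticalPoints n f, ∀ y, ‖y‖ ≤ R' → chartField (c.e p) X y = W p y) ∧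
      ∀ x ∉ criticalPoints n f, dfun f x (X x) < 0 := by
  have hfin := finite_criticalPoints hf
  -- Both requirements on the value at `x` are convex, hence compatible with partitions of unity and
  -- with group averages.
  let t : (x : M) → Set (TangentSpace (𝓡 n) x) := fun x =>
    {v | (x ∉ criticalPoints n f → dfun f x v < 0) ∧
      ∀ p ∈ criticalPoints n f, x ∈ (c.e p).source → ‖c.e p x‖ ≤ R' →
        dchart (c.e p) x v = W p (c.e p x)}
  have ht : ∀ x, Convex ℝ (t x) := by
    intro x v hv w hw a b ha hb hab
    refine ⟨fun hx => ?_, fun p hp hxp hn => ?_⟩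
    · have h1 : dfun f x (a • v + b • w) = a * dfun f x v + b * dfun f x w := by
        refine (map_add (dfun f x) (a • v : Euc n) (b • w : Euc n)).trans ?_
        exact congrArg₂ (· + ·) (map_smul (dfun f x) a v) (map_smul (dfun f x) b w)
      rw [h1]
      have h2 := hv.1 hx
      have h3 := hw.1 hx
      rcases ha.eq_or_lt with rfl | ha
      · rw [zero_add] at hab
        subst hab
        simpa using h3
      · nlinarith [mul_pos_of_neg_of_neg h2 (neg_lt_zero.2 ha)]
    · have h1 : dchart (c.e p) x (a • v + b • w) =
          a • dchart (c.e p) x v + b • dchart (c.e p) x w := by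
        refine (map_add (dchart (c.e p) x) (a • v : Euc n) (b • w : Euc n)).trans ?_
        exact congrArg₂ (· + ·) (map_smul (dchart (c.e p) x) a v) (map_smul (dchart (c.e p) x) b w)
      rw [h1, hv.2 p hp hxp hn, hw.2 p hp hxp hn, ← add_smul, hab, one_smul]
  have hloc : ∀ x₀ : M, ∃ U ∈ 𝓝 x₀, ∃ s : (x : M) → TangentSpace (𝓡 n) x,
      ContMDiffOn (𝓡 n) (𝓡 n).tangent ∞ (fun x => (⟨x, s x⟩ : TangentBundle (𝓡 n) M)) U ∧
      ∀ x ∈ U, s x ∈ t x := by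
    intro x₀
    by_cases hx₀ : ∃ p ∈ criticalPoints n f, x₀ ∈ (c.e p).source
    · obtain ⟨p, hp, hx₀⟩ := hx₀
      have he := c.mem_atlas p hp
      refine ⟨_, (c.e p).open_source.mem_nhds hx₀, fieldOfChart (c.e p) (W p),
        contMDiffOn_fieldOfChart he (by rw [c.target_eq p hp]; exact hWs p hp),
        fun x hx => ⟨fun hxC => ?_, fun q hq hxq _ => ?_⟩⟩
      · refine (dfun_fieldOfChart he hf.smooth hx).trans_lt ?_
        refine hWf p hp _ (c.target_eq p hp ▸ (c.e p).map_source hx) fun h0 => hxC ?_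
        rwa [(c.e p).injOn hx (c.mem_source p hp) (h0.trans (c.apply_self p hp).symm)]
      · have hpq : q = p := by
          by_contra h
          exact (c.disjoint q hq p hp h).le_bot ⟨hxq, hx⟩
        subst hpq
        exact dchart_fieldOfChart he hx
    · have hx₀C : x₀ ∉ criticalPoints n f := fun h => hx₀ ⟨x₀, h, c.mem_source x₀ h⟩
      have he := IsManifold.chart_mem_maximalAtlas (I := 𝓡 n) (n := ∞) x₀
      set e := chartAt (Euc n) x₀
      have hxe : x₀ ∈ e.source := mem_chart_source _ x₀
      have h0 : fderiv ℝ (fun y => f (e.symm y)) (e x₀) ≠ 0 := by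
        rw [Ne, fderiv_comp_chart_symm_eq_zero hf.smooth he (e.map_source hxe), e.left_inv hxe]
        exact hx₀C
      obtain ⟨w, hw⟩ : ∃ w, fderiv ℝ (fun y => f (e.symm y)) (e x₀) w < 0 := by
        obtain ⟨w, hw⟩ := DFunLike.ne_iff.1 h0
        rcases lt_or_gt_of_ne hw with h | h
        · exact ⟨w, h⟩
        · refine ⟨-w, ?_⟩
          rw [map_neg]
          exact neg_lt_zero.2 h
      have hc := (contDiffOn_comp_chart_symm hf.smooth he).continuousOn_fderiv_of_isOpen
        e.open_target (by simp)
      have h1 : {y | fderiv ℝ (fun y => f (e.symm y)) y w < 0} ∈ 𝓝 (e x₀) :=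
        ((hc.clm_apply continuousOn_const).continuousAt
          (e.open_target.mem_nhds (e.map_source hxe))).eventually_lt_const hw
      -- The balls of radius `R' < R` are compact, so a point outside all chart domains has a
      -- neighbourhood avoiding them, and the prescription imposes nothing there.
      have hK : ∀ p ∈ criticalPoints n f,
          ((c.e p).symm '' Metric.closedBall 0 R')ᶜ ∈ 𝓝 x₀ := by
        intro p hp
        have hsub : Metric.closedBall (0 : Euc n) R' ⊆ (c.e p).target := by
          rw [c.target_eq p hp]
          exact Metric.closedBall_subset_ball hR'
        refine ((isCompact_closedBall (0 : Euc n) R').image_of_continuousOn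
          ((c.e p).continuousOn_symm.mono hsub)).isClosed.isOpen_compl.mem_nhds ?_
        rintro ⟨y, hy, rfl⟩
        exact hx₀ ⟨p, hp, (c.e p).map_target (hsub hy)⟩
      refine ⟨_, inter_mem (inter_mem (e.open_source.mem_nhds hxe) ((e.continuousAt hxe) h1))
        ((biInter_mem hfin).2 hK), fieldOfChart e fun _ => w,
        (contMDiffOn_fieldOfChart he contDiffOn_const).mono fun x hx => hx.1.1,
        fun x hx => ⟨fun _ => ?_, fun p hp hxp hn => ?_⟩⟩
      · exact (dfun_fieldOfChart he hf.smooth hx.1.1).trans_lt hx.1.2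
      · refine absurd ⟨c.e p x, mem_closedBall_zero_iff.2 hn, (c.e p).left_inv hxp⟩
          (mem_iInter₂.1 hx.2 p hp)
  obtain ⟨s, hs⟩ := exists_contMDiffSection_forall_mem_convex_of_local (I := 𝓡 n) (n := ⊤)
    (fun x : M => TangentSpace (𝓡 n) x) t ht hloc
  have htG : ∀ (σ : G) x, ∀ v ∈ t (σ • x), dact σ⁻¹ (σ • x) v ∈ t x := by
    intro σ x v hv
    have hv' : v = dact σ x (dact σ⁻¹ (σ • x) v) := (dact_dact_inv σ x v).symm
    refine ⟨fun hx => ?_, fun p hp hxp hn => ?_⟩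
    · have h1 := hv.1 fun h => hx (by
        rw [← inv_smul_smul σ x]
        exact smul_mem_criticalPoints hf σ⁻¹ h)
      rw [hv'] at h1
      rwa [dfun_dact hf] at h1
    · have h1 := hv.2 (σ • p) (smul_mem_criticalPoints hf σ hp) (c.smul_mem σ p hp x hxp) (by
        rw [c.smul_apply σ p hp x hxp, c.rot_norm σ p hp]
        exact hn)
      rw [hv', c.dchart_dact hf σ hp hxp, c.smul_apply σ p hp x hxp,
        hWG σ p hp _ (c.target_eq p hp ▸ (c.e p).map_source hxp)] at h1
      have h2 : c.rot σ p (dchart (c.e p) x (dact σ⁻¹ (σ • x) v) - W p (c.e p x)) = 0 := by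
        rw [map_sub, h1, sub_self]
      rw [← norm_eq_zero, c.rot_norm σ p hp, norm_eq_zero, sub_eq_zero] at h2
      exact h2
  -- Averaging the pullbacks makes the field equivariant; by `htG` each pullback satisfies the
  -- convex conditions.
  let X : (x : M) → TangentSpace (𝓡 n) x := fun x => ∑ σ : G, (Fintype.card G : ℝ)⁻¹ •
    (dact σ⁻¹ (σ • x) (s (σ • x)) : TangentSpace (𝓡 n) x)
  have hXt : ∀ x, X x ∈ t x := fun x =>
    (ht x).sum_mem (fun _ _ => by positivity) (by simp) fun σ _ => htG σ x _ (hs (σ • x))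
  refine ⟨X, ?_, ?_, ?_, fun x => (hXt x).1⟩
  · refine ContMDiff.sum_section fun σ _ => ContMDiff.const_smul_section ?_
    have h1 : ContMDiff (𝓡 n) (𝓡 n).tangent ∞ (fun x => (⟨x, VectorField.mpullback (𝓡 n) (𝓡 n)
        (fun x : M => σ • x) s x⟩ : TangentBundle (𝓡 n) M)) :=
      ContMDiff.mpullback_vectorField s.contMDiff (SmoothAction.smooth σ)
        (fun x => ⟨dactEquiv σ x, rfl⟩) (by simp)
    refine h1.congr fun x => ?_
    have h2 : VectorField.mpullback (𝓡 n) (𝓡 n) (fun x : M => σ • x) s x =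
        dact σ⁻¹ (σ • x) (s (σ • x)) := by
      change (mfderiv (𝓡 n) (𝓡 n) (fun x : M => σ • x) x).inverse (s (σ • x)) = _
      exact congrArg (fun L : Euc n →L[ℝ] Euc n => L (s (σ • x)))
        (ContinuousLinearMap.inverse_equiv (dactEquiv σ x))
    rw [h2]
  · intro τ x
    change dact τ x (∑ σ : G, (Fintype.card G : ℝ)⁻¹ • dact σ⁻¹ (σ • x) (s (σ • x))) = _
    rw [map_sum]
    refine Fintype.sum_equiv (Equiv.mulRight τ⁻¹) _ _ fun σ => ?_
    have h1 : (σ * τ⁻¹) • τ • x = σ • x := by rw [smul_smul, inv_mul_cancel_right]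
    have h2 := dact_mul (n := n) τ σ⁻¹ (σ • x)
    rw [inv_smul_smul] at h2
    rw [map_smul]
    simp only [Equiv.coe_mulRight]
    rw [h1, mul_inv_rev, inv_inv, h2]
    rfl
  · intro p hp y hy
    have hyt : y ∈ (c.e p).target := by
      rw [c.target_eq p hp, mem_ball_zero_iff]
      exact hy.trans_lt hR'
    have h1 := (hXt ((c.e p).symm y)).2 p hp ((c.e p).map_target hyt)
      (by rwa [(c.e p).right_inv hyt])
    rw [(c.e p).right_inv hyt] at h1
    exact h1

end GradientLike

end EquivariantMorse

namespace EquivariantMorse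

/-! ### Functions along a flow -/

section AlongFlow

open Set Filter
open scoped RealInnerProductSpace

/-- A function which does not decrease while its value is close to `r` stays above `r`. -/
lemma le_of_deriv_nonneg_near {u u' : ℝ → ℝ} {r α T : ℝ} (hα : 0 < α) (hu : Continuous u)
    (h : ∀ t ∈ Icc 0 T, |u t - r| < α → HasDerivAt u (u' t) t ∧ 0 ≤ u' t) (h0 : r ≤ u 0)
    (hT : 0 ≤ T) : r ≤ u T := by
  by_contra! hlt
  -- At the last time `s` with `u s ≥ r` the value is exactly `r`, so `u` is nondecreasing just
  -- after `s`, contradicting maximality.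
  obtain ⟨s, ⟨⟨hs0, hsT⟩, hs⟩, hsmax⟩ : ∃ s ∈ Icc 0 T ∩ u ⁻¹' Ici r, ∀ t ∈ Icc 0 T ∩ u ⁻¹' Ici r,
      t ≤ s := by
    obtain ⟨s, hs⟩ := (isCompact_Icc.inter_right (isClosed_Ici.preimage hu)).exists_isGreatest
      ⟨0, ⟨le_refl 0, hT⟩, h0⟩
    exact ⟨s, hs.1, fun t ht => hs.2 ht⟩
  have hsT' : s < T := lt_of_le_of_ne hsT (by rintro rfl; exact absurd hs (not_le.2 hlt))
  have hbelow : ∀ t ∈ Ioc s T, u t < r := fun t ht => by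
    by_contra! h1
    exact absurd (hsmax t ⟨⟨hs0.trans ht.1.le, ht.2⟩, h1⟩) (not_le.2 ht.1)
  have hus : u s = r := by
    refine le_antisymm ?_ hs
    have h1 : Tendsto u (𝓝[>] s) (𝓝 (u s)) := hu.continuousAt.continuousWithinAt
    exact le_of_tendsto h1 (mem_of_superset (Ioc_mem_nhdsGT hsT') fun t ht => (hbelow t ht).le)
  have h1 : u ⁻¹' Metric.ball r α ∈ 𝓝 s :=
    hu.continuousAt (by rw [hus]; exact Metric.ball_mem_nhds _ hα)
  obtain ⟨δ, hδ, hball⟩ := Metric.mem_nhds_iff.1 h1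
  set s' := min T (s + δ / 2)
  have hss' : s < s' := lt_min hsT' (by linarith)
  have hnear : ∀ t ∈ Icc s s', HasDerivAt u (u' t) t ∧ 0 ≤ u' t := by
    intro t ht
    refine h t ⟨hs0.trans ht.1, ht.2.trans (min_le_left _ _)⟩ ?_
    have h2 : t ∈ Metric.ball s δ := by
      rw [Metric.mem_ball, Real.dist_eq, abs_of_nonneg (by linarith [ht.1])]
      linarith [ht.2.trans (min_le_right _ _)]
    have h3 := hball h2
    rwa [mem_preimage, Metric.mem_ball, Real.dist_eq] at h3
  have hmono : MonotoneOn u (Icc s s') := by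
    refine monotoneOn_of_hasDerivWithinAt_nonneg (convex_Icc _ _) hu.continuousOn (f' := u')
      (fun t ht => ?_) fun t ht => ?_
    · exact (hnear t (interior_subset ht)).1.hasDerivWithinAt
    · exact (hnear t (interior_subset ht)).2
  have h2 := hmono (left_mem_Icc.2 hss'.le) (right_mem_Icc.2 hss'.le) hss'.le
  linarith [hbelow s' ⟨hss', min_le_left _ _⟩]

/-- A flow along which `h` decreases carries `Y` into `Z` in finite time, if there is no stationary
point in between. -/
lemma exists_time_of_deriv_neg {M : Type*} [TopologicalSpace M] [CompactSpace M] {Φ : ℝ → M → M}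
    (hadd : ∀ s t x, Φ (s + t) x = Φ s (Φ t x)) (h0 : ∀ x, Φ 0 x = x) {h h' : M → ℝ}
    (hh : Continuous h) (hh' : Continuous h')
    (hder : ∀ x t, HasDerivAt (fun s => h (Φ s x)) (h' (Φ t x)) t) {Y Z K : Set M}
    (hY : ∀ t, 0 ≤ t → ∀ x ∈ Y, Φ t x ∈ Y) (hZ : ∀ t, 0 ≤ t → ∀ x ∈ Z, Φ t x ∈ Z)
    (hK : IsClosed K) (hYZK : Y ⊆ Z ∪ K) (hneg : ∀ x ∈ K, h' x < 0) :
    ∃ T, 0 ≤ T ∧ ∀ x ∈ Y, Φ T x ∈ Z := by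
  obtain ⟨δ, hδ, hδK⟩ : ∃ δ > 0, ∀ x ∈ K, h' x ≤ -δ := by
    rcases K.eq_empty_or_nonempty with rfl | hne
    · exact ⟨1, one_pos, by simp⟩
    · obtain ⟨x, hx, hmax⟩ := hK.isCompact.exists_isMaxOn hne hh'.continuousOn
      exact ⟨-h' x, neg_pos.2 (hneg x hx), fun y hy => by rw [neg_neg]; exact hmax hy⟩
  obtain ⟨C, hC⟩ := (isCompact_range hh).isBounded.exists_norm_le
  have hC' : ∀ x, |h x| ≤ C := fun x => hC _ ⟨x, rfl⟩
  -- An orbit remaining in `K` loses height at rate at least `δ`; over this time the loss exceeds `2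
  -- * |C|`, the largest possible oscillation of `h`.
  refine ⟨(2 * |C| + 1) / δ, by positivity, fun x hx => ?_⟩
  set T := (2 * |C| + 1) / δ
  have hT : 0 ≤ T := by positivity
  by_contra hxZ
  have hin : ∀ t ∈ Icc 0 T, Φ t x ∈ K := by
    intro t ht
    refine (hYZK (hY t ht.1 x hx)).resolve_left fun h1 => hxZ ?_
    have h2 := hZ (T - t) (by linarith [ht.2]) _ h1
    rwa [← hadd, sub_add_cancel] at h2
  have hanti : AntitoneOn (fun t => h (Φ t x) + δ * t) (Icc 0 T) := by
    have hd : ∀ t, HasDerivAt (fun t => h (Φ t x) + δ * t) (h' (Φ t x) + δ) t := fun t =>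
      (hder x t).add (by simpa using (hasDerivAt_id t).const_mul δ)
    refine antitoneOn_of_hasDerivWithinAt_nonpos (convex_Icc _ _)
      (fun t _ => (hd t).continuousAt.continuousWithinAt)
      (fun t _ => (hd t).hasDerivWithinAt) fun t ht => ?_
    linarith [hδK _ (hin t (interior_subset ht))]
  have h1 := hanti (left_mem_Icc.2 hT) (right_mem_Icc.2 hT) hT
  have h2 : δ * T = 2 * |C| + 1 := mul_div_cancel₀ _ hδ.ne'
  simp only [h2, mul_zero, add_zero, h0] at h1
  linarith [(abs_le.1 (hC' x)).2, (abs_le.1 (hC' (Φ T x))).1, le_abs_self C]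

variable {n : ℕ} {M : Type*} [TopologicalSpace M] [ChartedSpace (Euc n) M]
  [IsManifold (𝓡 n) ∞ M] {X : (x : M) → TangentSpace (𝓡 n) x}

lemma dfun_field_chart {e : OpenPartialHomeomorph M (Euc n)}
    (he : e ∈ IsManifold.maximalAtlas (𝓡 n) ∞ M) {h : M → ℝ}
    (hh : ContMDiff (𝓡 n) 𝓘(ℝ, ℝ) ∞ h) {x : M} (hx : x ∈ e.source) :
    dfun h x (X x) = fderiv ℝ (fun y => h (e.symm y)) (e x) (chartField e X (e x)) := by
  refine (dfun_eq_fderiv_chart he hh hx _).trans ?_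
  rw [chartField, e.left_inv hx]
  rfl

lemma continuous_dfun_field {h : M → ℝ} (hh : ContMDiff (𝓡 n) 𝓘(ℝ, ℝ) ∞ h) (hX : SmoothField X) :
    Continuous fun x => dfun h x (X x) := by
  rw [continuous_iff_continuousAt]
  intro x₀
  have he := IsManifold.chart_mem_maximalAtlas (I := 𝓡 n) (n := ∞) x₀
  set e := chartAt (Euc n) x₀
  have hx₀ : x₀ ∈ e.source := mem_chart_source _ x₀
  have hy := e.map_source hx₀
  have h1 := ((contDiffOn_comp_chart_symm hh he).continuousOn_fderiv_of_isOpen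
    e.open_target (by simp)).continuousAt (e.open_target.mem_nhds hy)
  have h2 := (h1.clm_apply (contDiffAt_chartField he hX hy).continuousAt).comp (e.continuousAt hx₀)
  refine h2.congr ?_
  filter_upwards [e.open_source.mem_nhds hx₀] with x hx
  exact (dfun_field_chart he hh hx).symm

lemma IsFlow.hasDerivAt_comp {Φ : ℝ → M → M} (hΦ : IsFlow X Φ) {h : M → ℝ}
    (hh : ContMDiff (𝓡 n) 𝓘(ℝ, ℝ) ∞ h) (x : M) (t : ℝ) :
    HasDerivAt (fun s => h (Φ s x)) (dfun h (Φ t x) (X (Φ t x))) t :=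
  hasDerivAt_comp_curve (hΦ.curve x t) (hh.mdifferentiableAt (by simp))

lemma IsFlow.antitone_comp {Φ : ℝ → M → M} (hΦ : IsFlow X Φ) {h : M → ℝ}
    (hh : ContMDiff (𝓡 n) 𝓘(ℝ, ℝ) ∞ h) (hneg : ∀ x, dfun h x (X x) ≤ 0) (x : M) :
    Antitone fun s => h (Φ s x) :=
  antitone_of_hasDerivAt_nonpos (fun t => hΦ.hasDerivAt_comp hh x t) fun _ => hneg _

/-- The translate of an integral curve of an equivariant field is again one, and integral curves are
unique. -/
lemma IsFlow.smul [T2Space M] {G : Type*} [Group G] [MulAction G M] [SmoothAction n G M]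
    (hX : SmoothField X) (hXG : ∀ (σ : G) x, dact σ x (X x) = X (σ • x)) {Φ : ℝ → M → M}
    (hΦ : IsFlow X Φ) (t : ℝ) (σ : G) (x : M) : Φ t (σ • x) = σ • Φ t x := by
  have h1 : IsMIntegralCurve (I := 𝓡 n) (fun t => σ • Φ t x) X := by
    intro t
    refine ((mdifferentiableAt_smul (n := n) σ (Φ t x)).hasMFDerivAt.comp t
      (hΦ.curve x t)).congr_mfderiv ?_
    ext
    change dact σ (Φ t x) ((1 : ℝ) • X (Φ t x) : Euc n) = ((1 : ℝ) • X (σ • Φ t x) : Euc n)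
    rw [← hXG]
    exact map_smul (dact σ (Φ t x)) (1 : ℝ) (X (Φ t x))
  have h2 := hΦ.eq_of_curve hX h1 t
  rw [hΦ.zero] at h2
  exact h2.symm

end AlongFlow

/-! ### Gluing functions defined in Morse charts -/

section Glue

open Set Filter

variable {n : ℕ} {M : Type*} [TopologicalSpace M] [ChartedSpace (Euc n) M]
  [IsManifold (𝓡 n) ∞ M] {f : M → ℝ} {G : Type*} [Group G] [MulAction G M] [SmoothAction n G M]
  {B : M → Euc n →L[ℝ] Euc n →L[ℝ] ℝ} {ε R : ℝ} (c : MorseCharts G f B ε R)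

namespace MorseCharts

lemma eq_of_mem_source {p q x : M} (hp : p ∈ criticalPoints n f) (hq : q ∈ criticalPoints n f)
    (hxp : x ∈ (c.e p).source) (hxq : x ∈ (c.e q).source) : p = q := by
  by_contra h
  exact (c.disjoint p hp q hq h).le_bot ⟨hxp, hxq⟩

lemma apply_mem_ball {p x : M} (hp : p ∈ criticalPoints n f) (hx : x ∈ (c.e p).source) :
    c.e p x ∈ Metric.ball (0 : Euc n) R :=
  c.target_eq p hp ▸ (c.e p).map_source hx

lemma symm_zero {p : M} (hp : p ∈ criticalPoints n f) : (c.e p).symm 0 = p := by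
  rw [← c.apply_self p hp, (c.e p).left_inv (c.mem_source p hp)]

lemma isCompact_image_closedBall {p : M} (hp : p ∈ criticalPoints n f) {r : ℝ} (hr : r < R) :
    IsCompact ((c.e p).symm '' Metric.closedBall 0 r) :=
  (isCompact_closedBall (0 : Euc n) r).image_of_continuousOn
    ((c.e p).continuousOn_symm.mono (by
      rw [c.target_eq p hp]
      exact Metric.closedBall_subset_ball hr))

lemma mem_image_closedBall {p : M} {x : M} {r : ℝ}
    (hx : x ∈ (c.e p).source) (h : ‖c.e p x‖ ≤ r) :
    x ∈ (c.e p).symm '' Metric.closedBall 0 r :=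
  ⟨c.e p x, mem_closedBall_zero_iff.2 h, (c.e p).left_inv hx⟩

/-- Away from the charts, only the outer part of the charts is near. -/
lemma eventually_of_notMem [CompactSpace M] [T2Space M] [Fintype G]
    (hf : IsEquivariantMorse n G f) {x₀ : M}
    (hx₀ : ¬∃ p ∈ criticalPoints n f, x₀ ∈ (c.e p).source) {r : ℝ} (hr : r < R) :
    ∀ᶠ x in 𝓝 x₀, ∀ p ∈ criticalPoints n f, x ∈ (c.e p).source → r < ‖c.e p x‖ := by
  have hK : ∀ p ∈ criticalPoints n f, ((c.e p).symm '' Metric.closedBall 0 r)ᶜ ∈ 𝓝 x₀ := by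
    intro p hp
    refine (c.isCompact_image_closedBall hp hr).isClosed.isOpen_compl.mem_nhds ?_
    rintro ⟨y, hy, rfl⟩
    refine hx₀ ⟨p, hp, (c.e p).map_target ?_⟩
    rw [c.target_eq p hp]
    exact Metric.closedBall_subset_ball hr hy
  filter_upwards [(biInter_mem (finite_criticalPoints hf)).2 hK] with x hx p hp hxp
  by_contra! h
  exact mem_iInter₂.1 hx p hp (c.mem_image_closedBall hxp h)

open Classical in
/-- The function given by `g p` in the chart around `p`, and zero outside of the charts. -/
noncomputable def glue (g : M → Euc n → ℝ) (x : M) : ℝ :=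
  if h : ∃ p ∈ criticalPoints n f, x ∈ (c.e p).source then g h.choose (c.e h.choose x) else 0

variable {g : M → Euc n → ℝ}

lemma glue_apply {p x : M} (hp : p ∈ criticalPoints n f) (hx : x ∈ (c.e p).source) :
    c.glue g x = g p (c.e p x) := by
  have h : ∃ p ∈ criticalPoints n f, x ∈ (c.e p).source := ⟨p, hp, hx⟩
  rw [glue, dif_pos h, c.eq_of_mem_source h.choose_spec.1 hp h.choose_spec.2 hx]

lemma glue_eq_zero {x : M} (hx : ¬∃ p ∈ criticalPoints n f, x ∈ (c.e p).source) :
    c.glue g x = 0 :=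
  dif_neg hx

lemma glue_smul (hf : IsEquivariantMorse n G f)
    (hg : ∀ (σ : G), ∀ p ∈ criticalPoints n f, ∀ y ∈ Metric.ball (0 : Euc n) R,
      g (σ • p) (c.rot σ p y) = g p y) (σ : G) (x : M) : c.glue g (σ • x) = c.glue g x := by
  by_cases hx : ∃ p ∈ criticalPoints n f, x ∈ (c.e p).source
  · obtain ⟨p, hp, hx⟩ := hx
    rw [c.glue_apply hp hx, c.glue_apply (smul_mem_criticalPoints hf σ hp)
      (c.smul_mem σ p hp x hx), c.smul_apply σ p hp x hx, hg σ p hp _ (c.apply_mem_ball hp hx)]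
  · rw [c.glue_eq_zero hx, c.glue_eq_zero]
    rintro ⟨p, hp, hxp⟩
    refine hx ⟨σ⁻¹ • p, smul_mem_criticalPoints hf _ hp, ?_⟩
    have h := c.smul_mem σ⁻¹ p hp _ hxp
    rwa [inv_smul_smul] at h

/-- Near a point outside all charts only the outer parts of the charts occur, where the function
vanishes. The order `m` is left free because `rho` is merely continuous. -/
lemma contMDiff_glue [CompactSpace M] [T2Space M] [Fintype G]
    (hf : IsEquivariantMorse n G f) {m : ℕ∞ω} (hm : m ≤ ∞)
    (hg : ∀ p ∈ criticalPoints n f, ContDiffOn ℝ m (g p) (Metric.ball 0 R)) {R' : ℝ} (hR' : R' < R)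
    (hsupp : ∀ p ∈ criticalPoints n f, ∀ y ∈ Metric.ball (0 : Euc n) R, R' < ‖y‖ → g p y = 0) :
    ContMDiff (𝓡 n) 𝓘(ℝ, ℝ) m (c.glue g) := by
  intro x₀
  by_cases hx₀ : ∃ p ∈ criticalPoints n f, x₀ ∈ (c.e p).source
  · obtain ⟨p, hp, hx₀⟩ := hx₀
    have h1 : ContMDiffAt (𝓡 n) 𝓘(ℝ, ℝ) m (fun x => g p (c.e p x)) x₀ :=
      ContMDiffAt.comp x₀ (g := g p) ((hg p hp).contDiffAt (Metric.isOpen_ball.mem_nhds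
        (c.apply_mem_ball hp hx₀))).contMDiffAt
        ((contMDiffAt_of_mem_maximalAtlas (c.mem_atlas p hp) hx₀).of_le hm)
    refine h1.congr_of_eventuallyEq ?_
    filter_upwards [(c.e p).open_source.mem_nhds hx₀] with x hx using c.glue_apply hp hx
  · refine (contMDiffAt_const (c := (0 : ℝ))).congr_of_eventuallyEq ?_
    filter_upwards [c.eventually_of_notMem hf hx₀ hR'] with x hx
    by_cases h : ∃ p ∈ criticalPoints n f, x ∈ (c.e p).source
    · obtain ⟨p, hp, hxp⟩ := h
      rw [c.glue_apply hp hxp, hsupp p hp _ (c.apply_mem_ball hp hxp) (hx p hp hxp)]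
    · exact c.glue_eq_zero h

end MorseCharts

end Glue

end EquivariantMorse

namespace EquivariantMorse

/-! ### The squared distance to the critical points on a level -/

section Rho

open Set Filter
open scoped RealInnerProductSpace

variable {n : ℕ} {M : Type*} [TopologicalSpace M] [ChartedSpace (Euc n) M]
  [IsManifold (𝓡 n) ∞ M] {f : M → ℝ} {G : Type*} [Group G] [MulAction G M] [SmoothAction n G M]
  {B : M → Euc n →L[ℝ] Euc n →L[ℝ] ℝ} {ε R : ℝ} (c : MorseCharts G f B ε R)

namespace MorseCharts

lemma rot_inner (σ : G) {p : M} (hp : p ∈ criticalPoints n f) (y z : Euc n) :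
    ⟪c.rot σ p y, c.rot σ p z⟫ = ⟪y, z⟫ :=
  LinearIsometry.inner_map_map (⟨(c.rot σ p).toLinearMap, c.rot_norm σ p hp⟩ :
    Euc n →ₗᵢ[ℝ] Euc n) y z

lemma symm_rot (σ : G) {p : M} (hp : p ∈ criticalPoints n f)
    {y : Euc n} (hy : y ∈ Metric.ball (0 : Euc n) R) :
    (c.e (σ • p)).symm (c.rot σ p y) = σ • (c.e p).symm y := by
  rw [← c.target_eq p hp] at hy
  have h1 := (c.e p).map_target hy
  have h2 := c.smul_apply σ p hp _ h1
  rw [(c.e p).right_inv hy] at h2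
  rw [← h2, (c.e (σ • p)).left_inv (c.smul_mem σ p hp _ h1)]

lemma quad_rot (σ : G) {p : M} (hp : p ∈ criticalPoints n f) (y : Euc n) :
    ⟪signL (c.d (σ • p)) (c.rot σ p y), c.rot σ p y⟫ = ⟪signL (c.d p) y, y⟫ := by
  rw [c.rot_sign σ p hp, c.rot_inner σ hp]

open Classical in
/-- The squared distance in the charts to the critical points on the level `a`, truncated away from
them. -/
noncomputable def rho (a : ℝ) (x : M) : ℝ :=
  9 / 16 * R ^ 2 + c.glue (fun p y =>
    if f p = a then min (‖y‖ ^ 2) (9 / 16 * R ^ 2) - 9 / 16 * R ^ 2 else 0) x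

variable {a : ℝ}

lemma rho_apply {p x : M} (hp : p ∈ criticalPointsAt n f a) (hx : x ∈ (c.e p).source) :
    c.rho a x = min (‖c.e p x‖ ^ 2) (9 / 16 * R ^ 2) := by
  rw [rho, c.glue_apply hp.1 hx, if_pos hp.2]
  ring

lemma exists_of_rho_lt {x : M} (hx : c.rho a x < 9 / 16 * R ^ 2) :
    ∃ p ∈ criticalPointsAt n f a, x ∈ (c.e p).source ∧ ‖c.e p x‖ ^ 2 = c.rho a x := by
  by_cases h : ∃ p ∈ criticalPoints n f, x ∈ (c.e p).source
  · obtain ⟨p, hp, hxp⟩ := h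
    by_cases hpa : f p = a
    · refine ⟨p, ⟨hp, hpa⟩, hxp, ?_⟩
      rw [c.rho_apply ⟨hp, hpa⟩ hxp] at hx ⊢
      exact (min_eq_left (le_of_lt (by simpa using hx))).symm
    · rw [rho, c.glue_apply hp hxp, if_neg hpa, add_zero] at hx
      exact absurd hx (lt_irrefl _)
  · rw [rho, c.glue_eq_zero h, add_zero] at hx
    exact absurd hx (lt_irrefl _)

lemma rho_smul (hf : IsEquivariantMorse n G f) (σ : G) (x : M) :
    c.rho a (σ • x) = c.rho a x := by
  rw [rho, rho, c.glue_smul hf]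
  intro σ p hp y _
  rw [hf.invariant, c.rot_norm σ p hp]

lemma continuous_rho [CompactSpace M] [T2Space M] [Fintype G] (hf : IsEquivariantMorse n G f) :
    Continuous (c.rho a) := by
  have hR := c.R_pos
  -- The truncation value `9 / 16 * R ^ 2` is the square of `3 / 4 * R`, so the glued function
  -- vanishes beyond that radius.
  refine continuous_const.add (c.contMDiff_glue hf (m := 0) (by simp) (fun p _ => ?_)
    (R' := 3 / 4 * R) (by linarith) fun p _ y _ hy => ?_).continuous
  · refine contDiffOn_zero.2 (Continuous.continuousOn ?_)
    split_ifs
    · fun_prop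
    · exact continuous_const
  · split_ifs
    · rw [min_eq_right, sub_self]
      nlinarith
    · rfl

lemma rho_symm {p : M} (hp : p ∈ criticalPointsAt n f a) {y : Euc n} (hy : ‖y‖ ≤ 3 / 4 * R) :
    c.rho a ((c.e p).symm y) = ‖y‖ ^ 2 := by
  have hR := c.R_pos
  have hyt : y ∈ (c.e p).target := by
    rw [c.target_eq p hp.1, mem_ball_zero_iff]
    linarith
  rw [c.rho_apply hp ((c.e p).map_target hyt), (c.e p).right_inv hyt, min_eq_left]
  nlinarith [norm_nonneg y]

/-- Expressing the union of balls through `rho` reduces its invariance under a flow to a statement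
about one real function along orbits. -/
lemma iUnion_ball {r : ℝ} (hr0 : 0 < r) (hr : r < 3 / 4 * R) :
    ⋃ p ∈ criticalPointsAt n f a, (c.e p).symm '' Metric.ball 0 r = {x | c.rho a x < r ^ 2} := by
  ext x
  simp only [mem_iUnion, mem_ofPred_eq]
  constructor
  · rintro ⟨p, hp, y, hy, rfl⟩
    rw [mem_ball_zero_iff] at hy
    rw [c.rho_symm hp (by linarith)]
    nlinarith [norm_nonneg y]
  · intro hx
    obtain ⟨p, hp, hxp, h⟩ := c.exists_of_rho_lt (hx.trans (by nlinarith))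
    refine ⟨p, hp, c.e p x, ?_, (c.e p).left_inv hxp⟩
    rw [mem_ball_zero_iff]
    rw [← h] at hx
    exact lt_of_pow_lt_pow_left₀ 2 hr0.le hx

lemma iUnion_closedBall {r : ℝ} (hr0 : 0 < r) (hr : r < 3 / 4 * R) :
    ⋃ p ∈ criticalPointsAt n f a, (c.e p).symm '' Metric.closedBall 0 r =
      {x | c.rho a x ≤ r ^ 2} := by
  ext x
  simp only [mem_iUnion, mem_ofPred_eq]
  constructor
  · rintro ⟨p, hp, y, hy, rfl⟩
    rw [mem_closedBall_zero_iff] at hy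
    rw [c.rho_symm hp (by linarith)]
    nlinarith [norm_nonneg y]
  · intro hx
    obtain ⟨p, hp, hxp, h⟩ := c.exists_of_rho_lt (hx.trans_lt (by nlinarith))
    refine ⟨p, hp, c.e p x, ?_, (c.e p).left_inv hxp⟩
    rw [mem_closedBall_zero_iff]
    rw [← h] at hx
    exact le_of_sq_le_sq hx hr0.le

/-- Below the truncation value `rho` is locally the squared norm in a single chart. -/
lemma hasDerivAt_rho {X : (x : M) → TangentSpace (𝓡 n) x} {Φ : ℝ → M → M} (hΦ : IsFlow X Φ)
    {x : M} {t : ℝ} (hx : c.rho a (Φ t x) < 9 / 16 * R ^ 2) :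
    ∃ p ∈ criticalPointsAt n f a, Φ t x ∈ (c.e p).source ∧
      ‖c.e p (Φ t x)‖ ^ 2 = c.rho a (Φ t x) ∧
      HasDerivAt (fun s => c.rho a (Φ s x))
        (2 * ⟪c.e p (Φ t x), chartField (c.e p) X (c.e p (Φ t x))⟫) t := by
  obtain ⟨p, hp, hxp, h⟩ := c.exists_of_rho_lt hx
  refine ⟨p, hp, hxp, h, ?_⟩
  have h1 := hasDerivAt_chart (c.mem_atlas p hp.1) (hΦ.curve x t) hxp
  refine h1.norm_sq.congr_of_eventuallyEq ?_
  have h2 : ContinuousAt (fun s => Φ s x) t :=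
    (hΦ.continuous.comp (continuous_id.prodMk continuous_const)).continuousAt
  have h3 := h1.continuousAt.norm.pow 2
  filter_upwards [h2 ((c.e p).open_source.mem_nhds hxp),
    h3.eventually_lt_const (h.trans_lt hx)] with s hs hs2
  exact (c.rho_apply hp hs).trans (min_eq_left hs2.le)

end MorseCharts

end Rho

/-! ### Sublevel sets around a critical level -/

section Sublevels

open Set Filter
open scoped RealInnerProductSpace

variable {n : ℕ} {M : Type*} [TopologicalSpace M] [ChartedSpace (Euc n) M]
  [IsManifold (𝓡 n) ∞ M] {f : M → ℝ} {G : Type*} [Group G] [MulAction G M] [SmoothAction n G M]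

/-- A field pointing towards the origin more or less than `-∇f`. -/
lemma fderiv_radial_neg {F : Euc n → ℝ} {d : Fin n → ℝ} (hd : ∀ i, d i ≠ 0)
    {y : Euc n} (hF : ∀ w, |fderiv ℝ F y w - ⟪signL d y, w⟫| ≤ 1 / 8 * ‖y‖ * ‖w‖) {s : ℝ}
    (hs : |s| ≤ 1 / 4) (hy : y ≠ 0) : fderiv ℝ F y (-signL d y + s • y) < 0 := by
  have hy' : 0 < ‖y‖ := norm_pos_iff.2 hy
  have h1 := (abs_le.1 (hF (-signL d y + s • y))).2
  have h2 : ⟪signL d y, -signL d y + s • y⟫ = -‖y‖ ^ 2 + s * ⟪signL d y, y⟫ := by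
    rw [inner_add_right, inner_neg_right, real_inner_self_eq_norm_sq, norm_signL hd,
      inner_smul_right]
  have h3 : |⟪signL d y, y⟫| ≤ ‖y‖ * ‖y‖ := by
    have := abs_real_inner_le_norm (signL d y) y
    rwa [norm_signL hd] at this
  have h4 : s * ⟪signL d y, y⟫ ≤ 1 / 4 * (‖y‖ * ‖y‖) := by
    refine (le_abs_self _).trans ?_
    rw [abs_mul]
    gcongr
  have h5 : ‖-signL d y + s • y‖ ≤ 5 / 4 * ‖y‖ := by
    refine (norm_add_le _ _).trans ?_
    rw [norm_neg, norm_signL hd, norm_smul, Real.norm_eq_abs]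
    nlinarith
  have h6 : 1 / 8 * ‖y‖ * ‖-signL d y + s • y‖ ≤ 1 / 8 * ‖y‖ * (5 / 4 * ‖y‖) := by gcongr
  -- The main part is at most `-3/4 ‖y‖²`, the error at most `1/8 · 5/4 ‖y‖² = 5/32 ‖y‖²`.
  nlinarith [mul_pos hy' hy']

/-- The coefficient of the radial part. -/
noncomputable def radialCoeff (F : Euc n → ℝ) (a : ℝ) (d : Fin n → ℝ) (R : ℝ) (y : Euc n) : ℝ :=
  Real.smoothTransition (16 * ‖y‖ ^ 2 / R ^ 2 - 1) *
    ((⟪signL d y, y⟫ - 2 * (F y - a)) / ‖y‖ ^ 2)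

/-- The numerator is `-2` times the error of the quadratic approximation. The resulting bound `1 /
4` is what `fderiv_radial_neg` tolerates. -/
lemma abs_radialCoeff_le {F : Euc n → ℝ} {a : ℝ} {d : Fin n → ℝ} {R : ℝ} {y : Euc n}
    (h : |F y - a - ⟪signL d y, y⟫ / 2| ≤ 1 / 8 * ‖y‖ ^ 2) :
    |radialCoeff F a d R y| ≤ 1 / 4 := by
  rw [radialCoeff, abs_mul]
  have h1 : |(⟪signL d y, y⟫ - 2 * (F y - a)) / ‖y‖ ^ 2| ≤ 1 / 4 := by
    rw [abs_div, abs_of_nonneg (sq_nonneg ‖y‖)]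
    refine div_le_of_le_mul₀ (sq_nonneg _) (by norm_num) ?_
    rw [abs_le] at h ⊢
    constructor <;> linarith [h.1, h.2]
  have h2 : |Real.smoothTransition (16 * ‖y‖ ^ 2 / R ^ 2 - 1)| ≤ 1 := by
    rw [abs_of_nonneg (Real.smoothTransition.nonneg _)]
    exact Real.smoothTransition.le_one _
  calc _ ≤ 1 * (1 / 4) := mul_le_mul h2 h1 (abs_nonneg _) one_pos.le
    _ = 1 / 4 := one_mul _

/-- The cutoff vanishes for `‖y‖ ≤ R / 4`, which removes the singularity of the quotient at the
origin. -/
lemma contDiffOn_radialCoeff {F : Euc n → ℝ} {a : ℝ} {d : Fin n → ℝ} {R : ℝ}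
    (hF : ContDiffOn ℝ ∞ F (Metric.ball 0 R)) :
    ContDiffOn ℝ ∞ (radialCoeff F a d R) (Metric.ball 0 R) := by
  have hsq : ContDiff ℝ ∞ fun y : Euc n => ‖y‖ ^ 2 := contDiff_norm_sq ℝ
  intro y hy
  by_cases h0 : y = 0
  · subst h0
    refine ((contDiffAt_const (c := (0 : ℝ))).congr_of_eventuallyEq ?_).contDiffWithinAt
    have h1 : ∀ᶠ y : Euc n in 𝓝 0, 16 * ‖y‖ ^ 2 / R ^ 2 - 1 < 0 := by
      refine ContinuousAt.eventually_lt (g := fun _ => (0 : ℝ)) ?_ continuousAt_const (by simp)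
      exact (((hsq.continuous.const_mul 16).div_const _).sub continuous_const).continuousAt
    filter_upwards [h1] with y hy
    rw [radialCoeff, Real.smoothTransition.zero_of_nonpos hy.le, zero_mul]
  · have h1 : ContDiffAt ℝ ∞ F y := hF.contDiffAt (Metric.isOpen_ball.mem_nhds hy)
    refine ContDiffAt.contDiffWithinAt (ContDiffAt.mul ?_ (ContDiffAt.div ?_ hsq.contDiffAt ?_))
    · exact Real.smoothTransition.contDiffAt.comp y
        (((contDiff_const.mul hsq).div_const _).sub contDiff_const).contDiffAt
    · exact (((signL d).contDiff.inner ℝ contDiff_id).contDiffAt).sub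
        (contDiffAt_const.mul (h1.sub contDiffAt_const))
    · exact pow_ne_zero 2 (norm_ne_zero_iff.2 h0)

/-- Morse charts of radius `R`, with an equivariant flow which is transverse to the spheres of
radius `R / 2` except at the critical level. -/
theorem exists_flow_transverse [CompactSpace M] [T2Space M] [Fintype G]
    (hf : IsEquivariantMorse n G f) {U : M → Set M} (hU : ∀ p ∈ criticalPoints n f, U p ∈ 𝓝 p) :
    ∃ (R : ℝ) (c : MorseCharts G f (averagedForm (n := n) G) (1 / 8) R)
      (X : (x : M) → TangentSpace (𝓡 n) x) (Φ : ℝ → M → M),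
      (∀ p ∈ criticalPoints n f, (c.e p).source ⊆ U p) ∧ SmoothField X ∧
      (∀ (σ : G) x, dact σ x (X x) = X (σ • x)) ∧ IsFlow X Φ ∧
      (∀ x ∉ criticalPoints n f, dfun f x (X x) < 0) ∧
      ∀ p ∈ criticalPoints n f, ∀ y, R ^ 2 / 8 < ‖y‖ ^ 2 → ‖y‖ ^ 2 < 3 / 8 * R ^ 2 →
        2 * ⟪y, chartField (c.e p) X y⟫ = -(4 * (f ((c.e p).symm y) - f p)) := by
  obtain ⟨R, -, c, hcU⟩ := exists_morseCharts hf
    (invariantForm_averagedForm (n := n) (M := M) (G := G)) (ε := 1 / 8) (by norm_num) hU one_pos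
  have hR := c.R_pos
  -- For `‖y‖² ≥ R² / 8` the cutoff is one and `s ‖y‖² = ⟪signL y, y⟫ - 2 (f - f p)`. The radial
  -- component of the field `-signL y + s y` is then determined by `f - f p` alone.
  let s : M → Euc n → ℝ := fun p => radialCoeff (fun y => f ((c.e p).symm y)) (f p) (c.d p) R
  have hs : ∀ p ∈ criticalPoints n f, ∀ y ∈ Metric.ball (0 : Euc n) R, |s p y| ≤ 1 / 4 :=
    fun p hp y hy => abs_radialCoeff_le (c.approx_value p hp y hy)
  obtain ⟨X, hX, hXG, hXW, hXf⟩ := exists_gradientLike hf c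
    (W := fun p y => -signL (c.d p) y + s p y • y) (R' := 3 / 4 * R)
    (fun p hp => by
      refine (signL (c.d p)).contDiff.contDiffOn.neg.add (ContDiffOn.smul (f := s p) (g := fun y => y) ?_ contDiffOn_id)
      refine contDiffOn_radialCoeff ?_
      rw [← c.target_eq p hp]
      exact contDiffOn_comp_chart_symm hf.smooth (c.mem_atlas p hp))
    (fun σ p hp y hy => by
      have h1 : s (σ • p) (c.rot σ p y) = s p y := by
        simp only [s, radialCoeff]
        rw [c.rot_norm σ p hp, c.quad_rot σ hp, c.symm_rot σ hp hy, hf.invariant, hf.invariant]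
      rw [h1, c.rot_sign σ p hp, map_add, map_neg, map_smul])
    (fun p hp y hy hy0 => fderiv_radial_neg (c.d_ne p hp) (c.approx_deriv p hp y hy)
      (hs p hp y hy) hy0) (by linarith)
  obtain ⟨Φ, hΦ⟩ := exists_isFlow hX
  refine ⟨R, c, X, Φ, hcU, hX, hXG, hΦ, hXf, fun p hp y hy1 hy2 => ?_⟩
  have hy3 : ‖y‖ ≤ 3 / 4 * R := by
    refine le_of_sq_le_sq ?_ (by linarith)
    nlinarith [sq_nonneg R]
  have hy0 : ‖y‖ ^ 2 ≠ 0 := by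
    have := sq_nonneg R
    linarith
  rw [hXW p hp y hy3, inner_add_right, inner_neg_right, inner_smul_right,
    real_inner_self_eq_norm_sq]
  simp only [s, radialCoeff]
  rw [Real.smoothTransition.one_of_one_le, one_mul, div_mul_cancel₀ _ hy0,
    real_inner_comm y]
  · ring
  · rw [le_sub_iff_add_le, le_div_iff₀ (by positivity)]
    linarith

lemma inclusionIsEquivariantHomotopyEquiv_of_flow {Z Y : Set M} (hZG : ∀ (σ : G), ∀ x ∈ Z, σ • x ∈ Z)
    (hYG : ∀ (σ : G), ∀ x ∈ Y, σ • x ∈ Y) (h : Z ⊆ Y) {Φ : ℝ → M → M}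
    (hΦ : Continuous fun p : ℝ × M => Φ p.1 p.2) (h0 : ∀ x, Φ 0 x = x)
    (hG : ∀ t (σ : G) x, Φ t (σ • x) = σ • Φ t x)
    (hZ : ∀ t, 0 ≤ t → ∀ x ∈ Z, Φ t x ∈ Z) (hY : ∀ t, 0 ≤ t → ∀ x ∈ Y, Φ t x ∈ Y)
    (hYZ : ∃ T, 0 ≤ T ∧ ∀ x ∈ Y, Φ T x ∈ Z) : InclusionIsEquivariantHomotopyEquiv G Z Y := by
  obtain ⟨T, hT, hYZ⟩ := hYZ
  exact ⟨⟨Z, fun σ x hx => hZG σ x hx⟩, ⟨Y, fun σ x hx => hYG σ x hx⟩, h, rfl, rfl,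
    inclusionMap_isEquivariantHomotopyEquiv h hΦ h0 hG hT hZ hY hYZ⟩

variable [CompactSpace M] [T2Space M] [Fintype G]

lemma dfun_nonpos {X : (x : M) → TangentSpace (𝓡 n) x}
    (h : ∀ x ∉ criticalPoints n f, dfun f x (X x) < 0) (x : M) : dfun f x (X x) ≤ 0 := by
  by_cases hx : x ∈ criticalPoints n f
  · have h1 : dfun (n := n) f x = 0 := hx
    rw [h1]
    rfl
  · exact (h x hx).le

theorem sublevel_inclusion_of_regular (hf : IsEquivariantMorse n G f) {a b : ℝ} (hab : a < b)
    (hreg : criticalValues n f ∩ Icc a b = ∅) :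
    InclusionIsEquivariantHomotopyEquiv G {x | f x ≤ a} {x | f x ≤ b} := by
  obtain ⟨R, c, X, Φ, -, hX, hXG, hΦ, hXf, -⟩ := exists_flow_transverse hf (U := fun _ => univ)
    fun _ _ => univ_mem
  have hanti := hΦ.antitone_comp hf.smooth (dfun_nonpos hXf)
  have hinv : ∀ a t, 0 ≤ t → ∀ x ∈ {x | f x ≤ a}, Φ t x ∈ {x | f x ≤ a} := fun a t ht x hx => by
    have h1 := hanti x ht
    simp only [hΦ.zero] at h1
    exact h1.trans hx
  refine inclusionIsEquivariantHomotopyEquiv_of_flow (fun σ x hx => (hf.invariant σ x).trans_le hx)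
    (fun σ x hx => (hf.invariant σ x).trans_le hx) (fun x hx => le_trans hx hab.le)
    hΦ.continuous hΦ.zero (hΦ.smul hX hXG) (hinv a) (hinv b) ?_
  refine exists_time_of_deriv_neg hΦ.add hΦ.zero hf.smooth.continuous
    (continuous_dfun_field hf.smooth hX) (hΦ.hasDerivAt_comp hf.smooth) (hinv b) (hinv a)
    (K := f ⁻¹' Icc a b) (isClosed_Icc.preimage hf.smooth.continuous) (fun x hx => ?_)
    fun x hx => hXf x fun hxC => ?_
  · by_cases h : f x ≤ a
    · exact Or.inl h
    · exact Or.inr ⟨(not_le.1 h).le, hx⟩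
  · have h1 : f x ∈ criticalValues n f ∩ Icc a b := ⟨⟨x, hxC, rfl⟩, hx⟩
    rwa [hreg] at h1

namespace MorseCharts

omit [CompactSpace M] [T2Space M] [Fintype G] in
lemma smul_image_ball {B : M → Euc n →L[ℝ] Euc n →L[ℝ] ℝ} {ε R : ℝ} (c : MorseCharts G f B ε R)
    (hf : IsEquivariantMorse n G f) {S : Set (Euc n)} (hSR : S ⊆ Metric.ball 0 R)
    (hS : ∀ y z : Euc n, ‖y‖ = ‖z‖ → y ∈ S → z ∈ S) (σ : G) {p : M}
    (hp : p ∈ criticalPoints n f) :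
    (fun x => σ • x) '' ((c.e p).symm '' S) = (c.e (σ • p)).symm '' S := by
  have hsub : ∀ (τ : G) {q}, q ∈ criticalPoints n f →
      (fun x => τ • x) '' ((c.e q).symm '' S) ⊆ (c.e (τ • q)).symm '' S := by
    rintro τ q hq _ ⟨_, ⟨y, hy, rfl⟩, rfl⟩
    exact ⟨c.rot τ q y, hS y _ (c.rot_norm τ q hq y).symm hy, c.symm_rot τ hq (hSR hy)⟩
  refine (hsub σ hp).antisymm fun x hx => ⟨σ⁻¹ • x, ?_, smul_inv_smul σ x⟩
  have h1 := hsub σ⁻¹ (smul_mem_criticalPoints hf σ hp) ⟨x, hx, rfl⟩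
  rwa [inv_smul_smul] at h1

end MorseCharts

/-- Below level `c` the squared radius does not decrease in the shell around radius `R / 2`, so no
orbit enters the removed balls. These contain all critical points of `f⁻¹[a, c]`, so `f` decreases
at a uniform rate on the rest. -/
theorem sublevel_inclusion_below (hf : IsEquivariantMorse n G f) {a c : ℝ} (hac : a < c)
    (hcrit : criticalValues n f ∩ Icc a c = {c}) {U : M → Set M}
    (hU : ∀ p ∈ criticalPointsAt n f c, U p ∈ 𝓝 p) :
    ∃ B : M → Set M,
      (∀ p ∈ criticalPointsAt n f c, IsOpenCoordinateBall n p (B p) ∧ B p ⊆ U p) ∧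
      (∀ σ : G, ∀ p ∈ criticalPointsAt n f c, (fun x => σ • x) '' B p = B (σ • p)) ∧
      InclusionIsEquivariantHomotopyEquiv G {x | f x ≤ a}
        ({x | f x ≤ c} \ ⋃ p ∈ criticalPointsAt n f c, B p) := by
  classical
  -- The charts at level `c` are kept inside `{a < f}`, so the removed balls miss the lower sublevel
  -- set.
  obtain ⟨R, C, X, Φ, hCU, hX, hXG, hΦ, hXf, hsph⟩ := exists_flow_transverse hf
    (U := fun p => if f p = c then U p ∩ {x | a < f x} else univ) fun p hp => by
      split_ifs with hpc
      · exact inter_mem (hU p ⟨hp, hpc⟩) ((isOpen_lt continuous_const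
          hf.smooth.continuous).mem_nhds (by simpa [hpc] using hac))
      · exact univ_mem
  have hR := C.R_pos
  have hsub : Metric.closedBall (0 : Euc n) (R / 2) ⊆ Metric.ball 0 R :=
    Metric.closedBall_subset_ball (by linarith)
  have hBU : ∀ p ∈ criticalPointsAt n f c,
      (C.e p).symm '' Metric.ball 0 (R / 2) ⊆ U p ∩ {x | a < f x} := by
    rintro p hp _ ⟨y, hy, rfl⟩
    have h1 := hCU p hp.1 ((C.e p).map_target
      (C.target_eq p hp.1 ▸ hsub (Metric.ball_subset_closedBall hy)))
    rwa [if_pos hp.2] at h1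
  refine ⟨fun p => (C.e p).symm '' Metric.ball 0 (R / 2), fun p hp => ⟨⟨C.e p, C.mem_atlas p hp.1,
    C.mem_source p hp.1, R / 2, by positivity, ?_, ?_⟩, fun x hx => (hBU p hp hx).1⟩, ?_, ?_⟩
  · rw [C.apply_self p hp.1, C.target_eq p hp.1]
    exact hsub
  · rw [C.apply_self p hp.1]
  · intro σ p hp
    exact C.smul_image_ball hf (Metric.ball_subset_closedBall.trans hsub)
      (fun y z hyz hy => by
        rw [mem_ball_zero_iff] at hy ⊢
        rwa [← hyz]) σ hp.1
  rw [C.iUnion_ball (by positivity) (by linarith)]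
  have hanti := hΦ.antitone_comp hf.smooth (dfun_nonpos hXf)
  have hinv : ∀ a t, 0 ≤ t → ∀ x ∈ {x | f x ≤ a}, Φ t x ∈ {x | f x ≤ a} := fun a t ht x hx => by
    have h1 := hanti x ht
    simp only [hΦ.zero] at h1
    exact h1.trans hx
  have hρ := C.continuous_rho hf (a := c)
  have hY : ∀ t, 0 ≤ t → ∀ x ∈ {x | f x ≤ c} \ {x | C.rho c x < (R / 2) ^ 2},
      Φ t x ∈ {x | f x ≤ c} \ {x | C.rho c x < (R / 2) ^ 2} := by
    rintro t ht x ⟨hxc, hx⟩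
    refine ⟨hinv c t ht x hxc, (not_lt.2 ?_ : ¬C.rho c (Φ t x) < (R / 2) ^ 2)⟩
    -- The width `α = R² / 8` around `R² / 4` gives the interval from `R² / 8` to `3 R² / 8` in
    -- which the radial formula holds.
    refine le_of_deriv_nonneg_near (u := fun s => C.rho c (Φ s x))
      (u' := fun s => -(4 * (f (Φ s x) - c))) (r := (R / 2) ^ 2) (α := R ^ 2 / 8)
      (by positivity) (hρ.comp (hΦ.continuous.comp (continuous_id.prodMk continuous_const)))
      (fun s hs hnear => ?_) (by simpa [hΦ.zero] using hx) ht
    rw [abs_lt] at hnear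
    obtain ⟨p, hp, hxp, hpρ, hd⟩ := C.hasDerivAt_rho hΦ (a := c) (x := x) (t := s)
      (by nlinarith [sq_nonneg R])
    have h1 := hsph p hp.1 (C.e p (Φ s x)) (by rw [hpρ]; linarith [hnear.1])
      (by rw [hpρ]; linarith [hnear.2])
    rw [(C.e p).left_inv hxp, hp.2] at h1
    rw [h1] at hd
    have h2 : f (Φ s x) ≤ c := hinv c s hs.1 x hxc
    exact ⟨hd, by linarith⟩
  refine inclusionIsEquivariantHomotopyEquiv_of_flow (fun σ x hx => (hf.invariant σ x).trans_le hx)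
    (fun σ x hx => ⟨(hf.invariant σ x).trans_le hx.1, ?_⟩) (fun x hx => ⟨le_trans hx hac.le, ?_⟩)
    hΦ.continuous hΦ.zero (hΦ.smul hX hXG) (hinv a) hY ?_
  · have h1 := hx.2
    simp only [mem_ofPred_eq] at h1 ⊢
    rwa [C.rho_smul hf]
  · intro h1
    rw [← C.iUnion_ball (by positivity) (by linarith)] at h1
    obtain ⟨p, hp, hxp⟩ := mem_iUnion₂.1 h1
    exact absurd (show f x ≤ a from hx) (not_le.2 (hBU p hp hxp).2)
  refine exists_time_of_deriv_neg hΦ.add hΦ.zero hf.smooth.continuous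
    (continuous_dfun_field hf.smooth hX) (hΦ.hasDerivAt_comp hf.smooth) hY (hinv a)
    (K := f ⁻¹' Icc a c ∩ C.rho c ⁻¹' Ici ((R / 2) ^ 2))
    ((isClosed_Icc.preimage hf.smooth.continuous).inter (isClosed_Ici.preimage hρ))
    (fun x hx => ?_) fun x hx => hXf x fun hxC => ?_
  · by_cases h : f x ≤ a
    · exact Or.inl h
    · exact Or.inr ⟨⟨(not_le.1 h).le, hx.1⟩, not_lt.1 (show ¬C.rho c x < (R / 2) ^ 2 from hx.2)⟩
  · have h1 : f x ∈ criticalValues n f ∩ Icc a c := ⟨⟨x, hxC, rfl⟩, hx.1⟩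
    rw [hcrit] at h1
    have h2 : C.rho c x = 0 := by
      have h3 := C.rho_symm (p := x) ⟨hxC, h1⟩ (y := 0) (by simp; positivity)
      rwa [C.symm_zero hxC, norm_zero, zero_pow two_ne_zero] at h3
    have h3 : (R / 2) ^ 2 ≤ C.rho c x := hx.2
    rw [h2] at h3
    nlinarith

/-- The mirror image of `sublevel_inclusion_below`: above level `c` the squared radius decreases in
the shell, so an orbit can leave a ball only after it has reached `{f ≤ c}`. -/
theorem sublevel_inclusion_above (hf : IsEquivariantMorse n G f) {c b : ℝ} (hcb : c < b)
    (hcrit : criticalValues n f ∩ Icc c b = {c}) {U : M → Set M}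
    (hU : ∀ p ∈ criticalPointsAt n f c, U p ∈ 𝓝 p) :
    ∃ B : M → Set M,
      (∀ p ∈ criticalPointsAt n f c, IsClosedCoordinateBall n p (B p) ∧ B p ⊆ U p) ∧
      (∀ σ : G, ∀ p ∈ criticalPointsAt n f c, (fun x => σ • x) '' B p = B (σ • p)) ∧
      InclusionIsEquivariantHomotopyEquiv G
        ({x | f x ≤ c} ∪ ⋃ p ∈ criticalPointsAt n f c, B p) {x | f x ≤ b} := by
  classical
  obtain ⟨R, C, X, Φ, hCU, hX, hXG, hΦ, hXf, hsph⟩ := exists_flow_transverse hf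
    (U := fun p => if f p = c then U p ∩ {x | f x < b} else univ) fun p hp => by
      split_ifs with hpc
      · exact inter_mem (hU p ⟨hp, hpc⟩) ((isOpen_lt hf.smooth.continuous
          continuous_const).mem_nhds (by simpa [hpc] using hcb))
      · exact univ_mem
  have hR := C.R_pos
  have hsub : Metric.closedBall (0 : Euc n) (R / 2) ⊆ Metric.ball 0 R :=
    Metric.closedBall_subset_ball (by linarith)
  have hBU : ∀ p ∈ criticalPointsAt n f c,
      (C.e p).symm '' Metric.closedBall 0 (R / 2) ⊆ U p ∩ {x | f x < b} := by
    rintro p hp _ ⟨y, hy, rfl⟩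
    have h1 := hCU p hp.1 ((C.e p).map_target (C.target_eq p hp.1 ▸ hsub hy))
    rwa [if_pos hp.2] at h1
  refine ⟨fun p => (C.e p).symm '' Metric.closedBall 0 (R / 2), fun p hp => ⟨⟨C.e p,
    C.mem_atlas p hp.1, C.mem_source p hp.1, R / 2, by positivity, ?_, ?_⟩,
    fun x hx => (hBU p hp hx).1⟩, ?_, ?_⟩
  · rw [C.apply_self p hp.1, C.target_eq p hp.1]
    exact hsub
  · rw [C.apply_self p hp.1]
  · intro σ p hp
    exact C.smul_image_ball hf hsub
      (fun y z hyz hy => by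
        rw [mem_closedBall_zero_iff] at hy ⊢
        rwa [← hyz]) σ hp.1
  have hun := C.iUnion_closedBall (a := c) (r := R / 2) (by positivity) (by linarith)
  rw [hun]
  have hanti := hΦ.antitone_comp hf.smooth (dfun_nonpos hXf)
  have hinv : ∀ a t, 0 ≤ t → ∀ x ∈ {x | f x ≤ a}, Φ t x ∈ {x | f x ≤ a} := fun a t ht x hx => by
    have h1 := hanti x ht
    simp only [hΦ.zero] at h1
    exact h1.trans hx
  have hρ := C.continuous_rho hf (a := c)
  have hZ : ∀ t, 0 ≤ t → ∀ x ∈ {x | f x ≤ c} ∪ {x | C.rho c x ≤ (R / 2) ^ 2},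
      Φ t x ∈ {x | f x ≤ c} ∪ {x | C.rho c x ≤ (R / 2) ^ 2} := by
    rintro t ht x (hx | hx)
    · exact Or.inl (hinv c t ht x hx)
    -- If the level `c` has not been reached by time `t`, then `f > c` along the whole orbit up to
    -- `t`, and `rho` cannot cross `(R / 2) ^ 2` upwards.
    by_cases hxc : f (Φ t x) ≤ c
    · exact Or.inl hxc
    refine Or.inr (neg_le_neg_iff.1 ?_ : C.rho c (Φ t x) ≤ (R / 2) ^ 2)
    refine le_of_deriv_nonneg_near (u := fun s => -C.rho c (Φ s x))
      (u' := fun s => -(-(4 * (f (Φ s x) - c)))) (r := -(R / 2) ^ 2) (α := R ^ 2 / 8)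
      (by positivity) (hρ.comp (hΦ.continuous.comp (continuous_id.prodMk continuous_const))).neg
      (fun s hs hnear => ?_) (by simpa [hΦ.zero] using hx) ht
    rw [abs_lt] at hnear
    obtain ⟨p, hp, hxp, hpρ, hd⟩ := C.hasDerivAt_rho hΦ (a := c) (x := x) (t := s)
      (by nlinarith [sq_nonneg R])
    have h1 := hsph p hp.1 (C.e p (Φ s x)) (by rw [hpρ]; linarith [hnear.2])
      (by rw [hpρ]; linarith [hnear.1])
    rw [(C.e p).left_inv hxp, hp.2] at h1
    rw [h1] at hd
    have h2 := hanti x hs.2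
    simp only at h2
    exact ⟨hd.neg, by linarith [not_le.1 hxc]⟩
  refine inclusionIsEquivariantHomotopyEquiv_of_flow ?_
    (fun σ x hx => (hf.invariant σ x).trans_le hx) ?_
    hΦ.continuous hΦ.zero (hΦ.smul hX hXG) hZ (hinv b) ?_
  · rintro σ x (hx | hx)
    · exact Or.inl ((hf.invariant σ x).trans_le hx)
    · exact Or.inr ((C.rho_smul hf σ x).trans_le hx)
  · rintro x (hx | hx)
    · exact le_trans hx hcb.le
    · rw [← hun] at hx
      obtain ⟨p, hp, hxp⟩ := mem_iUnion₂.1 hx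
      exact le_of_lt (a := f x) (hBU p hp hxp).2
  refine exists_time_of_deriv_neg hΦ.add hΦ.zero hf.smooth.continuous
    (continuous_dfun_field hf.smooth hX) (hΦ.hasDerivAt_comp hf.smooth) (hinv b) hZ
    (K := f ⁻¹' Icc c b ∩ C.rho c ⁻¹' Ici ((R / 2) ^ 2))
    ((isClosed_Icc.preimage hf.smooth.continuous).inter (isClosed_Ici.preimage hρ))
    (fun x hx => ?_) fun x hx => hXf x fun hxC => ?_
  · by_cases h : f x ≤ c
    · exact Or.inl (Or.inl h)
    by_cases h2 : C.rho c x ≤ (R / 2) ^ 2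
    · exact Or.inl (Or.inr h2)
    · exact Or.inr ⟨⟨(not_le.1 h).le, hx⟩, (not_le.1 h2).le⟩
  · have h1 : f x ∈ criticalValues n f ∩ Icc c b := ⟨⟨x, hxC, rfl⟩, hx.1⟩
    rw [hcrit] at h1
    have h2 : C.rho c x = 0 := by
      have h3 := C.rho_symm (p := x) ⟨hxC, h1⟩ (y := 0) (by simp; positivity)
      rwa [C.symm_zero hxC, norm_zero, zero_pow two_ne_zero] at h3
    have h3 : (R / 2) ^ 2 ≤ C.rho c x := hx.2
    rw [h2] at h3
    nlinarith

end Sublevels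

end EquivariantMorse

namespace EquivariantMorse

/-! ### A function with the same sublevel sets which is quadratic near the critical points -/

section LevelModel

open Set Filter
open scoped RealInnerProductSpace

variable {n : ℕ} {M : Type*} [TopologicalSpace M] [ChartedSpace (Euc n) M]
  [IsManifold (𝓡 n) ∞ M]

/-- A function `h` with the sublevel sets of `f` at `a` and `b` which is a standard quadratic
function near the critical points at the level `c₀`, with a linear gradient-like field there. -/
structure LevelModel (G : Type*) [Group G] [MulAction G M] (f : M → ℝ)
    (B : M → Euc n →L[ℝ] Euc n →L[ℝ] ℝ) (a b c₀ : ℝ) where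
  ε : ℝ
  R : ℝ
  charts : MorseCharts G f B ε R
  X : (x : M) → TangentSpace (𝓡 n) x
  Φ : ℝ → M → M
  h : M → ℝ
  smooth_field : SmoothField X
  smooth : ContMDiff (𝓡 n) 𝓘(ℝ, ℝ) ∞ h
  flow : IsFlow X Φ
  flow_smul : ∀ t (σ : G) x, Φ t (σ • x) = σ • Φ t x
  invariant : ∀ (σ : G) x, h (σ • x) = h x
  R_lt_left : R ^ 2 / 2 < c₀ - a
  R_lt_right : R ^ 2 / 2 < b - c₀
  eq_or : ∀ x, h x = f x ∨ (a < f x ∧ f x < b ∧ a < h x ∧ h x < b)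
  neg : ∀ x ∉ criticalPoints n f, dfun h x (X x) < 0
  quad : ∀ p ∈ criticalPointsAt n f c₀, ∀ x ∈ (charts.e p).source, ‖charts.e p x‖ ^ 2 ≤ R ^ 2 / 4 →
    h x = c₀ + ⟪signL (charts.d p) (charts.e p x), charts.e p x⟫ / 2
  field_eq : ∀ p ∈ criticalPoints n f, ∀ y, ‖y‖ ≤ 3 / 4 * R →
    chartField (charts.e p) X y = -signL (charts.d p) y

/-- The cutoff function which is one on `(-∞, 1]` and zero on `[2, ∞)`. -/
noncomputable def cutoff (t : ℝ) : ℝ := Real.smoothTransition (2 - t)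

lemma contDiff_cutoff : ContDiff ℝ ∞ cutoff :=
  Real.smoothTransition.contDiff.comp (contDiff_const.sub contDiff_id)

lemma cutoff_nonneg (t : ℝ) : 0 ≤ cutoff t := Real.smoothTransition.nonneg _

lemma cutoff_le_one (t : ℝ) : cutoff t ≤ 1 := Real.smoothTransition.le_one _

lemma cutoff_of_le_one {t : ℝ} (ht : t ≤ 1) : cutoff t = 1 :=
  Real.smoothTransition.one_of_one_le (by linarith)

lemma cutoff_of_two_le {t : ℝ} (ht : 2 ≤ t) : cutoff t = 0 :=
  Real.smoothTransition.zero_of_nonpos (by linarith)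

lemma exists_deriv_cutoff_bound : ∃ K, 0 ≤ K ∧ ∀ t ∈ Icc (0 : ℝ) 4, |deriv cutoff t| ≤ K := by
  obtain ⟨K, hK⟩ := (isCompact_Icc (a := (0 : ℝ)) (b := 4)).exists_bound_of_continuousOn
    (contDiff_cutoff.continuous_deriv (by simp)).continuousOn
  exact ⟨|K|, abs_nonneg K, fun t ht => (hK t ht).trans (le_abs_self K)⟩

lemma abs_inner_signL_le {d : Fin n → ℝ} (hd : ∀ i, d i ≠ 0) (y : Euc n) :
    |⟪signL d y, y⟫| ≤ ‖y‖ ^ 2 := by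
  have := abs_real_inner_le_norm (signL d y) y
  rwa [norm_signL hd, ← pow_two] at this

/-- Interpolation between a Morse function and its quadratic part keeps the decrease along the
gradient field of the quadratic part. -/
lemma fderiv_interpolation_neg {F : Euc n → ℝ} {d : Fin n → ℝ} (hd : ∀ i, d i ≠ 0) {ε R c₀ K : ℝ}
    (hR : 0 < R) (hε : 0 ≤ ε) (hK0 : 0 ≤ K) (hK : ∀ t ∈ Icc (0 : ℝ) 4, |deriv cutoff t| ≤ K)
    (hεK : ε * (1 + 8 * K) < 1) {y : Euc n} (hy : y ∈ Metric.ball (0 : Euc n) R) (hy0 : y ≠ 0)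
    (hFd : DifferentiableAt ℝ F y) (hF : |F y - c₀ - ⟪signL d y, y⟫ / 2| ≤ ε * ‖y‖ ^ 2)
    (hF' : ∀ w, |fderiv ℝ F y w - ⟪signL d y, w⟫| ≤ ε * ‖y‖ * ‖w‖) :
    fderiv ℝ (fun y => F y + cutoff (4 * ‖y‖ ^ 2 / R ^ 2) *
      (c₀ + ⟪signL d y, y⟫ / 2 - F y)) y (-signL d y) < 0 := by
  rw [mem_ball_zero_iff] at hy
  have hy' : 0 < ‖y‖ := norm_pos_iff.2 hy0
  set w := -signL d y with hw
  set Q : Euc n → ℝ := fun y => c₀ + ⟪signL d y, y⟫ / 2 - F y with hQ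
  set t := 4 * ‖y‖ ^ 2 / R ^ 2 with ht
  have hin : ⟪signL d y, w⟫ = -‖y‖ ^ 2 := by
    rw [hw, inner_neg_right, real_inner_self_eq_norm_sq, norm_signL hd]
  have hwn : ‖w‖ = ‖y‖ := by rw [hw, norm_neg, norm_signL hd]
  -- derivatives along the line in the direction `w`
  have hline : HasDerivAt (fun s : ℝ => y + s • w) w 0 := by
    simpa using ((hasDerivAt_id (0 : ℝ)).smul_const w).const_add y
  have hy0' : y + (0 : ℝ) • w = y := by simp
  have hF1 : HasDerivAt (fun s : ℝ => F (y + s • w)) (fderiv ℝ F y w) 0 :=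
    (hFd.hasFDerivAt.congr_fderiv rfl : HasFDerivAt F (fderiv ℝ F y) y).comp_hasDerivAt_of_eq 0
      hline hy0'.symm
  have hJ1 : HasDerivAt (fun s : ℝ => signL d (y + s • w)) (signL d w) 0 :=
    (signL d).hasFDerivAt.comp_hasDerivAt 0 hline
  have hQ1 : HasDerivAt (fun s : ℝ => Q (y + s • w)) (-‖y‖ ^ 2 - fderiv ℝ F y w) 0 := by
    have h1 := (((hJ1.inner ℝ hline).div_const 2).const_add c₀).sub hF1
    rw [hy0'] at h1
    refine h1.congr_deriv ?_
    rw [inner_diagL_comm _ w y, real_inner_comm (signL d y) w, hin]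
    ring
  have hψ1 : HasDerivAt (fun s : ℝ => cutoff (4 * ‖y + s • w‖ ^ 2 / R ^ 2))
      (deriv cutoff t * (4 * (2 * ⟪y, w⟫) / R ^ 2)) 0 := by
    have h1 := (hline.norm_sq.const_mul 4).div_const (R ^ 2)
    rw [hy0'] at h1
    exact ((contDiff_cutoff.differentiable (by simp)) t).hasDerivAt.comp_of_eq 0 h1 (by rw [hy0'])
  have hH := hF1.add (hψ1.mul hQ1)
  rw [hy0'] at hH
  have hdiff : DifferentiableAt ℝ (fun y => F y + cutoff (4 * ‖y‖ ^ 2 / R ^ 2) * Q y) y := by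
    have h1 : ContDiff ℝ ∞ fun y : Euc n => cutoff (4 * ‖y‖ ^ 2 / R ^ 2) :=
      contDiff_cutoff.comp ((contDiff_const.mul (contDiff_norm_sq ℝ)).div_const _)
    have h2 : DifferentiableAt ℝ (fun y => ⟪signL d y, y⟫) y :=
      ((signL d).differentiableAt).inner ℝ differentiableAt_id
    have h2' : DifferentiableAt ℝ (fun y => ⟪signL d y, y⟫ / 2) y := by
      simpa only [div_eq_mul_inv] using h2.mul_const (2⁻¹ : ℝ)
    exact hFd.add ((h1.differentiable (by simp) y).mul ((DifferentiableAt.const_add c₀ h2').sub hFd))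
  have heq : fderiv ℝ (fun y => F y + cutoff (4 * ‖y‖ ^ 2 / R ^ 2) * Q y) y w = _ :=
    (hdiff.hasFDerivAt.comp_hasDerivAt_of_eq 0 hline hy0'.symm).unique hH
  rw [heq]
  have hψ0 := cutoff_nonneg t
  have hψ2 := cutoff_le_one t
  have hsq : ‖y‖ ^ 2 ≤ R ^ 2 := by nlinarith
  have htI : t ∈ Icc (0 : ℝ) 4 := by
    refine ⟨by positivity, ?_⟩
    rw [ht, div_le_iff₀ (by positivity)]
    linarith
  have hDF : fderiv ℝ F y w ≤ -(1 - ε) * ‖y‖ ^ 2 := by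
    have h1 := (abs_le.1 (hF' w)).2
    rw [hin, hwn] at h1
    nlinarith
  have hQy : |Q y| ≤ ε * ‖y‖ ^ 2 := by
    rw [← abs_neg]
    refine le_trans (le_of_eq ?_) hF
    congr 1
    simp only [hQ]
    ring
  have hyw : |⟪y, w⟫| ≤ ‖y‖ ^ 2 := by
    rw [hw, inner_neg_right, abs_neg, real_inner_comm]
    exact abs_inner_signL_le hd y
  have hDψ : |deriv cutoff t * (4 * (2 * ⟪y, w⟫) / R ^ 2)| ≤ 8 * K := by
    rw [abs_mul, abs_div, abs_mul, abs_mul, abs_of_pos (by positivity : (0 : ℝ) < R ^ 2),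
      abs_of_pos (by norm_num : (0 : ℝ) < 4), abs_of_pos (by norm_num : (0 : ℝ) < 2)]
    have h1 : 4 * (2 * |⟪y, w⟫|) / R ^ 2 ≤ 8 := by
      rw [div_le_iff₀ (by positivity)]
      linarith
    calc _ ≤ K * 8 := mul_le_mul (hK t htI) h1 (by positivity) hK0
      _ = 8 * K := mul_comm _ _
  have hprod : deriv cutoff t * (4 * (2 * ⟪y, w⟫) / R ^ 2) * Q y ≤ 8 * K * (ε * ‖y‖ ^ 2) := by
    refine (le_abs_self _).trans ?_
    rw [abs_mul]
    exact mul_le_mul hDψ hQy (abs_nonneg _) (by positivity)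
  have h2 : 0 < ‖y‖ ^ 2 := by positivity
  -- With `ψ` the cutoff, the derivative is `(1 - ψ) DF w - ψ ‖y‖² + (Dψ w) Q`, at most `-(1 - ε)
  -- ‖y‖² + 8 K ε ‖y‖²`. This is negative as `ε (1 + 8 K) < 1`.
  have h3 : (1 - cutoff t) * fderiv ℝ F y w ≤ (1 - cutoff t) * (-(1 - ε) * ‖y‖ ^ 2) :=
    mul_le_mul_of_nonneg_left hDF (by linarith)
  have h4 : 0 ≤ cutoff t * (ε * ‖y‖ ^ 2) := by positivity
  nlinarith [mul_pos (sub_pos.2 hεK) h2]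

variable {f : M → ℝ} {G : Type*} [Group G] [MulAction G M] [SmoothAction n G M]
  [CompactSpace M] [T2Space M] [Fintype G]

/-- In the charts at level `c₀`, `f` is interpolated with its quadratic part. The field is linear
near every critical point, and both `f` and `h` decrease along it since the approximation is fine
compared with the slope of the cutoff. At other critical levels `f` is not changed. -/
theorem exists_levelModel (hf : IsEquivariantMorse n G f) {B : M → Euc n →L[ℝ] Euc n →L[ℝ] ℝ}
    (hB : InvariantForm G B) {a b c₀ : ℝ} (hac : a < c₀) (hcb : c₀ < b) :
    Nonempty (LevelModel G f B a b c₀) := by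
  classical
  obtain ⟨K, hK0, hK⟩ := exists_deriv_cutoff_bound
  -- Makes `ε * (1 + 8 * K)` equal to `1 / 2`.
  set ε : ℝ := 1 / (2 * (1 + 8 * K)) with hεdef
  have hε : 0 < ε := by positivity
  have hεK : ε * (1 + 8 * K) < 1 := by
    rw [hεdef]
    field_simp
    norm_num
  have hR₀ : 0 < min 1 (min (c₀ - a) (b - c₀)) :=
    lt_min one_pos (lt_min (sub_pos.2 hac) (sub_pos.2 hcb))
  -- On these charts both `f` and the quadratic function, which differs from `c₀` by at most `R² /
  -- 2`, stay strictly between `a` and `b`. So does the interpolation, and the sublevel sets at `a`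
  -- and `b` do not change.
  obtain ⟨R, hRR₀, c, hcU⟩ := exists_morseCharts hf hB hε
    (U := fun p => if f p = c₀ then f ⁻¹' Ioo a b else univ) (fun p hp => by
      split_ifs with hpc
      · exact hf.smooth.continuous.continuousAt (Ioo_mem_nhds (by rwa [hpc]) (by rwa [hpc]))
      · exact univ_mem) hR₀
  have hR := c.R_pos
  have hR1 : R ≤ 1 := hRR₀.trans (min_le_left _ _)
  have hRa : R ≤ c₀ - a := hRR₀.trans ((min_le_right _ _).trans (min_le_left _ _))
  have hRb : R ≤ b - c₀ := hRR₀.trans ((min_le_right _ _).trans (min_le_right _ _))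
  have hRsq : R ^ 2 / 2 < R := by nlinarith
  have hFs : ∀ p ∈ criticalPoints n f,
      ContDiffOn ℝ ∞ (fun y => f ((c.e p).symm y)) (Metric.ball 0 R) := fun p hp => by
    rw [← c.target_eq p hp]
    exact contDiffOn_comp_chart_symm hf.smooth (c.mem_atlas p hp)
  obtain ⟨X, hX, hXG, hXW, hXf⟩ := exists_gradientLike hf c (W := fun p y => -signL (c.d p) y)
    (R' := 3 / 4 * R) (fun p _ => (signL (c.d p)).contDiff.contDiffOn.neg)
    (fun σ p hp y _ => by rw [c.rot_sign σ p hp, map_neg])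
    (fun p hp y hy hy0 => by
      have hy' : 0 < ‖y‖ := norm_pos_iff.2 hy0
      have h1 := (abs_le.1 (c.approx_deriv p hp y hy (-signL (c.d p) y))).2
      rw [inner_neg_right, real_inner_self_eq_norm_sq, norm_neg, norm_signL (c.d_ne p hp)] at h1
      have h2 : ε < 1 := by nlinarith
      nlinarith [mul_pos hy' hy']) (by linarith)
  obtain ⟨Φ, hΦ⟩ := exists_isFlow hX
  -- The cutoff is one for `‖y‖ ≤ R / 2` and zero once `‖y‖² ≥ R² / 2`, in particular beyond `3 / 4
  -- * R`.
  let q : M → Euc n → ℝ := fun p y => if f p = c₀ then cutoff (4 * ‖y‖ ^ 2 / R ^ 2) *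
    (c₀ + ⟪signL (c.d p) y, y⟫ / 2 - f ((c.e p).symm y)) else 0
  have hq0 : ∀ p (y : Euc n), 3 / 4 * R < ‖y‖ → q p y = 0 := by
    intro p y hy
    simp only [q]
    split_ifs
    · rw [cutoff_of_two_le, zero_mul]
      rw [le_div_iff₀ (by positivity)]
      nlinarith
    · rfl
  let h : M → ℝ := fun x => f x + c.glue q x
  have hh : ContMDiff (𝓡 n) 𝓘(ℝ, ℝ) ∞ h := by
    refine hf.smooth.add (c.contMDiff_glue hf le_rfl (fun p hp => ?_) (R' := 3 / 4 * R)
      (by linarith) fun p _ y _ => hq0 p y)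
    simp only [q]
    split_ifs
    · refine ContDiffOn.mul ?_ (ContDiffOn.sub ?_ (hFs p hp))
      · exact (contDiff_cutoff.comp ((contDiff_const.mul (contDiff_norm_sq ℝ)).div_const
          _)).contDiffOn
      · exact (contDiff_const.add (((signL (c.d p)).contDiff.inner ℝ contDiff_id).div_const
          2)).contDiffOn
    · exact contDiffOn_const
  have hhp : ∀ {p}, p ∈ criticalPoints n f → f p = c₀ → ∀ {x}, x ∈ (c.e p).source →
      h x = f x + cutoff (4 * ‖c.e p x‖ ^ 2 / R ^ 2) *
        (c₀ + ⟪signL (c.d p) (c.e p x), c.e p x⟫ / 2 - f x) := by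
    intro p hp hpc x hx
    simp only [h]
    rw [c.glue_apply hp hx]
    simp only [q]
    rw [if_pos hpc, (c.e p).left_inv hx]
  refine ⟨⟨ε, R, c, X, Φ, h, hX, hh, hΦ, hΦ.smul hX hXG, ?_, by linarith, by linarith, ?_, ?_, ?_,
    fun p hp y hy => hXW p hp y hy⟩⟩
  · intro σ x
    simp only [h]
    rw [hf.invariant, c.glue_smul hf]
    intro σ p hp y hy
    simp only [q]
    rw [hf.invariant, c.rot_norm σ p hp, c.quad_rot σ hp, c.symm_rot σ hp hy, hf.invariant]
  · intro x
    by_cases hx : ∃ p ∈ criticalPoints n f, x ∈ (c.e p).source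
    · obtain ⟨p, hp, hxp⟩ := hx
      by_cases hpc : f p = c₀
      · rcases lt_or_ge (3 / 4 * R) ‖c.e p x‖ with hlt | hle
        · left
          simp only [h]
          rw [c.glue_apply hp hxp, hq0 p _ hlt, add_zero]
        right
        have h1 := hcU p hp hxp
        rw [if_pos hpc] at h1
        have h2 := cutoff_nonneg (4 * ‖c.e p x‖ ^ 2 / R ^ 2)
        have h3 := cutoff_le_one (4 * ‖c.e p x‖ ^ 2 / R ^ 2)
        have h4 := abs_le.1 (abs_inner_signL_le (c.d_ne p hp) (c.e p x))
        have h5 : ‖c.e p x‖ ^ 2 ≤ R ^ 2 := by nlinarith [norm_nonneg (c.e p x)]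
        obtain ⟨h6, h7⟩ : a < f x ∧ f x < b := h1
        refine ⟨h6, h7, ?_, ?_⟩
        · rw [hhp hp hpc hxp]
          rcases h3.eq_or_lt with h3 | h3
          · rw [h3]
            linarith [h4.1]
          · nlinarith [h4.1, mul_nonneg h2 (by linarith [h4.1] :
              0 ≤ c₀ + ⟪signL (c.d p) (c.e p x), c.e p x⟫ / 2 - a),
              mul_pos (sub_pos.2 h3) (sub_pos.2 h6)]
        · rw [hhp hp hpc hxp]
          rcases h3.eq_or_lt with h3 | h3
          · rw [h3]
            linarith [h4.2]
          · nlinarith [h4.2, mul_nonneg h2 (by linarith [h4.2] :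
              0 ≤ b - (c₀ + ⟪signL (c.d p) (c.e p x), c.e p x⟫ / 2)),
              mul_pos (sub_pos.2 h3) (sub_pos.2 h7)]
      · left
        simp only [h]
        rw [c.glue_apply hp hxp]
        simp only [q]
        rw [if_neg hpc, add_zero]
    · left
      simp only [h]
      rw [c.glue_eq_zero hx, add_zero]
  · intro x hx
    have hfar : h =ᶠ[𝓝 x] f → dfun h x (X x) < 0 := fun he => by
      have h1 : dfun (n := n) h x = dfun f x := he.mfderiv_eq
      rw [h1]
      exact hXf x hx
    by_cases hxs : ∃ p ∈ criticalPoints n f, x ∈ (c.e p).source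
    · obtain ⟨p, hp, hxp⟩ := hxs
      by_cases hpc : f p = c₀
      · rcases lt_or_ge (3 / 4 * R) ‖c.e p x‖ with hlt | hle
        · apply hfar
          filter_upwards [(c.e p).open_source.mem_nhds hxp,
            continuousAt_const.eventually_lt ((c.e p).continuousAt hxp).norm hlt] with z hz hz2
          simp only [h]
          rw [c.glue_apply hp hz, hq0 p _ hz2, add_zero]
        · refine (dfun_field_chart (c.mem_atlas p hp) hh hxp).trans_lt ?_
          rw [hXW p hp _ hle]
          have hy := c.apply_mem_ball hp hxp
          have hcong : (fun y => h ((c.e p).symm y)) =ᶠ[𝓝 (c.e p x)] fun y =>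
              f ((c.e p).symm y) + cutoff (4 * ‖y‖ ^ 2 / R ^ 2) *
                (c₀ + ⟪signL (c.d p) y, y⟫ / 2 - f ((c.e p).symm y)) := by
            filter_upwards [(c.e p).open_target.mem_nhds ((c.e p).map_source hxp)] with y hy
            rw [hhp hp hpc ((c.e p).map_target hy), (c.e p).right_inv hy]
          rw [hcong.fderiv_eq]
          refine fderiv_interpolation_neg (c.d_ne p hp) hR hε.le hK0 hK hεK hy (fun h0 => hx ?_)
            (((hFs p hp).contDiffAt (Metric.isOpen_ball.mem_nhds hy)).differentiableAt (by simp))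
            (by rw [← hpc]; exact c.approx_value p hp _ hy) (c.approx_deriv p hp _ hy)
          rwa [(c.e p).injOn hxp (c.mem_source p hp) (h0.trans (c.apply_self p hp).symm)]
      · apply hfar
        filter_upwards [(c.e p).open_source.mem_nhds hxp] with z hz
        simp only [h]
        rw [c.glue_apply hp hz]
        simp only [q]
        rw [if_neg hpc, add_zero]
    · apply hfar
      filter_upwards [c.eventually_of_notMem hf hxs (r := 3 / 4 * R) (by linarith)] with z hz
      simp only [h]
      by_cases hzs : ∃ p ∈ criticalPoints n f, z ∈ (c.e p).source
      · obtain ⟨p, hp, hzp⟩ := hzs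
        rw [c.glue_apply hp hzp, hq0 p _ (hz p hp hzp), add_zero]
      · rw [c.glue_eq_zero hzs, add_zero]
  · intro p hp x hx hle
    rw [hhp hp.1 hp.2 hx, cutoff_of_le_one]
    · ring
    · rw [div_le_one₀ (by positivity)]
      linarith

end LevelModel

end EquivariantMorse

namespace EquivariantMorse

/-! ### The local flow and the collapse near the critical points -/

section Collapse

open Set Filter
open scoped RealInnerProductSpace

lemma exists_first_exit {r : ℝ → ℝ} (hr : Continuous r) {m T : ℝ} (h0 : r 0 < m) :
    (∀ t ∈ Icc 0 T, r t < m) ∨ ∃ t₁ ∈ Icc 0 T, r t₁ = m ∧ ∀ t ∈ Ico 0 t₁, r t < m := by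
  by_cases h : ∀ t ∈ Icc 0 T, r t < m
  · exact Or.inl h
  push Not at h
  obtain ⟨t, ht, hmt⟩ := h
  obtain ⟨s, hs⟩ := (isCompact_Icc.inter_right (isClosed_Ici.preimage hr)).exists_isLeast
    (⟨t, ht, hmt⟩ : (Icc 0 T ∩ r ⁻¹' Ici m).Nonempty)
  have hs2 : m ≤ r s := hs.1.2
  have hlt : ∀ t ∈ Ico 0 s, r t < m := fun t ht => by
    by_contra! h1
    exact absurd (hs.2 ⟨⟨ht.1, ht.2.le.trans hs.1.1.2⟩, h1⟩) (not_le.2 ht.2)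
  have hs0 : 0 < s := lt_of_le_of_ne hs.1.1.1 (by rintro rfl; exact absurd hs2 (not_le.2 h0))
  refine Or.inr ⟨s, hs.1.1, le_antisymm ?_ hs2, hlt⟩
  have h1 : Tendsto r (𝓝[<] s) (𝓝 (r s)) := hr.continuousAt.continuousWithinAt
  exact le_of_tendsto h1 (mem_of_superset (Ico_mem_nhdsLT hs0) fun t ht => (hlt t ht).le)

variable {n : ℕ}

/-- The projection to the positive eigenspace of `signL d`. -/
noncomputable def plusPart (d : Fin n → ℝ) (y : Euc n) : Euc n := (2⁻¹ : ℝ) • (y + signL d y)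

lemma norm_plusPart_sq {d : Fin n → ℝ} (hd : ∀ i, d i ≠ 0) (y : Euc n) :
    ‖plusPart d y‖ ^ 2 = (‖y‖ ^ 2 + ⟪signL d y, y⟫) / 2 := by
  rw [plusPart, norm_smul, mul_pow, norm_add_sq_real, norm_signL hd, real_inner_comm]
  norm_num
  ring

lemma signL_plusPart {d : Fin n → ℝ} (hd : ∀ i, d i ≠ 0) (y : Euc n) :
    signL d (plusPart d y) = plusPart d y := by
  rw [plusPart, map_smul, map_add, signL_signL hd, add_comm]

lemma inner_plusPart {d : Fin n → ℝ} (hd : ∀ i, d i ≠ 0) (y : Euc n) :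
    ⟪y, plusPart d y⟫ = ‖plusPart d y‖ ^ 2 := by
  rw [norm_plusPart_sq hd, plusPart, inner_smul_right, inner_add_right,
    real_inner_self_eq_norm_sq, real_inner_comm]
  ring

lemma continuous_plusPart (d : Fin n → ℝ) : Continuous (plusPart d) := by
  unfold plusPart
  fun_prop

lemma plusPart_eq_zero {d : Fin n → ℝ} {y : Euc n} : plusPart d y = 0 ↔ signL d y = -y := by
  rw [plusPart, smul_eq_zero_iff_right (by norm_num), add_comm, add_eq_zero_iff_eq_neg]

lemma norm_sub_smul_plusPart_sq {d : Fin n → ℝ} (hd : ∀ i, d i ≠ 0) (y : Euc n) (μ : ℝ) :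
    ‖y - μ • plusPart d y‖ ^ 2 = ‖y‖ ^ 2 - (1 - (1 - μ) ^ 2) * ‖plusPart d y‖ ^ 2 := by
  rw [norm_sub_sq_real, inner_smul_right, inner_plusPart hd, norm_smul, mul_pow, Real.norm_eq_abs,
    sq_abs]
  ring

lemma plusPart_sub_smul_plusPart {d : Fin n → ℝ} (hd : ∀ i, d i ≠ 0) (y : Euc n) (μ : ℝ) :
    plusPart d (y - μ • plusPart d y) = (1 - μ) • plusPart d y := by
  have h1 : plusPart d (y - μ • plusPart d y) = plusPart d y - μ • plusPart d y := by
    have h2 := signL_plusPart hd y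
    conv_lhs => rw [plusPart]
    rw [map_sub, map_smul, h2]
    have h3 : plusPart d y = (2⁻¹ : ℝ) • (y + signL d y) := rfl
    rw [h3]
    module
  rw [h1, sub_smul, one_smul]

variable {M : Type*} [TopologicalSpace M] [ChartedSpace (Euc n) M] [IsManifold (𝓡 n) ∞ M]
  {f : M → ℝ} {G : Type*} [Group G] [MulAction G M] [SmoothAction n G M]
  {B : M → Euc n →L[ℝ] Euc n →L[ℝ] ℝ} {a b c₀ : ℝ} (m : LevelModel G f B a b c₀)

namespace LevelModel

lemma R_pos : 0 < m.R := m.charts.R_pos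

/-- The squared distance to the critical points. -/
noncomputable def rho (x : M) : ℝ := m.charts.rho c₀ x

/-- The squared norm of the positive part, near the critical points. -/
noncomputable def pos (x : M) : ℝ := m.h x - c₀ + m.rho x / 2

/-- Where `h` is exactly quadratic, `pos` is the squared length of the positive coordinates. Thus `h
= c₀ + pos - rho / 2` with globally defined functions, and the later estimates need no charts. -/
lemma exists_of_rho_lt {x : M} (hx : m.rho x < m.R ^ 2 / 4) :
    ∃ p ∈ criticalPointsAt n f c₀, x ∈ (m.charts.e p).source ∧ ‖m.charts.e p x‖ ^ 2 = m.rho x ∧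
      m.pos x = ‖plusPart (m.charts.d p) (m.charts.e p x)‖ ^ 2 := by
  obtain ⟨p, hp, hxp, h⟩ := m.charts.exists_of_rho_lt (hx.trans (by nlinarith [m.R_pos]))
  refine ⟨p, hp, hxp, h, ?_⟩
  rw [pos, m.quad p hp x hxp (h.trans_lt hx).le, norm_plusPart_sq (m.charts.d_ne p hp.1), h, rho]
  ring

lemma spec_of_mem_source {p x : M} (hp : p ∈ criticalPointsAt n f c₀)
    (hx : x ∈ (m.charts.e p).source) (h : ‖m.charts.e p x‖ ^ 2 ≤ m.R ^ 2 / 4) :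
    m.rho x = ‖m.charts.e p x‖ ^ 2 ∧
      m.pos x = ‖plusPart (m.charts.d p) (m.charts.e p x)‖ ^ 2 := by
  have h1 : m.rho x = ‖m.charts.e p x‖ ^ 2 :=
    (m.charts.rho_apply hp hx).trans (min_eq_left (by nlinarith [m.R_pos]))
  refine ⟨h1, ?_⟩
  rw [pos, m.quad p hp x hx h, norm_plusPart_sq (m.charts.d_ne p hp.1), h1]
  ring

lemma pos_nonneg {x : M} (hx : m.rho x < m.R ^ 2 / 4) : 0 ≤ m.pos x := by
  obtain ⟨p, -, -, -, h⟩ := m.exists_of_rho_lt hx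
  rw [h]
  positivity

/-- The linear flow `y' = -signL y` contracts positive coordinates like `exp (-t)`. -/
lemma hasDerivAt_pos {x : M} {t : ℝ} (hx : m.rho (m.Φ t x) < m.R ^ 2 / 4) :
    HasDerivAt (fun s => m.pos (m.Φ s x)) (-2 * m.pos (m.Φ t x)) t := by
  obtain ⟨p, hp, hxp, hpρ, hd⟩ := m.charts.hasDerivAt_rho m.flow (a := c₀) (x := x) (t := t)
    (hx.trans (by nlinarith [m.R_pos]))
  have hd' := m.charts.d_ne p hp.1
  have hlt : ‖m.charts.e p (m.Φ t x)‖ ^ 2 < m.R ^ 2 / 4 := hpρ.trans_lt hx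
  have hX := m.field_eq p hp.1 (m.charts.e p (m.Φ t x)) (by
    refine le_of_sq_le_sq ?_ (by linarith [m.R_pos])
    nlinarith [m.R_pos])
  have h1 := hasDerivAt_chart (m.charts.mem_atlas p hp.1) (m.flow.curve x t) hxp
  rw [hX] at hd h1
  set y := m.charts.e p (m.Φ t x) with hy
  have h2 : HasDerivAt (fun s => signL (m.charts.d p) (m.charts.e p (m.Φ s x)))
      (signL (m.charts.d p) (-signL (m.charts.d p) y)) t :=
    (signL (m.charts.d p)).hasFDerivAt.comp_hasDerivAt t h1
  rw [map_neg, signL_signL hd'] at h2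
  have h3 : HasDerivAt (fun s => m.h (m.Φ s x)) (-‖y‖ ^ 2) t := by
    have h4 := ((h2.inner ℝ h1).div_const 2).const_add c₀
    rw [inner_neg_right, inner_neg_left, real_inner_self_eq_norm_sq, real_inner_self_eq_norm_sq,
      norm_signL hd', ← hy] at h4
    refine (h4.congr_deriv (by ring)).congr_of_eventuallyEq ?_
    have h5 : ContinuousAt (fun s => m.Φ s x) t :=
      (m.flow.continuous.comp (continuous_id.prodMk continuous_const)).continuousAt
    filter_upwards [h5 ((m.charts.e p).open_source.mem_nhds hxp),
      (h1.continuousAt.norm.pow 2).eventually_lt continuousAt_const hlt] with s hs hs2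
    exact m.quad p hp _ hs (le_of_lt hs2)
  refine ((h3.sub_const c₀).add (hd.div_const 2)).congr_deriv ?_
  rw [(m.spec_of_mem_source hp hxp hlt.le).2, norm_plusPart_sq hd', inner_neg_right,
    real_inner_comm]
  ring

variable [CompactSpace M] [T2Space M] [Fintype G] (hf : IsEquivariantMorse n G f)

include hf

lemma continuous_rho : Continuous m.rho := m.charts.continuous_rho hf

lemma continuous_pos : Continuous m.pos :=
  (m.smooth.continuous.sub continuous_const).add ((m.continuous_rho hf).div_const 2)

omit [CompactSpace M] [T2Space M] [Fintype G] in
lemma rho_smul (σ : G) (x : M) : m.rho (σ • x) = m.rho x := m.charts.rho_smul hf σ x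

/-- A flow line in a small ball either stays in it or leaves it, and meanwhile the positive part
decreases. -/
lemma stays_or_exits {x : M} {r T : ℝ} (hr : r ≤ m.R ^ 2 / 4) (hx : m.rho x < r) (hT : 0 ≤ T) :
    (m.rho (m.Φ T x) < r ∧ m.pos (m.Φ T x) ≤ m.pos x) ∨
      ∃ t ∈ Icc 0 T, m.rho (m.Φ t x) = r ∧ m.pos (m.Φ t x) ≤ m.pos x := by
  have hcurve : Continuous fun s => m.Φ s x :=
    m.flow.continuous.comp (continuous_id.prodMk continuous_const)
  have key : ∀ t, 0 ≤ t → (∀ s ∈ Ico 0 t, m.rho (m.Φ s x) < r) →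
      m.pos (m.Φ t x) ≤ m.pos x := by
    intro t ht h
    have h1 : AntitoneOn (fun s => m.pos (m.Φ s x)) (Icc 0 t) := by
      refine antitoneOn_of_hasDerivWithinAt_nonpos (convex_Icc _ _)
        (f' := fun s => -2 * m.pos (m.Φ s x)) ((m.continuous_pos hf).comp hcurve).continuousOn
        (fun s hs => ?_) fun s hs => ?_ <;> rw [interior_Icc] at hs
      · exact (m.hasDerivAt_pos ((h s ⟨hs.1.le, hs.2⟩).trans_le hr)).hasDerivWithinAt
      · linarith [m.pos_nonneg ((h s ⟨hs.1.le, hs.2⟩).trans_le hr)]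
    have h2 := h1 (left_mem_Icc.2 ht) (right_mem_Icc.2 ht) ht
    simpa only [m.flow.zero] using h2
  rcases exists_first_exit ((m.continuous_rho hf).comp hcurve) (m := r) (T := T)
    (by simpa [m.flow.zero] using hx) with h | ⟨t, ht, htr, h⟩
  · exact Or.inl ⟨h T ⟨hT, le_rfl⟩, key T hT fun s hs => h s ⟨hs.1, hs.2.le⟩⟩
  · exact Or.inr ⟨t, ht, htr, key t ht.1 h⟩

omit hf [CompactSpace M] [T2Space M] [Fintype G] in
lemma h_antitone (x : M) : Antitone fun s => m.h (m.Φ s x) := by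
  refine m.flow.antitone_comp m.smooth (fun x => ?_) x
  by_cases hx : x ∈ criticalPoints n f
  · rw [dfun_field_chart (m.charts.mem_atlas x hx) m.smooth (m.charts.mem_source x hx),
      m.charts.apply_self x hx,
      m.field_eq x hx 0 (by simpa using m.R_pos.le), map_zero, neg_zero, map_zero]
  · exact (m.neg x hx).le

omit hf [CompactSpace M] [T2Space M] [Fintype G] in
lemma h_flow_le {t : ℝ} (ht : 0 ≤ t) (x : M) : m.h (m.Φ t x) ≤ m.h x := by
  have h := m.h_antitone x ht
  simpa only [m.flow.zero] using h

omit [CompactSpace M] [T2Space M] [Fintype G] hf in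
lemma h_eq (x : M) : m.h x = c₀ + m.pos x - m.rho x / 2 := by
  rw [pos]
  ring

/-- The part of a low sublevel set and of the descending disc of radius `√(2s)`. -/
lemma stays_low_or_descending {s : ℝ} (hs : s ≤ m.R ^ 2 / 64) {x : M} (hρ : m.rho x ≤ 2 * s)
    (hp : m.pos x ≤ 0) {t : ℝ} (ht : 0 ≤ t) :
    m.h (m.Φ t x) ≤ c₀ - s ∨ (m.rho (m.Φ t x) ≤ 2 * s ∧ m.pos (m.Φ t x) = 0) := by
  have hR := pow_pos m.R_pos 2
  -- While the orbit stays near, `pos` remains zero, and `h > c₀ - s` means `rho < 2 s`. On exit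
  -- `rho = R² / 8` and `pos ≤ 0` give `h ≤ c₀ - R² / 16`, which is below `c₀ - s` from then on.
  rcases m.stays_or_exits hf (r := m.R ^ 2 / 8) (by linarith) (x := x) (by linarith) ht with
    ⟨h1, h2⟩ | ⟨t', ht', h1, h2⟩
  · have h3 := m.pos_nonneg (h1.trans (by linarith))
    by_cases h4 : m.h (m.Φ t x) ≤ c₀ - s
    · exact Or.inl h4
    · rw [m.h_eq] at h4
      exact Or.inr ⟨by linarith, by linarith⟩
  · left
    have h3 := m.h_antitone x ht'.2
    simp only at h3
    rw [m.h_eq (m.Φ t' x)] at h3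
    linarith

/-- The set in which all flow lines from the sublevel set `b` end. -/
lemma stays_low_or_near {x : M} (hρ : m.rho x < m.R ^ 2 / 16) (hp : m.pos x ≤ m.R ^ 2 / 64) {t : ℝ}
    (ht : 0 ≤ t) : m.h (m.Φ t x) ≤ c₀ - m.R ^ 2 / 128 ∨
      (m.rho (m.Φ t x) < m.R ^ 2 / 16 ∧ m.pos (m.Φ t x) ≤ m.R ^ 2 / 64) := by
  have hR := pow_pos m.R_pos 2
  -- On exit `h ≤ c₀ + R² / 64 - R² / 32`, which is already low enough.
  rcases m.stays_or_exits hf (r := m.R ^ 2 / 16) (by linarith) hρ ht with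
    ⟨h1, h2⟩ | ⟨t', ht', h1, h2⟩
  · exact Or.inr ⟨h1, h2.trans hp⟩
  · left
    have h3 := m.h_antitone x ht'.2
    simp only at h3
    rw [m.h_eq (m.Φ t' x)] at h3
    linarith

/-! #### The collapse onto the descending discs -/

omit [CompactSpace M] [T2Space M] [Fintype G] hf in
/-- The amount by which the collapse at time `t` contracts the positive part at `x`. -/
noncomputable def amount (t : ℝ) (x : M) : ℝ :=
  max 0 (min t 1) * (Real.smoothTransition ((m.h x - (c₀ - m.R ^ 2 / 64)) / (m.R ^ 2 / 128)) *
    Real.smoothTransition ((m.R ^ 2 / 4 - m.rho x) / (m.R ^ 2 / 8)))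

omit [CompactSpace M] [T2Space M] [Fintype G] hf in
lemma amount_mem (t : ℝ) (x : M) : m.amount t x ∈ Icc (0 : ℝ) 1 := by
  have h1 : max 0 (min t 1) ≤ 1 := max_le zero_le_one (min_le_right _ _)
  have h2 : (0 : ℝ) ≤ max 0 (min t 1) := le_max_left _ _
  have h3 := Real.smoothTransition.nonneg ((m.h x - (c₀ - m.R ^ 2 / 64)) / (m.R ^ 2 / 128))
  have h4 := Real.smoothTransition.nonneg ((m.R ^ 2 / 4 - m.rho x) / (m.R ^ 2 / 8))
  exact ⟨mul_nonneg h2 (mul_nonneg h3 h4), mul_le_one₀ h1 (mul_nonneg h3 h4)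
    (mul_le_one₀ (Real.smoothTransition.le_one _) h4 (Real.smoothTransition.le_one _))⟩

lemma continuous_amount : Continuous fun q : ℝ × M => m.amount q.1 q.2 := by
  have h1 := m.smooth.continuous
  have h2 := m.continuous_rho hf
  exact (continuous_const.max (continuous_fst.min continuous_const)).mul
    ((Real.smoothTransition.continuous.comp (((h1.comp continuous_snd).sub
      continuous_const).div_const _)).mul (Real.smoothTransition.continuous.comp
      ((continuous_const.sub (h2.comp continuous_snd)).div_const _)))

omit [CompactSpace M] [T2Space M] [Fintype G] hf in
lemma amount_zero (x : M) : m.amount 0 x = 0 := by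
  simp [amount]

omit [CompactSpace M] [T2Space M] [Fintype G] hf in
lemma amount_of_le {x : M} (hx : m.h x ≤ c₀ - m.R ^ 2 / 64) (t : ℝ) : m.amount t x = 0 := by
  rw [amount, Real.smoothTransition.zero_of_nonpos (x := (m.h x - (c₀ - m.R ^ 2 / 64)) / _),
    zero_mul, mul_zero]
  exact div_nonpos_of_nonpos_of_nonneg (by linarith) (by positivity)

omit [CompactSpace M] [T2Space M] [Fintype G] hf in
lemma amount_of_far {x : M} (hx : m.R ^ 2 / 4 ≤ m.rho x) (t : ℝ) : m.amount t x = 0 := by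
  rw [amount, Real.smoothTransition.zero_of_nonpos (x := (m.R ^ 2 / 4 - m.rho x) / _),
    mul_zero, mul_zero]
  exact div_nonpos_of_nonpos_of_nonneg (by linarith) (by positivity)

-- With `η = R² / 128`, the collapse is complete above height `c₀ - η` near the critical points and,
-- by `amount_of_le`, trivial below `c₀ - 2 η`. The gap leaves room for a continuous transition.
omit [CompactSpace M] [T2Space M] [Fintype G] hf in
lemma amount_one {x : M} (hx : c₀ - m.R ^ 2 / 128 ≤ m.h x) (hρ : m.rho x ≤ m.R ^ 2 / 8) :
    m.amount 1 x = 1 := by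
  have hR := pow_pos m.R_pos 2
  rw [amount, Real.smoothTransition.one_of_one_le, Real.smoothTransition.one_of_one_le]
  · simp
  · rw [one_le_div (by positivity)]
    linarith
  · rw [one_le_div (by positivity)]
    linarith

omit [CompactSpace M] [T2Space M] [Fintype G] in
lemma amount_smul (t : ℝ) (σ : G) (x : M) : m.amount t (σ • x) = m.amount t x := by
  rw [amount, amount, m.invariant, m.rho_smul hf]

omit [CompactSpace M] [T2Space M] [Fintype G] hf in
open Classical in
/-- The collapse onto the descending discs in the charts. -/
noncomputable def collapse (t : ℝ) (x : M) : M :=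
  if h : ∃ p ∈ criticalPoints n f, x ∈ (m.charts.e p).source then
    (m.charts.e h.choose).symm (m.charts.e h.choose x -
      m.amount t x • plusPart (m.charts.d h.choose) (m.charts.e h.choose x))
  else x

omit [CompactSpace M] [T2Space M] [Fintype G] hf in
lemma collapse_apply (t : ℝ) {p x : M} (hp : p ∈ criticalPoints n f)
    (hx : x ∈ (m.charts.e p).source) : m.collapse t x = (m.charts.e p).symm
      (m.charts.e p x - m.amount t x • plusPart (m.charts.d p) (m.charts.e p x)) := by
  have h : ∃ p ∈ criticalPoints n f, x ∈ (m.charts.e p).source := ⟨p, hp, hx⟩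
  rw [collapse, dif_pos h, m.charts.eq_of_mem_source h.choose_spec.1 hp h.choose_spec.2 hx]

omit [CompactSpace M] [T2Space M] [Fintype G] hf in
lemma collapse_of_amount_eq_zero {t : ℝ} {x : M} (h : m.amount t x = 0) : m.collapse t x = x := by
  by_cases hx : ∃ p ∈ criticalPoints n f, x ∈ (m.charts.e p).source
  · obtain ⟨p, hp, hxp⟩ := hx
    rw [m.collapse_apply t hp hxp, h, zero_smul, sub_zero, (m.charts.e p).left_inv hxp]
  · exact dif_neg hx

omit [CompactSpace M] [T2Space M] [Fintype G] hf in
lemma contraction_mem {p : M} (hp : p ∈ criticalPoints n f) {y : Euc n} {μ : ℝ}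
    (hμ : μ ∈ Icc (0 : ℝ) 1) {r : ℝ} (hy : ‖y‖ ^ 2 < r ^ 2) :
    ‖y - μ • plusPart (m.charts.d p) y‖ ^ 2 < r ^ 2 := by
  rw [norm_sub_smul_plusPart_sq (m.charts.d_ne p hp)]
  have h1 : 0 ≤ 1 - (1 - μ) ^ 2 := by nlinarith [hμ.1, hμ.2]
  nlinarith [mul_nonneg h1 (sq_nonneg ‖plusPart (m.charts.d p) y‖)]

omit [CompactSpace M] [T2Space M] [Fintype G] hf in
lemma contraction_mem_target {p x : M} (hp : p ∈ criticalPoints n f)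
    (hx : x ∈ (m.charts.e p).source) (t : ℝ) : m.charts.e p x - m.amount t x •
      plusPart (m.charts.d p) (m.charts.e p x) ∈ (m.charts.e p).target := by
  have h1 := m.charts.apply_mem_ball hp hx
  rw [mem_ball_zero_iff] at h1
  rw [m.charts.target_eq p hp, mem_ball_zero_iff]
  refine lt_of_pow_lt_pow_left₀ 2 m.R_pos.le (m.contraction_mem hp (m.amount_mem t x) ?_)
  exact pow_lt_pow_left₀ h1 (norm_nonneg _) two_ne_zero

omit [CompactSpace M] [T2Space M] [Fintype G] hf in
lemma collapse_spec {x : M} (hx : m.rho x < m.R ^ 2 / 4) (t : ℝ) :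
    m.pos (m.collapse t x) = (1 - m.amount t x) ^ 2 * m.pos x ∧
      m.rho (m.collapse t x) = m.rho x - (1 - (1 - m.amount t x) ^ 2) * m.pos x := by
  obtain ⟨p, hp, hxp, h1, h2⟩ := m.exists_of_rho_lt hx
  have ht := m.contraction_mem_target hp.1 hxp t
  have h3 : ‖m.charts.e p (m.collapse t x)‖ ^ 2 ≤ m.R ^ 2 / 4 := by
    rw [m.collapse_apply t hp.1 hxp, (m.charts.e p).right_inv ht]
    have h4 := m.contraction_mem hp.1 (m.amount_mem t x) (y := m.charts.e p x) (r := m.R / 2)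
      (by rw [h1]; linarith)
    linarith
  have hs : m.collapse t x ∈ (m.charts.e p).source := by
    rw [m.collapse_apply t hp.1 hxp]
    exact (m.charts.e p).map_target ht
  obtain ⟨h4, h5⟩ := m.spec_of_mem_source hp hs h3
  rw [h4, h5, h2, ← h1, m.collapse_apply t hp.1 hxp, (m.charts.e p).right_inv ht,
    plusPart_sub_smul_plusPart (m.charts.d_ne p hp.1),
    norm_sub_smul_plusPart_sq (m.charts.d_ne p hp.1), norm_smul, mul_pow, Real.norm_eq_abs, sq_abs]
  exact ⟨rfl, rfl⟩

-- The collapse lowers `pos` and `rho` by the same nonnegative amount, so `h = c₀ + pos - rho / 2`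
-- drops by half of it.
omit [CompactSpace M] [T2Space M] [Fintype G] hf in
lemma h_collapse_le (t : ℝ) (x : M) : m.h (m.collapse t x) ≤ m.h x := by
  rcases lt_or_ge (m.rho x) (m.R ^ 2 / 4) with hx | hx
  · obtain ⟨h1, h2⟩ := m.collapse_spec hx t
    rw [m.h_eq, m.h_eq x, h1, h2]
    have h3 := m.amount_mem t x
    have h4 : 0 ≤ 1 - (1 - m.amount t x) ^ 2 := by nlinarith [h3.1, h3.2]
    nlinarith [mul_nonneg h4 (m.pos_nonneg hx)]
  · rw [m.collapse_of_amount_eq_zero (m.amount_of_far hx t)]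

omit [CompactSpace M] [T2Space M] [Fintype G] hf in
lemma collapse_of_pos_eq_zero {x : M} (hx : m.rho x < m.R ^ 2 / 4) (h : m.pos x = 0) (t : ℝ) :
    m.collapse t x = x := by
  obtain ⟨p, hp, hxp, h1, h2⟩ := m.exists_of_rho_lt hx
  rw [h, eq_comm, sq_eq_zero_iff, norm_eq_zero] at h2
  rw [m.collapse_apply t hp.1 hxp, h2, smul_zero, sub_zero, (m.charts.e p).left_inv hxp]

omit [CompactSpace M] [T2Space M] [Fintype G] in
lemma collapse_smul (t : ℝ) (σ : G) (x : M) : m.collapse t (σ • x) = σ • m.collapse t x := by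
  by_cases hx : ∃ p ∈ criticalPoints n f, x ∈ (m.charts.e p).source
  · obtain ⟨p, hp, hxp⟩ := hx
    have ht := m.contraction_mem_target hp hxp t
    rw [m.charts.target_eq p hp] at ht
    rw [m.collapse_apply t hp hxp, m.collapse_apply t (smul_mem_criticalPoints hf σ hp)
      (m.charts.smul_mem σ p hp x hxp), m.charts.smul_apply σ p hp x hxp, m.amount_smul hf,
      ← m.charts.symm_rot σ hp ht]
    congr 1
    rw [map_sub, map_smul, plusPart, plusPart, map_smul, map_add, m.charts.rot_sign σ p hp]
  · have h1 : m.collapse t x = x := dif_neg hx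
    have h2 : m.collapse t (σ • x) = σ • x := by
      refine dif_neg ?_
      rintro ⟨p, hp, hxp⟩
      refine hx ⟨σ⁻¹ • p, smul_mem_criticalPoints hf _ hp, ?_⟩
      have h := m.charts.smul_mem σ⁻¹ p hp _ hxp
      rwa [inv_smul_smul] at h
    rw [h1, h2]

/-- Near a point outside all chart domains every point has `rho ≥ R² / 4`, where the collapse is the
identity. -/
lemma continuous_collapse : Continuous fun q : ℝ × M => m.collapse q.1 q.2 := by
  rw [continuous_iff_continuousAt]
  rintro ⟨t, x⟩
  by_cases hx : ∃ p ∈ criticalPoints n f, x ∈ (m.charts.e p).source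
  · obtain ⟨p, hp, hxp⟩ := hx
    have h1 : ContinuousAt (fun q : ℝ × M => m.charts.e p q.2) (t, x) :=
      ContinuousAt.comp (g := m.charts.e p) ((m.charts.e p).continuousAt hxp)
        continuous_snd.continuousAt
    have h2 : ContinuousAt (fun q : ℝ × M => m.charts.e p q.2 - m.amount q.1 q.2 •
        plusPart (m.charts.d p) (m.charts.e p q.2)) (t, x) :=
      h1.sub ((m.continuous_amount hf).continuousAt.smul
        (ContinuousAt.comp (g := plusPart (m.charts.d p)) (continuous_plusPart _).continuousAt h1))
    refine (ContinuousAt.comp (g := (m.charts.e p).symm) (f := fun q : ℝ × M => m.charts.e p q.2 -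
      m.amount q.1 q.2 • plusPart (m.charts.d p) (m.charts.e p q.2)) ((m.charts.e p).continuousAt_symm
      (m.contraction_mem_target hp hxp t)) h2).congr ?_
    filter_upwards [continuous_snd.continuousAt.preimage_mem_nhds
      ((m.charts.e p).open_source.mem_nhds hxp)] with q hq
    exact (m.collapse_apply q.1 hp hq).symm
  · refine continuous_snd.continuousAt.congr ?_
    filter_upwards [continuous_snd.continuousAt.preimage_mem_nhds
      (m.charts.eventually_of_notMem hf hx (r := m.R / 2) (by linarith [m.R_pos]))] with q hq
    refine (m.collapse_of_amount_eq_zero (m.amount_of_far (not_lt.1 fun h => ?_) q.1)).symm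
    obtain ⟨p, hp, hqp, h1, -⟩ := m.exists_of_rho_lt h
    have h2 : m.R / 2 < ‖m.charts.e p q.2‖ := hq p hp.1 hqp
    nlinarith [m.R_pos]

end LevelModel

end Collapse

end EquivariantMorse

namespace EquivariantMorse

/-! ### The embedding of the descending discs -/

section DescendingDisc

open Set Filter
open scoped RealInnerProductSpace

variable {n : ℕ} {M : Type*} [TopologicalSpace M] [ChartedSpace (Euc n) M]
  [IsManifold (𝓡 n) ∞ M]

/-- The vector part of an element of the tangent bundle. -/
def vec (x : TangentBundle (𝓡 n) M) : Euc n := x.2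

lemma snd_trivializationAt_self (x : TangentBundle (𝓡 n) M) :
    (trivializationAt (Euc n) (TangentSpace (𝓡 n) : M → Type _) x.proj x).2 = vec x := by
  change (tangentBundleCore (𝓡 n) M).coordChange _ _ _ _ = _
  exact (tangentBundleCore (𝓡 n) M).coordChange_self _ _ (mem_chart_source _ x.proj) _

lemma continuousAt_snd_trivializationAt (x₀ : TangentBundle (𝓡 n) M) :
    ContinuousAt (fun x : TangentBundle (𝓡 n) M =>
      (trivializationAt (Euc n) (TangentSpace (𝓡 n) : M → Type _) x₀.proj x).2) x₀ := by
  set τ := trivializationAt (Euc n) (TangentSpace (𝓡 n) : M → Type _) x₀.proj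
  have h : ContinuousAt τ x₀ := τ.continuousOn.continuousAt
    (τ.open_source.mem_nhds FiberBundle.mem_trivializationAt_proj_source)
  exact h.snd

/-- Over a finite set of base points the base point is locally constant, so continuity on `D` may be
checked in one fibre at a time. -/
lemma continuous_of_finite_fibers {N : Type*} [TopologicalSpace N] [T1Space M] {C : Set M}
    (hC : C.Finite) {D : Set (TangentBundle (𝓡 n) M)} (hD : ∀ x ∈ D, x.proj ∈ C)
    {F : M → Euc n → N} (hF : ∀ x ∈ D, ContinuousAt (F x.proj) (vec x)) :
    Continuous fun x : D => F x.1.proj (vec x.1) := by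
  rw [continuous_iff_continuousAt]
  rintro ⟨x₀, hx₀⟩
  have hτc : ContinuousAt (fun x : D => (trivializationAt (Euc n)
      (TangentSpace (𝓡 n) : M → Type _) x₀.proj x.1).2) ⟨x₀, hx₀⟩ :=
    (continuousAt_snd_trivializationAt x₀).tendsto.comp continuous_subtype_val.continuousAt
  have h1 : ContinuousAt (F x₀.proj) ((trivializationAt (Euc n)
      (TangentSpace (𝓡 n) : M → Type _) x₀.proj x₀).2) := by
    rw [snd_trivializationAt_self]
    exact hF x₀ hx₀
  refine ContinuousAt.congr (h1.tendsto.comp hτc) ?_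
  have hπ : Continuous fun x : D => x.1.proj :=
    (FiberBundle.continuous_proj (Euc n) (TangentSpace (𝓡 n) : M → Type _)).comp
      continuous_subtype_val
  have h2 : (C \ {x₀.proj})ᶜ ∈ 𝓝 x₀.proj :=
    (hC.sdiff).isClosed.isOpen_compl.mem_nhds fun h => h.2 rfl
  filter_upwards [hπ.continuousAt.preimage_mem_nhds (x := ⟨x₀, hx₀⟩) h2] with x hx
  have h3 : x.1.proj = x₀.proj := by
    by_contra h
    exact hx ⟨hD x.1 x.2, h⟩
  have h4 := snd_trivializationAt_self x.1
  rw [h3] at h4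
  rw [h3]
  exact congrArg (F x₀.proj) h4

/-- The metric as a family of bilinear forms on `ℝⁿ`. -/
noncomputable def metricForm (g : SmoothMetric n M) (p : M) : Euc n →L[ℝ] Euc n →L[ℝ] ℝ :=
  g.inner p

lemma invariantForm_metricForm {G : Type*} [Group G] [MulAction G M] {g : SmoothMetric n M}
    (hg : IsInvariantMetric G g) : InvariantForm G (metricForm g) where
  symm p v w := g.symm p v w
  pos p v hv := g.pos p v hv
  invariant σ p v w := hg σ p v w

variable {f : M → ℝ} {G : Type*} [Group G] [MulAction G M] [SmoothAction n G M]

lemma dchart_surjective {e : OpenPartialHomeomorph M (Euc n)}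
    (he : e ∈ IsManifold.maximalAtlas (𝓡 n) ∞ M) {p : M} (hp : p ∈ e.source) (w : Euc n) :
    ∃ v, dchart e p v = w := by
  have h := mfderiv_chart_chart_symm he (e.map_source hp) w
  rw [e.left_inv hp] at h
  exact ⟨_, h⟩

/-- The embedding of the disc of vectors of norm at most one as a disc of radius `s` in the charts;
it is the identity up to a radial rescaling. -/
noncomputable def discMap {B : M → Euc n →L[ℝ] Euc n →L[ℝ] ℝ} {ε R : ℝ} (c : MorseCharts G f B ε R)
    (s : ℝ) (p : M) (v : Euc n) : M :=
  (c.e p).symm ((s * √(B p v v) / ‖dchart (c.e p) p v‖) • dchart (c.e p) p v)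

lemma form_smul (L : Euc n →L[ℝ] Euc n →L[ℝ] ℝ) (t : ℝ) (v : Euc n) :
    L (t • v) (t • v) = t * (t * L v v) := by
  simp

namespace MorseCharts

variable {B : M → Euc n →L[ℝ] Euc n →L[ℝ] ℝ} {ε R : ℝ} (c : MorseCharts G f B ε R)
  (hB : InvariantForm G B)

include hB

lemma dchart_ne_zero {p : M} (hp : p ∈ criticalPoints n f) {v : Euc n} (hv : v ≠ 0) :
    dchart (c.e p) p v ≠ 0 := fun h => by
  have h1 := hB.pos p v hv
  rw [c.form_eq p hp, h] at h1
  simp at h1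

/-- The forms `B` and the Euclidean one have different unit spheres in the chart. Rescaling rays
turns `B`-length into radius, so the unit sphere lands in a single level of the quadratic function
on the negative space. -/
lemma norm_radial {p : M} (hp : p ∈ criticalPoints n f) {s : ℝ} (hs : 0 ≤ s) (v : Euc n) :
    ‖(s * √(B p v v) / ‖dchart (c.e p) p v‖) • dchart (c.e p) p v‖ = s * √(B p v v) := by
  by_cases hv : v = 0
  · subst hv
    simp
  · rw [norm_smul, norm_div, norm_norm, div_mul_cancel₀ _ (norm_ne_zero_iff.2
      (c.dchart_ne_zero hB hp hv)), Real.norm_of_nonneg (by positivity)]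

/-- At the origin, where the direction is undefined and division by zero gives zero, continuity
follows from the length formula. -/
lemma continuous_radial {p : M} (hp : p ∈ criticalPoints n f) {s : ℝ} (hs : 0 ≤ s) :
    Continuous fun v : Euc n =>
      (s * √(B p v v) / ‖dchart (c.e p) p v‖) • dchart (c.e p) p v := by
  have hN : Continuous fun v : Euc n => s * √(B p v v) :=
    continuous_const.mul (((B p).continuous.clm_apply continuous_id).sqrt)
  rw [continuous_iff_continuousAt]
  intro v
  by_cases hv : v = 0
  · subst hv
    rw [ContinuousAt]
    simp only [map_zero, smul_zero]
    refine squeeze_zero_norm (fun v => (c.norm_radial hB hp hs v).le) ?_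
    have := hN.tendsto 0
    simpa using this
  · exact (hN.continuousAt.div (dchart (c.e p) p).continuous.norm.continuousAt
      (norm_ne_zero_iff.2 (c.dchart_ne_zero hB hp hv))).smul
      (dchart (c.e p) p).continuous.continuousAt

lemma discMap_smul (hf : IsEquivariantMorse n G f) {s : ℝ} (hs : 0 ≤ s) (σ : G) {p : M}
    (hp : p ∈ criticalPoints n f) {v : Euc n} (hv : s * √(B p v v) < R) :
    discMap c s (σ • p) (dact σ p v) = σ • discMap c s p v := by
  rw [discMap, discMap, ← c.symm_rot σ hp, hB.invariant,
    c.dchart_dact hf σ hp (c.mem_source p hp), c.rot_norm σ p hp, map_smul]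
  rwa [mem_ball_zero_iff, c.norm_radial hB hp hs]

/-- Equal images have equal length, which gives equal `B`-length, and lie on the same ray. -/
lemma radial_injective {p : M} (hp : p ∈ criticalPoints n f) {s : ℝ} (hs : 0 < s) {v w : Euc n}
    (h : (s * √(B p v v) / ‖dchart (c.e p) p v‖) • dchart (c.e p) p v =
      (s * √(B p w w) / ‖dchart (c.e p) p w‖) • dchart (c.e p) p w) : v = w := by
  have hN : √(B p v v) = √(B p w w) := by
    have h1 := congrArg norm h
    rw [c.norm_radial hB hp hs.le, c.norm_radial hB hp hs.le] at h1
    exact mul_left_cancel₀ hs.ne' h1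
  have hz : ∀ u : Euc n, √(B p u u) = 0 → u = 0 := fun u hu => by
    by_contra hu0
    exact (Real.sqrt_pos.2 (hB.pos p u hu0)).ne' hu
  by_cases hv : v = 0
  · have h1 : √(B p w w) = 0 := by rw [← hN, hv]; simp
    rw [hv, hz w h1]
  have hw : w ≠ 0 := fun hw => hv (hz v (by rw [hN, hw]; simp))
  have hNv : 0 < √(B p v v) := Real.sqrt_pos.2 (hB.pos p v hv)
  have hv1 := norm_pos_iff.2 (c.dchart_ne_zero hB hp hv)
  have hw1 := norm_pos_iff.2 (c.dchart_ne_zero hB hp hw)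
  set t := ‖dchart (c.e p) p w‖ / ‖dchart (c.e p) p v‖ with ht
  have ht0 : 0 < t := by positivity
  have hwt : w = t • v := by
    rw [← sub_eq_zero]
    by_contra h0
    refine c.dchart_ne_zero hB hp h0 ?_
    rw [map_sub, map_smul, sub_eq_zero]
    rw [← hN] at h
    have h2 := congrArg (fun u => (‖dchart (c.e p) p w‖ / (s * √(B p v v))) • u) h
    simp only [smul_smul] at h2
    have h3 : ‖dchart (c.e p) p w‖ / (s * √(B p v v)) *
        (s * √(B p v v) / ‖dchart (c.e p) p w‖) = 1 := by field_simp
    have h4 : ‖dchart (c.e p) p w‖ / (s * √(B p v v)) *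
        (s * √(B p v v) / ‖dchart (c.e p) p v‖) = t := by rw [ht]; field_simp
    rw [h3, h4, one_smul] at h2
    exact h2.symm
  have h5 : √(B p w w) = t * √(B p v v) := by
    rw [hwt, form_smul,
      ← mul_assoc, ← pow_two, Real.sqrt_mul (sq_nonneg t), Real.sqrt_sq ht0.le]
  have h6 : t = 1 := by
    rw [← hN] at h5
    nlinarith
  rw [hwt, h6, one_smul]

lemma exists_radial_eq {p : M} (hp : p ∈ criticalPoints n f) {s : ℝ} (hs : 0 < s) (y : Euc n) :
    ∃ (v : Euc n) (t : ℝ), dchart (c.e p) p v = t • y ∧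
      (s * √(B p v v) / ‖dchart (c.e p) p v‖) • dchart (c.e p) p v = y := by
  by_cases hy : y = 0
  · exact ⟨0, 0, by simp [hy]⟩
  obtain ⟨v, hv⟩ := dchart_surjective (c.mem_atlas p hp) (c.mem_source p hp) y
  have hv0 : v ≠ 0 := fun h => hy (by rw [← hv, h, map_zero])
  have hN : 0 < √(B p v v) := Real.sqrt_pos.2 (hB.pos p v hv0)
  have hy0 : 0 < ‖y‖ := norm_pos_iff.2 hy
  set t := ‖y‖ / (s * √(B p v v)) with ht
  have ht0 : 0 < t := by positivity
  refine ⟨t • v, t, by rw [map_smul, hv], ?_⟩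
  have h5 : √(B p (t • v) (t • v)) = t * √(B p v v) := by
    rw [form_smul,
      ← mul_assoc, ← pow_two, Real.sqrt_mul (sq_nonneg t), Real.sqrt_sq ht0.le]
  rw [h5, map_smul, hv, norm_smul, Real.norm_of_nonneg ht0.le, smul_smul]
  have h6 : s * (t * √(B p v v)) / (t * ‖y‖) * t = 1 := by
    rw [ht]
    field_simp
  rw [h6, one_smul]

lemma isCompact_unitDisc (p : M) :
    IsCompact {v : Euc n | signL (c.d p) (dchart (c.e p) p v) = -dchart (c.e p) p v ∧
      B p v v ≤ 1} := by
  have hcl : IsClosed {v : Euc n | signL (c.d p) (dchart (c.e p) p v) = -dchart (c.e p) p v ∧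
      B p v v ≤ 1} :=
    (isClosed_eq ((signL (c.d p)).continuous.comp (dchart (c.e p) p).continuous)
      (dchart (c.e p) p).continuous.neg).inter
      (isClosed_le ((B p).continuous.clm_apply continuous_id) continuous_const)
  refine Metric.isCompact_of_isClosed_isBounded hcl ?_
  -- The unit sphere is empty only for `n = 0`; otherwise the minimum of `B` on it bounds the disc.
  rcases (Metric.sphere (0 : Euc n) 1).eq_empty_or_nonempty with he | hne
  · refine (Metric.isBounded_closedBall (x := (0 : Euc n)) (r := 0)).subset fun v _ => ?_
    by_contra hv
    have hv0 : v ≠ 0 := fun h => hv (by simp [h])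
    have h1 : ‖v‖⁻¹ • v ∈ Metric.sphere (0 : Euc n) 1 := by
      rw [mem_sphere_zero_iff_norm, norm_smul, norm_inv, norm_norm,
        inv_mul_cancel₀ (norm_ne_zero_iff.2 hv0)]
    rw [he] at h1
    exact h1
  · obtain ⟨u, hu, hmin⟩ := (isCompact_sphere (0 : Euc n) 1).exists_isMinOn hne
      ((B p).continuous.clm_apply continuous_id).continuousOn
    have hu0 : u ≠ 0 := by
      rintro rfl
      simp at hu
    have hμ := hB.pos p u hu0
    refine (Metric.isBounded_closedBall (x := (0 : Euc n)) (r := √((B p u u)⁻¹))).subset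
      fun v hv => ?_
    rw [mem_closedBall_zero_iff]
    by_cases hv0 : v = 0
    · rw [hv0, norm_zero]
      positivity
    have hvn := norm_pos_iff.2 hv0
    have h1 : ‖v‖⁻¹ • v ∈ Metric.sphere (0 : Euc n) 1 := by
      rw [mem_sphere_zero_iff_norm, norm_smul, norm_inv, norm_norm, inv_mul_cancel₀ hvn.ne']
    have h2 : B p u u ≤ B p (‖v‖⁻¹ • v) (‖v‖⁻¹ • v) := hmin h1
    rw [form_smul] at h2
    refine Real.le_sqrt_of_sq_le ?_
    rw [← one_div, le_div_iff₀ hμ]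
    have h3 : ‖v‖ ^ 2 * B p u u ≤ ‖v‖ ^ 2 * (‖v‖⁻¹ * (‖v‖⁻¹ * B p v v)) := by gcongr
    have h4 : ‖v‖ ^ 2 * (‖v‖⁻¹ * (‖v‖⁻¹ * B p v v)) = B p v v := by field_simp
    rw [h4] at h3
    exact h3.trans hv.2

end MorseCharts

variable [CompactSpace M] [T2Space M] [Fintype G]

/-- The attaching theorem, given a description of the descending tangent spaces. -/
theorem exists_cellAttachment (hf : IsEquivariantMorse n G f) {g : SmoothMetric n M}
    (hg : IsInvariantMetric G g) {a b c : ℝ} (hac : a < c) (hcb : c < b)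
    (hcrit : criticalValues n f ∩ Icc a b = {c}) (m : LevelModel G f (metricForm g) a b c)
    (hT : ∀ p ∈ criticalPointsAt n f c, ∀ v : Euc n, v ∈ descendingTangentSpace g f p ↔
      signL (m.charts.d p) (dchart (m.charts.e p) p v) = -dchart (m.charts.e p) p v) :
    ∃ (φ : EquivariantMap G (descendingSpheres hf hg c) (sublevel hf a))
      (Φ : EquivariantMap G (CellAttachment hf hg a c φ) (sublevel hf b)),
      IsEquivariantHomotopyEquiv Φ ∧
      ∀ x : sublevel hf a, (Φ.toFun (Adjunction.base _ φ x) : M) = x := by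
  have hB := invariantForm_metricForm hg
  have hR := m.R_pos
  have hR2 := pow_pos hR 2
  have hRa := m.R_lt_left
  have hRb := m.R_lt_right
  -- The sublevel sets at `a` and `b` may be computed with `h` instead of `f`.
  have ha : ∀ x, f x ≤ a ↔ m.h x ≤ a := fun x => by
    rcases m.eq_or x with h | ⟨h1, -, h2, -⟩
    · rw [h]
    · exact ⟨fun h => absurd h (not_le.2 h1), fun h => absurd h (not_le.2 h2)⟩
  have hb : ∀ x, f x ≤ b ↔ m.h x ≤ b := fun x => by
    rcases m.eq_or x with h | ⟨-, h1, -, h2⟩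
    · rw [h]
    · exact ⟨fun _ => h2.le, fun _ => h1.le⟩
  have hfh : ∀ x, a ≤ m.h x → m.h x ≤ b → f x ∈ Icc a b := fun x h1 h2 => by
    rcases m.eq_or x with h | ⟨h3, h4, -⟩
    · rw [← h]
      exact ⟨h1, h2⟩
    · exact ⟨h3.le, h4.le⟩
  have hcp : ∀ x ∈ criticalPoints n f, a ≤ m.h x → m.h x ≤ b → m.rho x = 0 ∧ m.h x = c := by
    intro x hx h1 h2
    have h3 : f x ∈ criticalValues n f ∩ Icc a b := ⟨⟨x, hx, rfl⟩, hfh x h1 h2⟩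
    rw [hcrit] at h3
    have h4 := m.spec_of_mem_source (p := x) ⟨hx, h3⟩ (m.charts.mem_source x hx)
      (by rw [m.charts.apply_self x hx]; simp; positivity)
    rw [m.charts.apply_self x hx] at h4
    have h5 : m.rho x = 0 := by simpa using h4.1
    have h6 : m.pos x = 0 := by simpa [plusPart] using h4.2
    exact ⟨h5, by rw [m.h_eq, h5, h6]; ring⟩
  -- Matched so that `s ^ 2 = 2 * η`: on the disc of radius `s` one has `h = c - η * g(v, v)`, and
  -- its boundary is exactly where the disc meets `{h ≤ c - η}`.
  set η := m.R ^ 2 / 128 with hη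
  set s := m.R / 8 with hs
  have hs0 : 0 < s := by positivity
  -- the discs
  have hD : ∀ x ∈ descendingDiscs hf hg c, x.proj ∈ criticalPointsAt n f c ∧
      signL (m.charts.d x.proj) (dchart (m.charts.e x.proj) x.proj (vec x)) =
        -dchart (m.charts.e x.proj) x.proj (vec x) ∧ metricForm g x.proj (vec x) (vec x) ≤ 1 :=
    fun x hx => ⟨hx.1, (hT _ hx.1 _).1 hx.2.1, hx.2.2⟩
  let θ : descendingDiscs hf hg c → M := fun x => discMap m.charts s x.1.proj (vec x.1)
  have hN : ∀ x : descendingDiscs hf hg c,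
      s * √(metricForm g x.1.proj (vec x.1) (vec x.1)) ≤ s := fun x =>
    mul_le_of_le_one_right hs0.le (Real.sqrt_le_one.2 (hD x.1 x.2).2.2)
  have hθt : ∀ x : descendingDiscs hf hg c, (s * √(metricForm g x.1.proj (vec x.1) (vec x.1)) /
      ‖dchart (m.charts.e x.1.proj) x.1.proj (vec x.1)‖) •
        dchart (m.charts.e x.1.proj) x.1.proj (vec x.1) ∈ (m.charts.e x.1.proj).target := fun x => by
    rw [m.charts.target_eq _ (hD x.1 x.2).1.1, mem_ball_zero_iff,
      m.charts.norm_radial hB (hD x.1 x.2).1.1 hs0.le]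
    linarith [hN x]
  have hθs : ∀ x, θ x ∈ (m.charts.e x.1.proj).source := fun x =>
    (m.charts.e x.1.proj).map_target (hθt x)
  have hθe : ∀ x : descendingDiscs hf hg c, m.charts.e x.1.proj (θ x) =
      (s * √(metricForm g x.1.proj (vec x.1) (vec x.1)) /
        ‖dchart (m.charts.e x.1.proj) x.1.proj (vec x.1)‖) •
          dchart (m.charts.e x.1.proj) x.1.proj (vec x.1) := fun x =>
    (m.charts.e x.1.proj).right_inv (hθt x)
  have hg0 : ∀ x : descendingDiscs hf hg c, 0 ≤ metricForm g x.1.proj (vec x.1) (vec x.1) := fun x => by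
    by_cases h : vec x.1 = 0
    · rw [h]
      simp
    · exact (hB.pos _ _ h).le
  have hθρ : ∀ x, m.rho (θ x) = 2 * η * metricForm g x.1.proj (vec x.1) (vec x.1) ∧ m.pos (θ x) = 0 := by
    intro x
    have hx := hD x.1 x.2
    have h1 : ‖m.charts.e x.1.proj (θ x)‖ ^ 2 = 2 * η * metricForm g x.1.proj (vec x.1) (vec x.1) := by
      rw [hθe, m.charts.norm_radial hB hx.1.1 hs0.le, mul_pow, Real.sq_sqrt (hg0 x), hs, hη]
      ring
    have h2 := m.spec_of_mem_source hx.1 (hθs x) (by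
      rw [h1, hη]
      nlinarith [hx.2.2, hg0 x])
    refine ⟨h2.1.trans h1, ?_⟩
    rw [h2.2, hθe, sq_eq_zero_iff, norm_eq_zero, plusPart_eq_zero, map_smul, hx.2.1, smul_neg]
  have hθh : ∀ x, m.h (θ x) = c - η * metricForm g x.1.proj (vec x.1) (vec x.1) := fun x => by
    rw [m.h_eq, (hθρ x).1, (hθρ x).2]
    ring
  -- Conversely the disc contains every nearby point without positive part, since the radial map
  -- onto the negative coordinates is surjective.
  have hrange : ∀ x, m.rho x ≤ 2 * η → m.pos x = 0 → x ∈ range θ := by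
    intro x h1 h2
    obtain ⟨p, hp, hxp, h3, h4⟩ := m.exists_of_rho_lt (x := x) (by linarith)
    rw [h2, eq_comm, sq_eq_zero_iff, norm_eq_zero, plusPart_eq_zero] at h4
    obtain ⟨v, t, hv, hvy⟩ := m.charts.exists_radial_eq hB hp.1 hs0 (m.charts.e p x)
    have hvT : signL (m.charts.d p) (dchart (m.charts.e p) p v) = -dchart (m.charts.e p) p v := by
      rw [hv, map_smul, h4, smul_neg]
    have hv1 : metricForm g p v v ≤ 1 := by
      have h5 := congrArg norm hvy
      rw [m.charts.norm_radial hB hp.1 hs0.le] at h5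
      have h6 : √(metricForm g p v v) ≤ 1 := by
        have h7 : (s * √(metricForm g p v v)) ^ 2 ≤ s ^ 2 := by
          rw [h5, h3, hs]
          linarith
        have h8 := le_of_sq_le_sq h7 hs0.le
        nlinarith
      exact Real.sqrt_le_one.1 h6
    refine ⟨⟨⟨p, v⟩, hp, (hT p hp v).2 hvT, hv1⟩, ?_⟩
    exact (congrArg (m.charts.e p).symm hvy).trans ((m.charts.e p).left_inv hxp)
  have hfinC : (criticalPointsAt n f c).Finite :=
    (finite_criticalPoints hf).subset fun x hx => hx.1
  have hθc : Continuous θ := by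
    refine continuous_of_finite_fibers (F := discMap m.charts s) hfinC
      (fun x hx => (hD x hx).1) fun x hx => ?_
    exact ContinuousAt.comp (g := (m.charts.e x.proj).symm)
      ((m.charts.e x.proj).continuousAt_symm (hθt ⟨x, hx⟩))
      (m.charts.continuous_radial hB (hD x hx).1.1 hs0.le).continuousAt
  have hcompact : CompactSpace (descendingDiscs hf hg c) := by
    refine isCompact_iff_compactSpace.1 ?_
    have h1 : (descendingDiscs hf hg c : Set (TangentBundle (𝓡 n) M)) =
        ⋃ p ∈ criticalPointsAt n f c, (fun v : Euc n => (⟨p, v⟩ : TangentBundle (𝓡 n) M)) ''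
          {v : Euc n | signL (m.charts.d p) (dchart (m.charts.e p) p v) =
            -dchart (m.charts.e p) p v ∧ metricForm g p v v ≤ 1} := by
      ext x
      constructor
      · intro hx
        exact mem_biUnion (hD x hx).1 ⟨x.2, (hD x hx).2, rfl⟩
      · intro hx
        obtain ⟨p, hp, v, hv, rfl⟩ := mem_iUnion₂.1 hx
        exact ⟨hp, (hT p hp v).2 hv.1, hv.2⟩
    change IsCompact (descendingDiscs hf hg c : Set (TangentBundle (𝓡 n) M))
    rw [h1]
    exact hfinC.isCompact_biUnion fun p _ => (m.charts.isCompact_unitDisc hB p).image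
      (FiberBundle.continuous_totalSpaceMk (Euc n) (TangentSpace (𝓡 n) : M → Type _) p)
  have hinj : Function.Injective θ := by
    rintro ⟨⟨p, v⟩, hx⟩ ⟨⟨q, w⟩, hy⟩ hxy
    have h1 : p = q := by
      refine m.charts.eq_of_mem_source (hD _ hx).1.1 (hD _ hy).1.1 (hθs ⟨_, hx⟩) ?_
      rw [hxy]
      exact hθs ⟨_, hy⟩
    subst h1
    have h2 : v = w := by
      refine m.charts.radial_injective hB (hD _ hx).1.1 hs0 ?_
      have h3 := hθe ⟨_, hx⟩
      rw [hxy] at h3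
      exact h3.symm.trans (hθe ⟨_, hy⟩)
    subst h2
    rfl
  have hθG : ∀ (σ : G) x, θ (σ • x) = σ • θ x := fun σ x =>
    m.charts.discMap_smul hB hf hs0.le σ (hD x.1 x.2).1.1
      ((hN x).trans_lt (by linarith))
  -- the flow
  have hLt : ∀ r t, 0 ≤ t → ∀ x ∈ {x | m.h x ≤ r}, m.Φ t x ∈ {x | m.h x ≤ r} :=
    fun r t ht x hx => (m.h_flow_le ht x).trans hx
  obtain ⟨T₁, hT₁, hLA⟩ : ∃ T, 0 ≤ T ∧ ∀ x ∈ {x | m.h x ≤ c - η}, m.Φ T x ∈ {x | m.h x ≤ a} := by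
    refine exists_time_of_deriv_neg m.flow.add m.flow.zero m.smooth.continuous
      (continuous_dfun_field m.smooth m.smooth_field) (m.flow.hasDerivAt_comp m.smooth)
      (hLt _) (hLt _) (K := m.h ⁻¹' Icc a (c - η)) (isClosed_Icc.preimage m.smooth.continuous)
      (fun x hx => ?_) fun x hx => m.neg x fun hxC => ?_
    · by_cases h : m.h x ≤ a
      · exact Or.inl h
      · exact Or.inr ⟨(not_le.1 h).le, hx⟩
    · have h1 := (hcp x hxC hx.1 (by linarith [hx.2])).2
      linarith [hx.2]
  -- The critical points between the levels have `rho = 0`, so `h` decreases strictly where `rho ≥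
  -- R² / 64`. Where `rho` is smaller, `pos ≤ rho` puts the point in the target region.
  obtain ⟨T₂, hT₂, hYZ⟩ : ∃ T, 0 ≤ T ∧ ∀ x ∈ {x | m.h x ≤ b}, m.Φ T x ∈ {x | m.h x ≤ c - η ∨
      (m.rho x < m.R ^ 2 / 16 ∧ m.pos x ≤ m.R ^ 2 / 64)} := by
    refine exists_time_of_deriv_neg m.flow.add m.flow.zero m.smooth.continuous
      (continuous_dfun_field m.smooth m.smooth_field) (m.flow.hasDerivAt_comp m.smooth)
      (hLt _) (fun t ht x hx => ?_)
      (K := m.h ⁻¹' Icc (c - η) b ∩ m.rho ⁻¹' Ici (m.R ^ 2 / 64))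
      ((isClosed_Icc.preimage m.smooth.continuous).inter
        (isClosed_Ici.preimage (m.continuous_rho hf)))
      (fun x hx => ?_) fun x hx => m.neg x fun hxC => ?_
    · rcases hx with hx | ⟨hx1, hx2⟩
      · exact Or.inl (hLt _ t ht x hx)
      · exact m.stays_low_or_near hf hx1 hx2 ht
    · by_cases h : m.h x ≤ c - η
      · exact Or.inl (Or.inl h)
      by_cases h2 : m.rho x < m.R ^ 2 / 64
      · refine Or.inl (Or.inr ⟨by linarith, ?_⟩)
        obtain ⟨p, hp, hxp, h3, h4⟩ := m.exists_of_rho_lt (x := x) (by linarith)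
        have h5 := abs_le.1 (abs_inner_signL_le (m.charts.d_ne p hp.1) (m.charts.e p x))
        rw [h4, norm_plusPart_sq (m.charts.d_ne p hp.1)]
        linarith [h5.2]
      · exact Or.inr ⟨⟨(not_le.1 h).le, hx⟩, not_lt.1 h2⟩
    · have h1 := (hcp x hxC (by linarith [hx.1.1]) hx.1.2).1
      have h2 : m.R ^ 2 / 64 ≤ m.rho x := hx.2
      linarith
  set T := max T₁ T₂ with hTdef
  have hT0 : 0 ≤ T := hT₁.trans (le_max_left _ _)
  have hLA' : ∀ x ∈ {x | m.h x ≤ c - η}, m.h (m.Φ T x) ≤ a := fun x hx => by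
    have h1 := hLt a (T - T₁) (sub_nonneg.2 (le_max_left _ _)) _ (hLA x hx)
    rwa [← m.flow.add, sub_add_cancel] at h1
  have hYZ' : ∀ x ∈ {x | m.h x ≤ b}, m.h (m.Φ T x) ≤ c - η ∨
      (m.rho (m.Φ T x) < m.R ^ 2 / 16 ∧ m.pos (m.Φ T x) ≤ m.R ^ 2 / 64) := fun x hx => by
    have h1 := hYZ (m.Φ (T - T₂) x) (hLt b (T - T₂) (sub_nonneg.2 (le_max_right _ _)) _ hx)
    rwa [← m.flow.add, add_sub_cancel] at h1
  have hin : ∀ x, (inclusionMap (descendingSpheres_subset hf hg c)).toFun x =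
      ⟨x.1, descendingSpheres_subset hf hg c x.2⟩ := fun x => rfl
  refine exists_attachingMap_of_flow (inclusionMap (descendingSpheres_subset hf hg c))
    (L := {x | m.h x ≤ c - η}) (isClosed_le m.smooth.continuous continuous_const)
    m.flow.continuous m.flow.zero m.flow.add m.flow_smul hT0 hθc hinj hθG
    (fun σ x hx => (m.invariant σ x).trans_le hx) (fun x hx => ?_) (fun x hx => ?_)
    (fun t ht x hx => ?_) (hLt _) (fun t ht x hx => ?_) (fun x hx => (ha _).2 (hLA' x hx))
    (fun x => ?_) (fun x => ?_) (fun t ht x => ?_) (m.continuous_collapse hf)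
    (fun x => m.collapse_of_amount_eq_zero (m.amount_zero x)) (m.collapse_smul hf)
    (fun t _ x hx => (hb _).2 ((m.h_collapse_le t x).trans ((hb x).1 hx))) (fun x hx => ?_)
    (fun x hx => ?_) fun t ht x => ?_
  · have h1 : m.h x ≤ a := (ha x).1 hx
    exact h1.trans (by linarith)
  · have h1 : m.h x ≤ c - η := hx
    exact (hb x).2 (by linarith)
  · exact (ha _).2 (hLt a t ht x ((ha x).1 hx))
  · exact (hb _).2 (hLt b t ht x ((hb x).1 hx))
  · refine (hb _).2 ?_
    rw [hθh]
    nlinarith [hg0 x]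
  · constructor
    · intro hx
      have h1 : m.h (θ x) ≤ c - η := hx
      rw [hθh] at h1
      have h2 : metricForm g x.1.proj (vec x.1) (vec x.1) = 1 :=
        le_antisymm (hD x.1 x.2).2.2 (by nlinarith)
      exact ⟨⟨x.1, x.2.1, x.2.2.1, h2⟩, rfl⟩
    · rintro ⟨y, rfl⟩
      change m.h (θ _) ≤ c - η
      rw [hθh]
      have h2 : metricForm g y.1.proj (vec y.1) (vec y.1) = 1 := y.2.2.2
      rw [hin]
      simp only
      rw [h2, mul_one]
  · rcases m.stays_low_or_descending hf (s := η) (by linarith) (x := θ x)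
      (by rw [(hθρ x).1]; nlinarith [(hD x.1 x.2).2.2]) (hθρ x).2.le ht with h | ⟨h1, h2⟩
    · exact Or.inl h
    · exact Or.inr (hrange _ h1 h2)
  -- A point that is not low after the flow lies in the zone of complete collapse. Its positive part
  -- becomes zero, and it is then either low or within radius `s`.
  · by_cases hL : m.h (m.Φ T x) ≤ c - η
    · exact Or.inl ((m.h_collapse_le 1 _).trans hL)
    obtain ⟨h1, h2⟩ := (hYZ' x ((hb x).1 hx)).resolve_left hL
    have h3 := m.amount_one (x := m.Φ T x) (by linarith [not_le.1 hL]) (by linarith)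
    obtain ⟨h4, h5⟩ := m.collapse_spec (x := m.Φ T x) (by linarith) 1
    rw [h3] at h4 h5
    by_cases hL2 : m.h (m.collapse 1 (m.Φ T x)) ≤ c - η
    · exact Or.inl hL2
    · refine Or.inr (hrange _ ?_ (by rw [h4]; ring))
      rw [m.h_eq, h4] at hL2
      linarith
  · refine m.collapse_of_amount_eq_zero (m.amount_of_le ?_ 1)
    have h1 : m.h x ≤ a := (ha x).1 hx
    linarith
  -- The value `2 * η` is the height below which the collapse is trivial; above it the orbit has no
  -- positive part to be collapsed.
  · rcases m.stays_low_or_descending hf (s := 2 * η) (by linarith) (x := θ x)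
      (by rw [(hθρ x).1]; nlinarith [(hD x.1 x.2).2.2]) (hθρ x).2.le ht with h | ⟨h1, h2⟩
    · exact m.collapse_of_amount_eq_zero (m.amount_of_le (by linarith) 1)
    · exact m.collapse_of_pos_eq_zero (by linarith) h2 1

end DescendingDisc

end EquivariantMorse

namespace EquivariantMorse

/-! ### Solutions emanating from a hyperbolic equilibrium -/

section BackwardSolutions

open Set Filter MeasureTheory
open scoped BoundedContinuousFunction

/-- The solution of `x' = a x + h` which is bounded at `-∞`, with value `u` at `0` if `0 < a`. -/
noncomputable def boundedSolution (a : ℝ) (h : ℝ → ℝ) (u t : ℝ) : ℝ :=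
  Real.exp (a * t) * ((if 0 < a then u else ∫ s in Iic (0 : ℝ), Real.exp (-a * s) * h s) +
    ∫ s in (0 : ℝ)..t, Real.exp (-a * s) * h s)

variable {a : ℝ} {h h' : ℝ → ℝ} {K : ℝ}

lemma boundedSolution_zero (ha : 0 < a) (u : ℝ) : boundedSolution a h u 0 = u := by
  simp [boundedSolution, ha]

lemma continuous_exp_mul (hc : Continuous h) : Continuous fun s => Real.exp (-a * s) * h s := by
  fun_prop

lemma hasDerivAt_boundedSolution (hc : Continuous h) (u t : ℝ) :
    HasDerivAt (boundedSolution a h u) (a * boundedSolution a h u t + h t) t := by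
  have h1 := (continuous_exp_mul (a := a) hc).integral_hasStrictDerivAt 0 t
  have h2 : HasDerivAt (fun t : ℝ => Real.exp (a * t)) (Real.exp (a * t) * a) t := by
    simpa using ((hasDerivAt_id t).const_mul a).exp
  refine (h2.mul (h1.hasDerivAt.const_add
    (if 0 < a then u else ∫ s in Iic (0 : ℝ), Real.exp (-a * s) * h s))).congr_deriv ?_
  have h3 : Real.exp (a * t) * Real.exp (-a * t) = 1 := by
    rw [← Real.exp_add]
    simp
  rw [boundedSolution, ← mul_assoc (Real.exp (a * t)) (Real.exp (-a * t)), h3]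
  ring

lemma integrableOn_exp_mul (ha : a < 0) (hc : Continuous h) (hK : ∀ s, |h s| ≤ K) (t : ℝ) :
    IntegrableOn (fun s => Real.exp (-a * s) * h s) (Iic t) := by
  refine Integrable.mono' ((integrableOn_exp_mul_Iic (neg_pos.2 ha) t).const_mul K)
    (continuous_exp_mul hc).aestronglyMeasurable (Eventually.of_forall fun s => ?_)
  rw [norm_mul, Real.norm_of_nonneg (Real.exp_pos _).le, mul_comm K]
  exact mul_le_mul_of_nonneg_left (hK s) (Real.exp_pos _).le

/-- In a stable direction boundedness at `-∞` leaves no freedom: the initial value must be the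
integral from `-∞`. -/
lemma boundedSolution_of_neg (ha : a < 0) (hc : Continuous h) (hK : ∀ s, |h s| ≤ K) (u t : ℝ) :
    boundedSolution a h u t = Real.exp (a * t) * ∫ s in Iic t, Real.exp (-a * s) * h s := by
  rw [boundedSolution, if_neg (not_lt.2 ha.le), ← intervalIntegral.integral_Iic_sub_Iic
    (integrableOn_exp_mul ha hc hK _) (integrableOn_exp_mul ha hc hK _), add_sub_cancel]

/-- In either case the forcing is integrated against an exponential of total mass at most `1 / |a|`;
for `a < 0` the value `u` does not enter. -/
lemma abs_boundedSolution_le (ha : a ≠ 0) (hc : Continuous h) (hK : ∀ s, |h s| ≤ K) (u : ℝ)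
    {t : ℝ} (ht : t ≤ 0) : |boundedSolution a h u t| ≤ |u| + K / |a| := by
  have hK0 : 0 ≤ K := (abs_nonneg _).trans (hK 0)
  have hle : ∀ s, ‖Real.exp (-a * s) * h s‖ ≤ K * Real.exp (-a * s) := fun s => by
    rw [norm_mul, Real.norm_of_nonneg (Real.exp_pos _).le, mul_comm K]
    exact mul_le_mul_of_nonneg_left (hK s) (Real.exp_pos _).le
  have h3 : Real.exp (a * t) * Real.exp (-a * t) = 1 := by
    rw [← Real.exp_add]
    simp
  rcases lt_or_gt_of_ne ha with ha | ha
  · rw [boundedSolution_of_neg ha hc hK, abs_mul, Real.abs_exp, abs_of_neg ha]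
    have h1 := norm_integral_le_of_norm_le ((integrableOn_exp_mul_Iic (neg_pos.2 ha) t).const_mul K)
      (Eventually.of_forall hle)
    rw [integral_const_mul, integral_exp_mul_Iic (neg_pos.2 ha), Real.norm_eq_abs] at h1
    have h2 := mul_le_mul_of_nonneg_left h1 (Real.exp_pos (a * t)).le
    have h4 : Real.exp (a * t) * (K * (Real.exp (-a * t) / -a)) =
        (Real.exp (a * t) * Real.exp (-a * t)) * (K / -a) := by ring
    rw [h4, h3, one_mul] at h2
    exact h2.trans (le_add_of_nonneg_left (abs_nonneg u))
  · have h0 : Real.exp (a * t) ≤ 1 := Real.exp_le_one_iff.2 (mul_nonpos_of_nonneg_of_nonpos ha.le ht)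
    have h1 := intervalIntegral.norm_integral_le_of_norm_le (μ := volume) ht
      (Eventually.of_forall fun s _ => hle s)
      (Continuous.intervalIntegrable (by fun_prop) _ _)
    have h5 : ∫ s in t..0, K * Real.exp (-a * s) = K / a * (Real.exp (-a * t) - 1) := by
      have := intervalIntegral.integral_eq_sub_of_hasDerivAt (a := t) (b := 0)
        (f := fun s => -(K / a) * Real.exp (-a * s)) (f' := fun s => K * Real.exp (-a * s))
        (fun s _ => by
          refine ((((hasDerivAt_id s).const_mul (-a)).exp).const_mul (-(K / a))).congr_deriv ?_
          simp only [id]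
          field_simp) (Continuous.intervalIntegrable (by fun_prop) _ _)
      rw [this]
      simp
      ring
    rw [h5] at h1
    rw [boundedSolution, if_pos ha, abs_of_pos ha, intervalIntegral.integral_symm, abs_mul,
      Real.abs_exp]
    have h6 : |u + -∫ s in t..0, Real.exp (-a * s) * h s| ≤
        |u| + K / a * (Real.exp (-a * t) - 1) := by
      refine (abs_add_le _ _).trans ?_
      rw [abs_neg]
      exact add_le_add le_rfl h1
    refine (mul_le_mul_of_nonneg_left h6 (Real.exp_pos _).le).trans ?_
    have h7 : Real.exp (a * t) * (|u| + K / a * (Real.exp (-a * t) - 1)) =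
        Real.exp (a * t) * |u| + K / a * (Real.exp (a * t) * Real.exp (-a * t)) -
          K / a * Real.exp (a * t) := by ring
    rw [h7, h3]
    have h8 : 0 ≤ K / a * Real.exp (a * t) := by positivity
    have h9 := mul_le_of_le_one_left (abs_nonneg u) h0
    linarith

lemma boundedSolution_sub (hc : Continuous h) (hK : ∀ s, |h s| ≤ K) (hc' : Continuous h')
    {K' : ℝ} (hK' : ∀ s, |h' s| ≤ K') (ha : a ≠ 0) (u t : ℝ) :
    boundedSolution a h u t - boundedSolution a h' u t =
      boundedSolution a (fun s => h s - h' s) 0 t := by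
  have h1 : (fun s => Real.exp (-a * s) * (h s - h' s)) =
      fun s => Real.exp (-a * s) * h s - Real.exp (-a * s) * h' s := funext fun s => by ring
  have h2 := intervalIntegral.integral_sub (μ := volume)
    ((continuous_exp_mul (a := a) hc).intervalIntegrable 0 t)
    ((continuous_exp_mul (a := a) hc').intervalIntegrable 0 t)
  rcases lt_or_gt_of_ne ha with ha | ha
  · have h3 := integral_sub (integrableOn_exp_mul ha hc hK 0) (integrableOn_exp_mul ha hc' hK' 0)
    simp only [boundedSolution, if_neg (not_lt.2 ha.le), h1]
    rw [h2, h3]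
    ring
  · simp only [boundedSolution, if_pos ha, h1]
    rw [h2]
    ring

/-- Solutions of `x' = Λ x + N x` which emanate from the equilibrium `0`, with prescribed unstable
component at time `0`; here `Λ` is diagonal and hyperbolic and `N` vanishes to first order. -/
theorem exists_backward_solution {ι : Type*} [Fintype ι] {lam : ι → ℝ} (hlam : ∀ i, lam i ≠ 0)
    {N : (ι → ℝ) → ι → ℝ} (hN0 : N 0 = 0)
    (hN : HasStrictFDerivAt N (0 : (ι → ℝ) →L[ℝ] ι → ℝ) 0) {r : ℝ} (hr : 0 < r) :
    ∃ δ > 0, ∀ u : ι → ℝ, ‖u‖ ≤ δ → ∃ x : ℝ → ι → ℝ, Continuous x ∧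
      (∀ t < 0, HasDerivAt x (fun i => lam i * x t i + N (x t) i) t) ∧ (∀ t ≤ 0, ‖x t‖ ≤ r) ∧
      Tendsto x atBot (𝓝 0) ∧ ∀ i, 0 < lam i → x 0 i = u i := by
  classical
  -- The solution is sought as `exp (ν t) • z` with `z` bounded, which forces decay at `-∞`. Taking
  -- `ν` below all positive rates keeps the signs of the shifted rates `lam i - ν`.
  obtain ⟨ν, hν, hνlam⟩ : ∃ ν > 0, ∀ i, 0 < lam i → ν < lam i := by
    have h1 : ∀ᶠ ν in 𝓝[>] (0 : ℝ), ∀ i, 0 < lam i → ν < lam i := by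
      refine eventually_all.2 fun i => ?_
      by_cases hi : 0 < lam i
      · filter_upwards [Ioo_mem_nhdsGT hi] with ν hν _ using hν.2
      · exact Eventually.of_forall fun ν h => absurd h hi
    obtain ⟨ν, h2, h3⟩ := (h1.and self_mem_nhdsWithin).exists
    exact ⟨ν, h3, h2⟩
  have hmu : ∀ i, lam i - ν ≠ 0 := fun i => by
    rcases lt_or_gt_of_ne (hlam i) with h | h
    · exact (by linarith : lam i - ν < 0).ne
    · exact (sub_pos.2 (hνlam i h)).ne'
  obtain ⟨m, hm, hmmu⟩ : ∃ m > 0, ∀ i, m ≤ |lam i - ν| := by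
    have h1 : ∀ᶠ m in 𝓝[>] (0 : ℝ), ∀ i, m ≤ |lam i - ν| := by
      refine eventually_all.2 fun i => ?_
      filter_upwards [Ioo_mem_nhdsGT (abs_pos.2 (hmu i))] with m hm using hm.2.le
    obtain ⟨m, h2, h3⟩ := (h1.and self_mem_nhdsWithin).exists
    exact ⟨m, h3, h2⟩
  -- Half the spectral gap `m`, so that the integral operator has contraction ratio `1 / 2`.
  set η : NNReal := ⟨m / 2, by positivity⟩ with hη
  have hηm : (η : ℝ) = m / 2 := rfl
  obtain ⟨s, hs, hLip⟩ := hN.exists_lipschitzOnWith_of_nnnorm_lt η (by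
    rw [nnnorm_zero]
    exact NNReal.coe_pos.1 (by rw [hηm]; positivity))
  obtain ⟨r₀, hr₀, hr₀s⟩ := Metric.nhds_basis_closedBall.mem_iff.1 hs
  set ρ := min r r₀ with hρ
  have hρ0 : 0 < ρ := lt_min hr hr₀
  -- truncation
  let cl : (ι → ℝ) → ι → ℝ := fun y i => max (-ρ) (min ρ (y i))
  have hcl1 : ∀ y, ‖cl y‖ ≤ ρ := fun y => (pi_norm_le_iff_of_nonneg hρ0.le).2 fun i =>
    abs_le.2 ⟨le_max_left _ _, max_le (by linarith) (min_le_left _ _)⟩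
  have hcl2 : ∀ y, ‖y‖ ≤ ρ → cl y = y := fun y hy => funext fun i => by
    have h1 := abs_le.1 ((norm_le_pi_norm y i).trans hy)
    simp only [cl]
    rw [min_eq_right h1.2, max_eq_right h1.1]
  have hcl3 : ∀ y z, ‖cl y - cl z‖ ≤ ‖y - z‖ := fun y z =>
    (pi_norm_le_iff_of_nonneg (norm_nonneg _)).2 fun i => by
      refine le_trans ?_ (norm_le_pi_norm (y - z) i)
      refine (abs_max_sub_max_le_max (-ρ) (min ρ (y i)) (-ρ) (min ρ (z i))).trans ?_
      rw [sub_self, abs_zero, max_eq_right (abs_nonneg _)]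
      refine (abs_min_sub_min_le_max ρ (y i) ρ (z i)).trans ?_
      rw [sub_self, abs_zero, max_eq_right (abs_nonneg _)]
      rfl
  have hNcl : ∀ y z, ‖N (cl y) - N (cl z)‖ ≤ η * ‖y - z‖ := fun y z => by
    refine (hLip.norm_sub_le (hr₀s ?_) (hr₀s ?_)).trans
      (mul_le_mul_of_nonneg_left (hcl3 y z) η.2) <;>
    exact mem_closedBall_zero_iff.2 ((hcl1 _).trans (min_le_right _ _))
  have hNc : Continuous fun y => N (cl y) := by
    refine (LipschitzWith.of_dist_le_mul (K := η) fun y z => ?_).continuous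
    rw [dist_eq_norm, dist_eq_norm]
    exact hNcl y z
  have hcl0 : cl 0 = 0 := hcl2 0 (by simpa using hρ0.le)
  -- The equation for `z` has this nonlinearity; the two exponential factors cancel, leaving a
  -- Lipschitz constant independent of time.
  let Nt : ℝ → (ι → ℝ) → ι → ℝ := fun t z => Real.exp (-ν * t) • N (cl (Real.exp (ν * t) • z))
  have hexp : ∀ t, Real.exp (-ν * t) * Real.exp (ν * t) = 1 := fun t => by
    rw [← Real.exp_add]
    simp
  have hNt : ∀ t y z, ‖Nt t y - Nt t z‖ ≤ η * ‖y - z‖ := fun t y z => by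
    simp only [Nt]
    rw [← smul_sub, norm_smul, Real.norm_of_nonneg (Real.exp_pos _).le]
    have h1 := hNcl (Real.exp (ν * t) • y) (Real.exp (ν * t) • z)
    rw [← smul_sub, norm_smul, Real.norm_of_nonneg (Real.exp_pos _).le] at h1
    refine (mul_le_mul_of_nonneg_left h1 (Real.exp_pos (-ν * t)).le).trans_eq ?_
    calc _ = Real.exp (-ν * t) * Real.exp (ν * t) * (η * ‖y - z‖) := by ring
      _ = _ := by rw [hexp, one_mul]
  have hNt0 : ∀ t, Nt t 0 = 0 := fun t => by
    simp only [Nt, smul_zero, hcl0, hN0]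
  let H : (ℝ →ᵇ (ι → ℝ)) → ι → ℝ → ℝ := fun z i t => Nt t (z t) i
  have hHc : ∀ z i, Continuous (H z i) := fun z i => by
    have h1 : Continuous fun t => Nt t (z t) :=
      (by fun_prop : Continuous fun t : ℝ => Real.exp (-ν * t)).smul
        (hNc.comp ((by fun_prop : Continuous fun t : ℝ => Real.exp (ν * t)).smul z.continuous))
    exact (continuous_apply i).comp h1
  have hHd : ∀ z z' i t, |H z i t - H z' i t| ≤ η * dist z z' := fun z z' i t => by
    refine (norm_le_pi_norm (Nt t (z t) - Nt t (z' t)) i).trans ((hNt t _ _).trans ?_)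
    rw [← dist_eq_norm]
    exact mul_le_mul_of_nonneg_left (BoundedContinuousFunction.dist_coe_le_dist t) η.2
  have hH0 : ∀ i t, H 0 i t = 0 := fun i t => congrFun (hNt0 t) i
  have hHb : ∀ z i t, |H z i t| ≤ η * ‖z‖ := fun z i t => by
    have h1 := hHd z 0 i t
    rwa [hH0, sub_zero, dist_zero_right] at h1
  have hdiv : ∀ i, ∀ b : ℝ, 0 ≤ b → η * b / |lam i - ν| ≤ b / 2 := fun i b hb => by
    rw [div_le_iff₀ (abs_pos.2 (hmu i)), hηm]
    nlinarith [hmmu i]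
  -- Only `t ≤ 0` matters; `min t 0` extends the functions by a constant, to work with bounded
  -- continuous functions on all of `ℝ`.
  let Tf : (ι → ℝ) → (ℝ →ᵇ (ι → ℝ)) → ℝ → ι → ℝ := fun u z t i =>
    boundedSolution (lam i - ν) (H z i) (u i) (min t 0)
  have hTb : ∀ u z t, ‖Tf u z t‖ ≤ ‖u‖ + ‖z‖ / 2 := fun u z t =>
    (pi_norm_le_iff_of_nonneg (by positivity)).2 fun i =>
      (abs_boundedSolution_le (hmu i) (hHc z i) (hHb z i) (u i) (min_le_right t 0)).trans
        (add_le_add (norm_le_pi_norm u i) (hdiv i _ (norm_nonneg z)))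
  have hTc : ∀ u z, Continuous (Tf u z) := fun u z => continuous_pi fun i =>
    (continuous_iff_continuousAt.2 fun t =>
      (hasDerivAt_boundedSolution (a := lam i - ν) (hHc z i) (u i) t).continuousAt).comp
      (continuous_id.min continuous_const)
  let T : (ι → ℝ) → (ℝ →ᵇ (ι → ℝ)) → (ℝ →ᵇ (ι → ℝ)) := fun u z =>
    BoundedContinuousFunction.ofNormedAddCommGroup (Tf u z) (hTc u z) _ (hTb u z)
  have hT : ∀ u, ContractingWith (1 / 2) (T u) := fun u => by
    refine ⟨by norm_num, LipschitzWith.of_dist_le_mul fun z z' => ?_⟩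
    refine (BoundedContinuousFunction.dist_le (by positivity)).2 fun t => ?_
    refine (dist_pi_le_iff (by positivity)).2 fun i => ?_
    rw [Real.dist_eq]
    change |boundedSolution (lam i - ν) (H z i) (u i) (min t 0) -
      boundedSolution (lam i - ν) (H z' i) (u i) (min t 0)| ≤ _
    rw [boundedSolution_sub (hHc z i) (hHb z i) (hHc z' i) (hHb z' i) (hmu i)]
    refine (abs_boundedSolution_le (hmu i) ((hHc z i).sub (hHc z' i)) (hHd z z' i) 0
      (min_le_right t 0)).trans ?_
    rw [abs_zero, zero_add]
    refine (hdiv i _ dist_nonneg).trans_eq ?_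
    push_cast
    ring
  -- The fixed point satisfies `‖z‖ ≤ ‖u‖ + ‖z‖ / 2`, hence `‖z‖ ≤ ρ`, and the truncation is
  -- inactive for `t ≤ 0`.
  refine ⟨ρ / 2, by positivity, fun u hu => ?_⟩
  obtain ⟨z, hz⟩ : ∃ z, T u z = z := ⟨_, (hT u).fixedPoint_isFixedPt⟩
  have hzt : ∀ t i, z t i = boundedSolution (lam i - ν) (H z i) (u i) (min t 0) := fun t i => by
    conv_lhs => rw [← hz]
    rfl
  have hzn : ‖z‖ ≤ ρ := by
    have h1 : ‖z‖ ≤ ‖u‖ + ‖z‖ / 2 := by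
      conv_lhs => rw [← hz]
      exact BoundedContinuousFunction.norm_ofNormedAddCommGroup_le _ (by positivity) (hTb u z)
    linarith
  have hxn : ∀ t, ‖Real.exp (ν * t) • z t‖ ≤ Real.exp (ν * t) * ρ := fun t => by
    rw [norm_smul, Real.norm_of_nonneg (Real.exp_pos _).le]
    exact mul_le_mul_of_nonneg_left ((z.norm_coe_le_norm t).trans hzn) (Real.exp_pos _).le
  have hxρ : ∀ t ≤ 0, ‖Real.exp (ν * t) • z t‖ ≤ ρ := fun t ht =>
    (hxn t).trans (mul_le_of_le_one_left hρ0.le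
      (Real.exp_le_one_iff.2 (mul_nonpos_of_nonneg_of_nonpos hν.le ht)))
  refine ⟨fun t => Real.exp (ν * t) • z t,
    (by fun_prop : Continuous fun t : ℝ => Real.exp (ν * t)).smul z.continuous, fun t ht => ?_,
    fun t ht => (hxρ t ht).trans (min_le_left _ _), ?_, fun i hi => ?_⟩
  · refine hasDerivAt_pi.2 fun i => ?_
    have h1 : HasDerivAt (fun t => z t i) ((lam i - ν) * z t i + H z i t) t := by
      have h2 := hasDerivAt_boundedSolution (a := lam i - ν) (hHc z i) (u i) t
      have h3 : z t i = boundedSolution (lam i - ν) (H z i) (u i) t := by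
        rw [hzt, min_eq_left ht.le]
      rw [← h3] at h2
      refine h2.congr_of_eventuallyEq ?_
      filter_upwards [Iio_mem_nhds ht] with s hs
      rw [hzt, min_eq_left (le_of_lt hs)]
    have h4 : HasDerivAt (fun t : ℝ => Real.exp (ν * t)) (Real.exp (ν * t) * ν) t := by
      simpa using ((hasDerivAt_id t).const_mul ν).exp
    refine (h4.mul h1).congr_deriv ?_
    have h5 : Real.exp (ν * t) * H z i t = N (Real.exp (ν * t) • z t) i := by
      simp only [H, Nt]
      rw [hcl2 _ (hxρ t ht.le), Pi.smul_apply, smul_eq_mul, ← mul_assoc, mul_comm (Real.exp _),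
        hexp, one_mul]
    rw [← h5]
    simp only [Pi.smul_apply, smul_eq_mul]
    ring
  · refine squeeze_zero_norm hxn ?_
    have h1 : Tendsto (fun t => Real.exp (ν * t)) atBot (𝓝 0) :=
      Real.tendsto_exp_atBot.comp (tendsto_id.const_mul_atBot hν)
    simpa using h1.mul_const ρ
  · simp only [mul_zero, Real.exp_zero, one_smul]
    rw [hzt, min_self, boundedSolution_zero (sub_pos.2 (hνlam i hi))]

end BackwardSolutions

end EquivariantMorse

namespace EquivariantMorse

/-! ### The negative gradient field -/

section Gradient

open Set Filter
open scoped RealInnerProductSpace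

variable {n : ℕ} {M : Type*} [TopologicalSpace M] [ChartedSpace (Euc n) M]
  [IsManifold (𝓡 n) ∞ M] (g : SmoothMetric n M) {f : M → ℝ}

/-- The expression of the metric in a chart. -/
noncomputable def formInChart (e : OpenPartialHomeomorph M (Euc n)) (y : Euc n) :
    Euc n →L[ℝ] Euc n →L[ℝ] ℝ :=
  (metricForm g (e.symm y)).bilinearComp (dchartSymm e y) (dchartSymm e y)

lemma contMDiffOn_metric_apply {X Y : (x : M) → TangentSpace (𝓡 n) x} {s : Set M}
    (hX : ContMDiffOn (𝓡 n) (𝓡 n).tangent ∞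
      (fun x => (⟨x, X x⟩ : TangentBundle (𝓡 n) M)) s)
    (hY : ContMDiffOn (𝓡 n) (𝓡 n).tangent ∞
      (fun x => (⟨x, Y x⟩ : TangentBundle (𝓡 n) M)) s) :
    ContMDiffOn (𝓡 n) 𝓘(ℝ, ℝ) ∞ (fun x => g.inner x (X x) (Y x)) s := by
  intro x hx
  have : ContMDiffWithinAt (𝓡 n) ((𝓡 n).prod 𝓘(ℝ)) ∞
      (fun m ↦ Bundle.TotalSpace.mk' ℝ (E := Bundle.Trivial M ℝ) m (g.inner m (X m) (Y m)))
      s x := by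
    apply ContMDiffWithinAt.clm_bundle_apply₂ (F₁ := Euc n) (F₂ := Euc n)
    · exact g.contMDiff.contMDiffAt.contMDiffWithinAt
    · exact hX x hx
    · exact hY x hx
  simp only [Bundle.contMDiffWithinAt_totalSpace] at this
  exact this.2

variable {e : OpenPartialHomeomorph M (Euc n)} (he : e ∈ IsManifold.maximalAtlas (𝓡 n) ∞ M)

include he

lemma dchartSymm_dchart {x : M} (hx : x ∈ e.source) (v : Euc n) :
    dchartSymm e (e x) (dchart e x v) = v :=
  mfderiv_chart_symm_chart he hx v

lemma dchart_dchartSymm {y : Euc n} (hy : y ∈ e.target) (v : Euc n) :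
    dchart e (e.symm y) (dchartSymm e y v) = v :=
  mfderiv_chart_chart_symm he hy v

lemma contDiffOn_formInChart : ContDiffOn ℝ ∞ (formInChart g e) e.target := by
  refine contDiffOn_clm_apply.2 fun v => contDiffOn_clm_apply.2 fun w => ?_
  have h1 := contMDiffOn_metric_apply g
    (contMDiffOn_fieldOfChart he (W := fun _ => v) contDiffOn_const)
    (contMDiffOn_fieldOfChart he (W := fun _ => w) contDiffOn_const)
  refine (contMDiffOn_iff_contDiffOn.1 (h1.comp (contMDiffOn_symm_of_mem_maximalAtlas he)
    fun y hy => e.map_target hy)).congr fun y hy => ?_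
  have h2 : ∀ u : Euc n, dchartSymm e y u = fieldOfChart e (fun _ => u) (e.symm y) := fun u => by
    rw [fieldOfChart_eq he (e.map_target hy), e.right_inv hy]
    rfl
  change metricForm g (e.symm y) (dchartSymm e y v) (dchartSymm e y w) = _
  rw [h2, h2]
  rfl

lemma formInChart_pos {y : Euc n} (hy : y ∈ e.target) {v : Euc n} (hv : v ≠ 0) :
    0 < formInChart g e y v v := by
  refine g.pos (e.symm y) (dchartSymm e y v) fun h => hv ?_
  rw [← dchart_dchartSymm he hy v]
  exact (congrArg (dchart e (e.symm y)) h).trans (map_zero _)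

lemma exists_formInChart_eq {y : Euc n} (hy : y ∈ e.target) :
    ∃ A : Euc n ≃L[ℝ] (Euc n →L[ℝ] ℝ), (A : Euc n →L[ℝ] Euc n →L[ℝ] ℝ) = formInChart g e y := by
  have hinj : Function.Injective (formInChart g e y : Euc n →ₗ[ℝ] Euc n →L[ℝ] ℝ) := by
    refine (injective_iff_map_eq_zero _).2 fun v hv => ?_
    by_contra h
    have h1 := formInChart_pos g he hy h
    have h2 : formInChart g e y v = 0 := hv
    rw [h2] at h1
    simp at h1
  have hdim : Module.finrank ℝ (Euc n) = Module.finrank ℝ (Euc n →L[ℝ] ℝ) := by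
    rw [← Subspace.dual_finrank_eq]
    exact LinearEquiv.finrank_eq LinearMap.toContinuousLinearMap
  refine ⟨(LinearMap.linearEquivOfInjective _ hinj hdim).toContinuousLinearEquiv, ?_⟩
  ext v w
  rfl

lemma formInChart_eq_of_mem {x : M} (hx : x ∈ e.source) (v w : Euc n) :
    formInChart g e (e x) (dchart e x v) (dchart e x w) = metricForm g x v w := by
  change metricForm g (e.symm (e x)) (dchartSymm e (e x) (dchart e x v))
    (dchartSymm e (e x) (dchart e x w)) = _
  rw [dchartSymm_dchart he hx, dchartSymm_dchart he hx, e.left_inv hx]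

omit he in
/-- The negative gradient field of `f`. -/
theorem exists_negGradient [CompactSpace M] [T2Space M] (hf : ContMDiff (𝓡 n) 𝓘(ℝ, ℝ) ∞ f) :
    ∃ X : (x : M) → TangentSpace (𝓡 n) x, SmoothField X ∧
      ∀ x (w : Euc n), metricForm g x (X x) w = -dfun f x w := by
  -- The defining equation is affine, hence convex, so local solutions obtained by inverting the
  -- metric in charts can be patched.
  let t : (x : M) → Set (TangentSpace (𝓡 n) x) := fun x =>
    {v | ∀ w : Euc n, metricForm g x v w = -dfun f x w}
  have ht : ∀ x, Convex ℝ (t x) := by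
    intro x v hv w hw a b ha hb hab u
    have h1 : ∀ v w : Euc n, metricForm g x (a • v + b • w) u =
        a * metricForm g x v u + b * metricForm g x w u := fun v w => by simp
    refine (h1 v w).trans ?_
    rw [hv u, hw u, ← add_mul, hab, one_mul]
  obtain ⟨s, hs⟩ := exists_contMDiffSection_forall_mem_convex_of_local (I := 𝓡 n) (n := ⊤)
    (fun x : M => TangentSpace (𝓡 n) x) t ht (fun x₀ => by
      have he := IsManifold.chart_mem_maximalAtlas (I := 𝓡 n) (n := ∞) x₀
      set e := chartAt (Euc n) x₀
      refine ⟨e.source, e.open_source.mem_nhds (mem_chart_source _ x₀), fieldOfChart e fun y =>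
        (formInChart g e y).inverse (-fderiv ℝ (fun z => f (e.symm z)) y),
        contMDiffOn_fieldOfChart he fun y hy => ?_, fun x hx w => ?_⟩
      · have h1 := (contDiffOn_formInChart g he).contDiffAt (e.open_target.mem_nhds hy)
        have h2 := (contDiffOn_comp_chart_symm hf he).contDiffAt (e.open_target.mem_nhds hy)
        obtain ⟨A, hA⟩ := exists_formInChart_eq g he hy
        have h3 : ContDiffAt ℝ ∞ (ContinuousLinearMap.inverse :
            (Euc n →L[ℝ] Euc n →L[ℝ] ℝ) → _) (formInChart g e y) := by
          rw [← hA]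
          exact contDiffAt_map_inverse A
        exact ((h3.comp y h1).clm_apply (h2.fderiv_right (m := ∞) (by simp)).neg).contDiffWithinAt
      · obtain ⟨A, hA⟩ := exists_formInChart_eq g he (e.map_source hx)
        refine (formInChart_eq_of_mem g he hx _ w).symm.trans ?_
        rw [dfun_eq_fderiv_chart he hf hx]
        refine (congrArg (fun u => formInChart g e (e x) u (dchart e x w))
          (dchart_fieldOfChart he hx)).trans ?_
        rw [← hA, ContinuousLinearMap.inverse_equiv]
        have h4 := A.apply_symm_apply (-fderiv ℝ (fun z => f (e.symm z)) (e x))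
        exact congrArg (fun L : Euc n →L[ℝ] ℝ => L (dchart e x w)) h4)
  exact ⟨s, s.contMDiff, hs⟩

variable {g} {X : (x : M) → TangentSpace (𝓡 n) x}
  (hX : ∀ x (w : Euc n), metricForm g x (X x) w = -dfun f x w)

lemma formInChart_chartField (hf : ContMDiff (𝓡 n) 𝓘(ℝ, ℝ) ∞ f)
    (hX : ∀ x (w : Euc n), metricForm g x (X x) w = -dfun f x w) {y : Euc n} (hy : y ∈ e.target) :
    formInChart g e y (chartField e X y) = -fderiv ℝ (fun z => f (e.symm z)) y := by
  ext w
  have h1 := formInChart_eq_of_mem g he (e.map_target hy) (X (e.symm y)) (dchartSymm e y w)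
  rw [e.right_inv hy, dchart_dchartSymm he hy] at h1
  refine h1.trans ((hX _ _).trans ?_)
  have h2 := dfun_eq_fderiv_chart he hf (e.map_target hy) (dchartSymm e y w)
  rw [e.right_inv hy, dchart_dchartSymm he hy] at h2
  rw [h2]
  rfl

omit he

lemma eq_of_metricForm_eq {x : M} {v w : Euc n}
    (h : ∀ u, metricForm g x v u = metricForm g x w u) : v = w := by
  by_contra hvw
  have h1 : 0 < metricForm g x (v - w) (v - w) := g.pos x _ (sub_ne_zero.2 hvw)
  have h2 : metricForm g x (v - w) = 0 := by
    ext u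
    simp [h u]
  rw [h2] at h1
  exact lt_irrefl 0 h1

include hX in
lemma isDescendingFlowLine_iff {γ : ℝ → M} :
    IsDescendingFlowLine g f γ ↔ IsMIntegralCurve (I := 𝓡 n) γ X := by
  constructor
  · intro h t
    have h1 : (mfderiv 𝓘(ℝ, ℝ) (𝓡 n) γ t (1 : ℝ) : Euc n) = X (γ t) :=
      eq_of_metricForm_eq fun w => ((h t).2 w).trans (hX (γ t) w).symm
    refine (h t).1.hasMFDerivAt.congr_mfderiv ?_
    ext
    refine h1.trans (one_smul ℝ (X (γ t) : Euc n)).symm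
  · intro h t
    refine ⟨(h t).mdifferentiableAt, fun w => ?_⟩
    have h1 : (mfderiv 𝓘(ℝ, ℝ) (𝓡 n) γ t (1 : ℝ) : Euc n) = X (γ t) := by
      rw [(h t).mfderiv]
      exact one_smul ℝ (X (γ t) : Euc n)
    exact (congrArg (fun u : Euc n => metricForm g (γ t) u w) h1).trans (hX (γ t) w)

variable {G : Type*} [Group G] [MulAction G M] [SmoothAction n G M]

lemma MorseCharts.exists_equiv_dchart {B : M → Euc n →L[ℝ] Euc n →L[ℝ] ℝ} {ε R : ℝ}
    (c : MorseCharts G f B ε R) {p : M} (hp : p ∈ criticalPoints n f) :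
    ∃ L : Euc n ≃L[ℝ] Euc n, ∀ v, dchart (c.e p) p v = L v := by
  obtain ⟨L, hL⟩ := isInvertible_mfderiv_chart (c.mem_atlas p hp) (c.mem_source p hp)
  exact ⟨L, fun v => congrArg (fun T : Euc n →L[ℝ] Euc n => T v) hL.symm⟩

lemma MorseCharts.fderiv_fderiv_eq {B : M → Euc n →L[ℝ] Euc n →L[ℝ] ℝ} {ε R : ℝ}
    (c : MorseCharts G f B ε R) (hf : ContMDiff (𝓡 n) 𝓘(ℝ, ℝ) ∞ f) {p : M}
    (hp : p ∈ criticalPoints n f) (v w : Euc n) :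
    fderiv ℝ (fderiv ℝ fun y => f ((c.e p).symm y)) 0 v w = ⟪signL (c.d p) v, w⟫ := by
  obtain ⟨L, hL⟩ := c.exists_equiv_dchart hp
  have h1 := fderiv_fderiv_chart hf (c.mem_atlas p hp) hp (c.mem_source p hp) hL v w
  rw [c.apply_self p hp, c.hessian_eq p hp, hL, hL, L.apply_symm_apply, L.apply_symm_apply] at h1
  exact h1

include hX in
/-- The linearisation of the negative gradient field at a critical point, in a Morse chart for the
metric. -/
lemma MorseCharts.hasStrictFDerivAt_chartField {ε R : ℝ}
    (c : MorseCharts G f (metricForm g) ε R) (hf : ContMDiff (𝓡 n) 𝓘(ℝ, ℝ) ∞ f)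
    (hXs : SmoothField X) {p : M} (hp : p ∈ criticalPoints n f) :
    chartField (c.e p) X 0 = 0 ∧
      HasStrictFDerivAt (chartField (c.e p) X) (diagL fun i => -c.d p i) 0 := by
  have he := c.mem_atlas p hp
  have hps := c.mem_source p hp
  have hp0 := c.apply_self p hp
  have h0 : (0 : Euc n) ∈ (c.e p).target := hp0 ▸ (c.e p).map_source hps
  have hsymm : (c.e p).symm 0 = p := by rw [← hp0, (c.e p).left_inv hps]
  have hform := fun y hy => formInChart_chartField (e := c.e p) he hf hX (y := y) hy
  have hF := contDiffAt_chartField he hXs h0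
  have hD0 : fderiv ℝ (fun z => f ((c.e p).symm z)) 0 = 0 := by
    rw [fderiv_comp_chart_symm_eq_zero hf he h0, hsymm]
    exact hp
  have hF0 : chartField (c.e p) X 0 = 0 := by
    by_contra h
    have h1 := formInChart_pos g he h0 h
    rw [hform 0 h0, hD0] at h1
    simp at h1
  refine ⟨hF0, ?_⟩
  have hstrict := hF.hasStrictFDerivAt (by simp)
  refine hstrict.congr_fderiv ?_
  set A := fderiv ℝ (chartField (c.e p) X) 0 with hA
  obtain ⟨L, hL⟩ := c.exists_equiv_dchart hp
  have hHess := c.fderiv_fderiv_eq hf hp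
  have hmet : ∀ v w, formInChart g (c.e p) 0 v w = ∑ i, |c.d p i|⁻¹ * v i * w i := fun v w => by
    have h1 := formInChart_eq_of_mem g he hps (L.symm v) (L.symm w)
    rw [hp0, c.form_eq p hp, hL, hL, L.apply_symm_apply, L.apply_symm_apply] at h1
    exact h1
  -- Differentiate `g(X, ·) = -df` at the zero of the field: the derivative of the metric is paired
  -- with the vanishing field and drops out.
  have hkey : ∀ v w, formInChart g (c.e p) 0 (A v) w = -⟪signL (c.d p) v, w⟫ := by
    intro v w
    have h1 := ((contDiffOn_formInChart g he).contDiffAt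
      ((c.e p).open_target.mem_nhds h0)).differentiableAt (by simp) |>.hasFDerivAt
    have h2 := h1.clm_apply hstrict.hasFDerivAt
    have h3 : HasFDerivAt (fun y => -fderiv ℝ (fun z => f ((c.e p).symm z)) y)
        (-fderiv ℝ (fderiv ℝ fun z => f ((c.e p).symm z)) 0) 0 :=
      ((((contDiffOn_comp_chart_symm hf he).contDiffAt ((c.e p).open_target.mem_nhds
        h0)).fderiv_right (m := 1) (by simpa [one_add_one_eq_two] using two_le_infty)).differentiableAt
          (by simp)).hasFDerivAt.neg
    have h4 := h2.unique (h3.congr_of_eventuallyEq (by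
      filter_upwards [(c.e p).open_target.mem_nhds h0] with y hy using hform y hy))
    have h5 := congrArg (fun T : Euc n →L[ℝ] Euc n →L[ℝ] ℝ => T v w) h4
    simp only [hF0, map_zero, add_zero] at h5
    rw [← hHess]
    exact h5
  ext v i
  have h1 := hkey v (EuclideanSpace.single i 1)
  rw [hmet, inner_diagL] at h1
  simp only [PiLp.single_apply, mul_ite, mul_one, mul_zero,
    Finset.sum_ite_eq', Finset.mem_univ, if_true] at h1
  rw [diagL_apply]
  have hd := c.d_ne p hp i
  have h2 : |c.d p i| * Real.sign (c.d p i) = c.d p i := by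
    rcases lt_or_gt_of_ne hd with h | h
    · rw [abs_of_neg h, Real.sign_of_neg h]; ring
    · rw [abs_of_pos h, Real.sign_of_pos h]; ring
  have h3 : (A v) i = |c.d p i| * (|c.d p i|⁻¹ * (A v) i) := by
    rw [← mul_assoc, mul_inv_cancel₀ (abs_ne_zero.2 hd), one_mul]
  rw [h3, h1, mul_neg, ← mul_assoc, h2, neg_mul]

end Gradient

end EquivariantMorse

namespace EquivariantMorse

/-! ### The cone condition -/

section Cone

open Set Filter
open scoped RealInnerProductSpace

variable {n : ℕ} {d : Fin n → ℝ} {κ μ : ℝ}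

/-- The coefficients of the quadratic form whose negative cone is a neighbourhood of the directions
in which `d` is negative. -/
noncomputable def coneWeight (κ : ℝ) (d : Fin n → ℝ) (i : Fin n) : ℝ :=
  if 0 < d i then 1 else -κ ^ 2

lemma abs_coneWeight_le (hκ0 : 0 ≤ κ) (hκ1 : κ ≤ 1) (i : Fin n) : |coneWeight κ d i| ≤ 1 := by
  rw [coneWeight]
  split_ifs
  · simp
  · rw [abs_neg, abs_of_nonneg (by positivity)]
    exact pow_le_one₀ hκ0 hκ1

lemma norm_sq_eq_sum (y : Euc n) : ‖y‖ ^ 2 = ∑ i, y i ^ 2 := by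
  rw [EuclideanSpace.norm_sq_eq]
  simp

lemma inner_coneWeight (κ : ℝ) (d : Fin n → ℝ) (y : Euc n) :
    ⟪diagL (coneWeight κ d) y, y⟫ = ∑ i, coneWeight κ d i * y i ^ 2 := by
  rw [inner_diagL]
  exact Finset.sum_congr rfl fun i _ => by ring

lemma norm_diagL_le {w : Fin n → ℝ} (hw : ∀ i, |w i| ≤ 1) (y : Euc n) : ‖diagL w y‖ ≤ ‖y‖ := by
  refine le_of_sq_le_sq ?_ (norm_nonneg y)
  rw [norm_sq_eq_sum, norm_sq_eq_sum]
  refine Finset.sum_le_sum fun i _ => ?_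
  rw [diagL_apply]
  exact sq_le_sq.2 (by
    rw [abs_mul]
    exact mul_le_of_le_one_left (abs_nonneg _) (hw i))

/-- Every product `coneWeight κ d i * d i` is at least `μ κ²`, so along the linear field the form
loses `μ κ² ‖y‖²`, as much as the error can contribute. -/
lemma inner_coneWeight_field_nonpos (hκ0 : 0 ≤ κ) (hκ1 : κ ≤ 1) (hμ0 : 0 ≤ μ)
    (hμ : ∀ i, μ ≤ |d i|) {y z : Euc n}
    (hz : ‖z - diagL (fun i => -d i) y‖ ≤ μ * κ ^ 2 * ‖y‖) :
    ⟪diagL (coneWeight κ d) y, z⟫ ≤ 0 := by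
  have h1 : ⟪diagL (coneWeight κ d) y, diagL (fun i => -d i) y⟫ ≤ -(μ * κ ^ 2 * ‖y‖ ^ 2) := by
    rw [inner_diagL, norm_sq_eq_sum, Finset.mul_sum, ← Finset.sum_neg_distrib]
    refine Finset.sum_le_sum fun i _ => ?_
    rw [diagL_apply]
    have h2 : μ * κ ^ 2 ≤ coneWeight κ d i * d i := by
      have hκ2 : κ ^ 2 ≤ 1 := pow_le_one₀ hκ0 hκ1
      rw [coneWeight]
      split_ifs with h
      · have := hμ i
        rw [abs_of_pos h] at this
        nlinarith
      · have := hμ i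
        rw [abs_of_nonpos (not_lt.1 h)] at this
        nlinarith [sq_nonneg κ]
    nlinarith [mul_le_mul_of_nonneg_right h2 (sq_nonneg (y i))]
  have h2 := (real_inner_le_norm (diagL (coneWeight κ d) y) (z - diagL (fun i => -d i) y)).trans
    (mul_le_mul (norm_diagL_le (abs_coneWeight_le hκ0 hκ1) y) hz (norm_nonneg _) (norm_nonneg _))
  rw [inner_sub_right] at h2
  nlinarith

/-- Curves which emanate from the equilibrium lie in the cone around the unstable directions. -/
lemma inner_coneWeight_nonpos {F : Euc n → Euc n} {r : ℝ} (hκ0 : 0 ≤ κ) (hκ1 : κ ≤ 1)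
    (hμ0 : 0 ≤ μ) (hμ : ∀ i, μ ≤ |d i|)
    (hF : ∀ y, ‖y‖ ≤ r → ‖F y - diagL (fun i => -d i) y‖ ≤ μ * κ ^ 2 * ‖y‖) {y : ℝ → Euc n}
    (hy : ∀ t ≤ 0, HasDerivAt y (F (y t)) t) (hyr : ∀ t ≤ 0, ‖y t‖ ≤ r)
    (hlim : Tendsto y atBot (𝓝 0)) : ⟪diagL (coneWeight κ d) (y 0), y 0⟫ ≤ 0 := by
  set L := diagL (coneWeight κ d)
  have hder : ∀ t ≤ 0, HasDerivAt (fun t => ⟪L (y t), y t⟫) (2 * ⟪L (y t), F (y t)⟫) t := by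
    intro t ht
    have h1 : HasDerivAt (fun t => L (y t)) (L (F (y t))) t := L.hasFDerivAt.comp_hasDerivAt t (hy t ht)
    refine (h1.inner ℝ (hy t ht)).congr_deriv ?_
    rw [inner_diagL_comm (coneWeight κ d) (F (y t)), real_inner_comm]
    ring
  -- The form decreases in time and tends to zero at `-∞`, so it is never positive.
  have hanti : AntitoneOn (fun t => ⟪L (y t), y t⟫) (Iic 0) := by
    refine antitoneOn_of_hasDerivWithinAt_nonpos (convex_Iic 0)
      (fun t ht => (hder t ht).continuousAt.continuousWithinAt)
      (f' := fun t => 2 * ⟪L (y t), F (y t)⟫) (fun t ht => ?_) fun t ht => ?_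
    · exact (hder t (interior_subset ht : t ∈ Iic 0)).hasDerivWithinAt
    · have := inner_coneWeight_field_nonpos hκ0 hκ1 hμ0 hμ
        (hF (y t) (hyr t (interior_subset ht : t ∈ Iic 0)))
      linarith
  have hlim2 : Tendsto (fun t => ⟪L (y t), y t⟫) atBot (𝓝 0) := by
    have h1 := ((L.continuous.tendsto 0).comp hlim).inner (𝕜 := ℝ) hlim
    simpa using h1
  refine ge_of_tendsto hlim2 ?_
  filter_upwards [Iic_mem_atBot (0 : ℝ)] with t ht using hanti ht (mem_Iic.2 le_rfl) ht

lemma abs_apply_le_of_cone (hκ0 : 0 ≤ κ) {y : Euc n}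
    (h : ⟪diagL (coneWeight κ d) y, y⟫ ≤ 0) {i : Fin n} (hi : 0 < d i) : |y i| ≤ κ * ‖y‖ := by
  refine abs_le_of_sq_le_sq ?_ (by positivity)
  rw [inner_coneWeight] at h
  have h1 : y i ^ 2 ≤ ∑ j, (coneWeight κ d j * y j ^ 2 + κ ^ 2 * y j ^ 2) := by
    refine le_trans ?_ (Finset.single_le_sum (fun j _ => ?_) (Finset.mem_univ i))
    · rw [coneWeight, if_pos hi]
      nlinarith [mul_nonneg (sq_nonneg κ) (sq_nonneg (y i))]
    · rw [coneWeight]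
      split_ifs
      · positivity
      · linarith
  rw [Finset.sum_add_distrib, ← Finset.mul_sum, ← norm_sq_eq_sum] at h1
  rw [mul_pow]
  linarith

/-- The difference has only components with `d i > 0`, which the cone condition bounds by `κ` times
the remaining ones, that is, by those of `u`. -/
lemma norm_sub_le_of_cone (hκ0 : 0 ≤ κ) {y u : Euc n}
    (h : ⟪diagL (coneWeight κ d) y, y⟫ ≤ 0) (hu : ∀ i, 0 < d i → u i = 0)
    (hy : ∀ i, ¬0 < d i → y i = u i) : ‖y - u‖ ≤ κ * ‖u‖ := by
  refine le_of_sq_le_sq ?_ (by positivity)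
  rw [inner_coneWeight] at h
  have h1 : ∑ i, (y - u) i ^ 2 ≤ ∑ j, (coneWeight κ d j * y j ^ 2 + κ ^ 2 * u j ^ 2) := by
    refine Finset.sum_le_sum fun i _ => ?_
    rw [PiLp.sub_apply, coneWeight]
    split_ifs with hi
    · rw [hu i hi]
      simp
    · rw [hy i hi]
      simp
  rw [Finset.sum_add_distrib, ← Finset.mul_sum, ← norm_sq_eq_sum, ← norm_sq_eq_sum] at h1
  rw [mul_pow]
  linarith

lemma signL_eq_neg_iff (hd : ∀ i, d i ≠ 0) {v : Euc n} :
    signL d v = -v ↔ ∀ i, 0 < d i → v i = 0 := by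
  constructor
  · intro h i hi
    have h1 := congrArg (fun u : Euc n => u i) h
    simp only [diagL_apply, Real.sign_of_pos hi, PiLp.neg_apply] at h1
    linarith
  · intro h
    ext i
    rw [diagL_apply, PiLp.neg_apply]
    rcases lt_or_gt_of_ne (hd i) with hi | hi
    · rw [Real.sign_of_neg hi]
      ring
    · rw [h i hi]
      simp

lemma exists_pos_le_abs (hd : ∀ i, d i ≠ 0) : ∃ μ > 0, ∀ i, μ ≤ |d i| := by
  have h1 : ∀ᶠ m in 𝓝[>] (0 : ℝ), ∀ i, m ≤ |d i| := by
    refine eventually_all.2 fun i => ?_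
    filter_upwards [Ioo_mem_nhdsGT (abs_pos.2 (hd i))] with m hm using hm.2.le
  obtain ⟨m, h2, h3⟩ := (h1.and self_mem_nhdsWithin).exists
  exact ⟨m, h3, h2⟩

end Cone

/-! ### The descending manifold near its critical point -/

section Trapping

open Set Filter
open scoped RealInnerProductSpace

variable {n : ℕ} {M : Type*} [TopologicalSpace M] [ChartedSpace (Euc n) M]
  [IsManifold (𝓡 n) ∞ M] {g : SmoothMetric n M} {f : M → ℝ}
  {X : (x : M) → TangentSpace (𝓡 n) x} {Φ : ℝ → M → M} {G : Type*} [Group G] [MulAction G M]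
  [SmoothAction n G M]

lemma mem_descendingManifold_iff [T2Space M] (hXs : SmoothField X)
    (hX : ∀ x (w : Euc n), metricForm g x (X x) w = -dfun f x w) (hΦ : IsFlow X Φ) {p x : M} :
    x ∈ descendingManifold g f p ↔ Tendsto (fun t => Φ t x) atBot (𝓝 p) := by
  constructor
  · rintro ⟨γ, hγ, rfl, hlim⟩
    refine hlim.congr fun t => ?_
    exact hΦ.eq_of_curve hXs ((isDescendingFlowLine_iff hX).1 hγ) t
  · intro h
    exact ⟨fun t => Φ t x, (isDescendingFlowLine_iff hX).2 (hΦ.curve x), hΦ.zero x, h⟩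

lemma dfun_negGradient_nonpos (hX : ∀ x (w : Euc n), metricForm g x (X x) w = -dfun f x w) (x : M) :
    dfun f x (X x) ≤ 0 := by
  have h1 : 0 ≤ metricForm g x (X x) (X x) := by
    by_cases h : (X x : Euc n) = 0
    · have h2 : metricForm g x (X x) (X x) = metricForm g x (0 : Euc n) (0 : Euc n) :=
        congrArg (fun u : Euc n => metricForm g x u u) h
      rw [h2]
      simp
    · exact (g.pos x (X x) h).le
  have h2 := hX x (X x)
  linarith

/-- A function of the form `f + β ρ` decreases along the negative gradient field close to a critical
point, where `ρ` is the square of the distance in a Morse chart. -/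
lemma MorseCharts.exists_decreasing {ε R : ℝ} (c : MorseCharts G f (metricForm g) ε R)
    (hf : ContMDiff (𝓡 n) 𝓘(ℝ, ℝ) ∞ f) (hXs : SmoothField X)
    (hX : ∀ x (w : Euc n), metricForm g x (X x) w = -dfun f x w) {p : M}
    (hp : p ∈ criticalPoints n f) :
    ∃ r > 0, ∃ β > 0, r < R ∧ ∀ y : Euc n, ‖y‖ ≤ r →
      fderiv ℝ (fun z => f ((c.e p).symm z)) y (chartField (c.e p) X y) +
        β * (2 * ⟪y, chartField (c.e p) X y⟫) ≤ 0 := by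
  have he := c.mem_atlas p hp
  have hps := c.mem_source p hp
  have hp0 := c.apply_self p hp
  have h0 : (0 : Euc n) ∈ (c.e p).target := hp0 ▸ (c.e p).map_source hps
  have hsymm : (c.e p).symm 0 = p := by rw [← hp0, (c.e p).left_inv hps]
  obtain ⟨μ, hμ, hμd⟩ := exists_pos_le_abs (c.d_ne p hp)
  obtain ⟨hF0, hF⟩ := c.hasStrictFDerivAt_chartField hX hf hXs hp
  set F := chartField (c.e p) X
  set D := diagL fun i => -c.d p i
  set K := ‖D‖
  -- With this error `f` has derivative at most `-(μ - η (K + 2)) ‖y‖² ≤ -μ/2 ‖y‖²` along the field.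
  -- The constant `β` below is chosen so that the `rho` term contributes at most `μ/2 ‖y‖²`.
  set η := min 1 (μ / (2 * (K + 2))) with hη
  have hK : 0 ≤ K := norm_nonneg D
  have hη0 : 0 < η := lt_min one_pos (by positivity)
  have hη1 : η ≤ 1 := min_le_left _ _
  have hη2 : η * (K + 2) ≤ μ / 2 := by
    have h1 : η ≤ μ / (2 * (K + 2)) := min_le_right _ _
    rw [le_div_iff₀ (by positivity)] at h1
    linarith
  obtain ⟨δ, hδ, -, happ⟩ := exists_ball_approx (c.e p).open_target h0
    (contDiffOn_comp_chart_symm hf he)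
    ((fderiv_comp_chart_symm_eq_zero hf he h0).2 (by rw [hsymm]; exact hp))
    (d := fun i => Real.sign (c.d p i)) (c.fderiv_fderiv_eq hf hp) hη0
  obtain ⟨δ', hδ', hball⟩ := Metric.mem_nhds_iff.1 (hF.hasFDerivAt.isLittleO.def hη0)
  obtain ⟨r, hr, hrm⟩ : ∃ r > 0, r < min (min δ δ') R :=
    exists_between (lt_min (lt_min hδ hδ') c.R_pos)
  have hr1 : r < δ := hrm.trans_le ((min_le_left _ _).trans (min_le_left _ _))
  have hr2 : r < δ' := hrm.trans_le ((min_le_left _ _).trans (min_le_right _ _))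
  set β := μ / (4 * (K + 1)) with hβ
  have hβ2 : β * (2 * (K + 1)) = μ / 2 := by
    rw [hβ]
    field_simp
    norm_num
  refine ⟨r, hr, β, by positivity, hrm.trans_le (min_le_right _ _), fun y hy => ?_⟩
  have h1 := ((abs_le.1 ((happ y (mem_ball_zero_iff.2 (hy.trans_lt hr1))).2 (F y))).2)
  have h2 : ‖F y - F 0 - D (y - 0)‖ ≤ η * ‖y - 0‖ := hball (mem_ball_zero_iff.2 (hy.trans_lt hr2))
  rw [hF0, sub_zero, sub_zero] at h2
  have h3 : ‖F y‖ ≤ (K + η) * ‖y‖ := by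
    have h4 := norm_le_norm_add_norm_sub (D y) (F y)
    have h5 := D.le_opNorm y
    rw [norm_sub_rev] at h4
    linarith
  have h4 : ⟪signL (c.d p) y, D y⟫ ≤ -(μ * ‖y‖ ^ 2) := by
    rw [inner_diagL, norm_sq_eq_sum, Finset.mul_sum, ← Finset.sum_neg_distrib]
    refine Finset.sum_le_sum fun i _ => ?_
    rw [diagL_apply]
    have h5 : Real.sign (c.d p i) * c.d p i = |c.d p i| := by
      rcases lt_or_gt_of_ne (c.d_ne p hp i) with h | h
      · rw [abs_of_neg h, Real.sign_of_neg h]; ring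
      · rw [abs_of_pos h, Real.sign_of_pos h]; ring
    nlinarith [mul_le_mul_of_nonneg_right (hμd i) (sq_nonneg (y i))]
  have h5 := real_inner_le_norm (signL (c.d p) y) (F y - D y)
  rw [norm_signL (c.d_ne p hp), inner_sub_right] at h5
  have h6 : ‖y‖ * ‖F y - D y‖ ≤ η * ‖y‖ ^ 2 := by
    nlinarith [mul_le_mul_of_nonneg_left h2 (norm_nonneg y)]
  have h7 := real_inner_le_norm y (F y)
  have h8 : ‖y‖ * ‖F y‖ ≤ (K + 1) * ‖y‖ ^ 2 := by
    have h9 : ‖F y‖ ≤ (K + 1) * ‖y‖ :=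
      h3.trans (mul_le_mul_of_nonneg_right (by linarith) (norm_nonneg y))
    nlinarith [mul_le_mul_of_nonneg_left h9 (norm_nonneg y)]
  have h9 : β * (2 * ⟪y, F y⟫) ≤ μ / 2 * ‖y‖ ^ 2 := by
    rw [← hβ2]
    have hβ0 : 0 < β := by positivity
    nlinarith [mul_le_mul_of_nonneg_left (h7.trans h8) hβ0.le]
  have h10 : η * (‖y‖ * ‖F y‖) ≤ η * ((K + 1) * ‖y‖ ^ 2) := mul_le_mul_of_nonneg_left h8 hη0.le
  have h11 := mul_le_mul_of_nonneg_right hη2 (sq_nonneg ‖y‖)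
  nlinarith

/-- Backward orbits of points of the descending manifold close to the critical point stay close to
it. -/
lemma MorseCharts.exists_trapping [T2Space M] {ε R : ℝ} (c : MorseCharts G f (metricForm g) ε R)
    (hf : ContMDiff (𝓡 n) 𝓘(ℝ, ℝ) ∞ f) (hXs : SmoothField X)
    (hX : ∀ x (w : Euc n), metricForm g x (X x) w = -dfun f x w) (hΦ : IsFlow X Φ) {p : M}
    (hp : p ∈ criticalPoints n f) {r : ℝ} (hr : 0 < r) :
    ∀ᶠ x in 𝓝 p, Tendsto (fun t => Φ t x) atBot (𝓝 p) →
      ∀ t ≤ 0, Φ t x ∈ (c.e p).source ∧ ‖c.e p (Φ t x)‖ ≤ r := by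
  have he := c.mem_atlas p hp
  have hps := c.mem_source p hp
  have hp0 := c.apply_self p hp
  obtain ⟨r₀, hr₀, β, hβ, hr₀R, hdec⟩ := c.exists_decreasing hf hXs hX hp
  set s := min r r₀ with hs
  have hs0 : 0 < s := lt_min hr hr₀
  have hlt : f p - β * s ^ 2 < f p := sub_lt_self _ (by positivity)
  filter_upwards [hf.continuous.continuousAt.eventually (lt_mem_nhds hlt)] with x hx hlim
  set e := c.e p
  set U := e.source ∩ e ⁻¹' Metric.ball 0 s with hU
  have hUo : IsOpen U := e.isOpen_inter_preimage Metric.isOpen_ball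
  have hpU : p ∈ U := ⟨hps, by
    rw [mem_preimage, hp0]
    exact Metric.mem_ball_self hs0⟩
  have hsub : Metric.closedBall (0 : Euc n) s ⊆ e.target := by
    rw [c.target_eq p hp]
    exact Metric.closedBall_subset_ball ((min_le_right _ _).trans_lt hr₀R)
  have hC : IsClosed (e.symm '' Metric.closedBall 0 s) :=
    ((isCompact_closedBall (0 : Euc n) s).image_of_continuousOn
      (e.continuousOn_symm.mono hsub)).isClosed
  have hcont : Continuous fun t => Φ t x := hΦ.continuous.comp (continuous_id.prodMk continuous_const)
  suffices h : ∀ t ≤ 0, Φ t x ∈ U from fun t ht =>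
    ⟨(h t ht).1, (mem_ball_zero_iff.1 (h t ht).2).le.trans (min_le_left _ _)⟩
  by_contra! hbad
  -- Let `T` be the earliest time outside the ball. Up to `T` the function `f + β ‖·‖²` decreases
  -- from its limit `f p`, so `f (Φ T x) ≤ f p - β s²`. But `f (Φ T x) ≥ f x`, which was taken
  -- larger.
  set B := Iic (0 : ℝ) ∩ (fun t => Φ t x) ⁻¹' Uᶜ with hB
  have hBc : IsClosed B := isClosed_Iic.inter (hUo.isClosed_compl.preimage hcont)
  obtain ⟨t₀, ht₀⟩ := eventually_atBot.1 (hlim.eventually (hUo.mem_nhds hpU))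
  have hBb : BddBelow B := ⟨t₀, fun t ht => by
    by_contra! h
    exact ht.2 (ht₀ t h.le)⟩
  obtain ⟨t₁, ht₁, ht₁U⟩ := hbad
  have hT := hBc.csInf_mem ⟨t₁, ht₁, ht₁U⟩ hBb
  set T := sInf B
  have hbelow : ∀ t < T, Φ t x ∈ U := fun t ht => by
    by_contra h
    exact absurd (csInf_le hBb ⟨ht.le.trans hT.1, h⟩) (not_le.2 ht)
  have hTC : Φ T x ∈ e.symm '' Metric.closedBall 0 s := by
    refine hC.mem_of_tendsto (hcont.continuousAt.continuousWithinAt (s := Iio T)) ?_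
    filter_upwards [self_mem_nhdsWithin] with t ht
    have h1 := hbelow t ht
    exact ⟨e (Φ t x), Metric.ball_subset_closedBall h1.2, e.left_inv h1.1⟩
  obtain ⟨y, hy, hyT⟩ := hTC
  have hTs : Φ T x ∈ e.source := hyT ▸ e.map_target (hsub hy)
  have hTe : e (Φ T x) = y := by rw [← hyT, e.right_inv (hsub hy)]
  have hTn : s ≤ ‖e (Φ T x)‖ := by
    by_contra! h
    exact hT.2 ⟨hTs, mem_ball_zero_iff.2 h⟩
  have hle : ∀ t ≤ T, Φ t x ∈ e.source ∧ ‖e (Φ t x)‖ ≤ s := by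
    intro t ht
    rcases ht.lt_or_eq with h | rfl
    · exact ⟨(hbelow t h).1, (mem_ball_zero_iff.1 (hbelow t h).2).le⟩
    · exact ⟨hTs, by rw [hTe]; exact mem_closedBall_zero_iff.1 hy⟩
  have hder : ∀ t ≤ T, HasDerivAt (fun t => f (Φ t x) + β * ‖e (Φ t x)‖ ^ 2)
      (fderiv ℝ (fun z => f (e.symm z)) (e (Φ t x)) (chartField e X (e (Φ t x))) +
        β * (2 * ⟪e (Φ t x), chartField e X (e (Φ t x))⟫)) t := by
    intro t ht
    have h1 := hΦ.hasDerivAt_comp hf x t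
    have h2 := hasDerivAt_chart he (hΦ.curve x t) (hle t ht).1
    refine (h1.add (h2.norm_sq.const_mul β)).congr_deriv ?_
    exact congrArg (· + _) (dfun_field_chart he hf (hle t ht).1)
  have hanti : AntitoneOn (fun t => f (Φ t x) + β * ‖e (Φ t x)‖ ^ 2) (Iic T) := by
    refine antitoneOn_of_hasDerivWithinAt_nonpos (convex_Iic T)
      (fun t ht => (hder t ht).continuousAt.continuousWithinAt)
      (fun t ht => (hder t (interior_subset ht : t ∈ Iic T)).hasDerivWithinAt) fun t ht => ?_
    exact hdec _ ((hle t (interior_subset ht : t ∈ Iic T)).2.trans (min_le_right _ _))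
  have hlimV : Tendsto (fun t => f (Φ t x) + β * ‖e (Φ t x)‖ ^ 2) atBot (𝓝 (f p)) := by
    have h1 := (hf.continuous.tendsto p).comp hlim
    have h2 : Tendsto (fun t => e (Φ t x)) atBot (𝓝 0) := by
      have h3 := (e.continuousAt hps).tendsto.comp hlim
      rwa [hp0] at h3
    simpa using h1.add ((h2.norm.pow 2).const_mul β)
  have h1 : f (Φ T x) + β * ‖e (Φ T x)‖ ^ 2 ≤ f p := by
    refine ge_of_tendsto hlimV ?_
    filter_upwards [Iic_mem_atBot T] with t ht using hanti ht (mem_Iic.2 le_rfl) ht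
  have h2 : f x ≤ f (Φ T x) := by
    have h3 := hΦ.antitone_comp hf (dfun_negGradient_nonpos hX) x hT.1
    simpa [hΦ.zero] using h3
  have h3 : β * s ^ 2 ≤ β * ‖e (Φ T x)‖ ^ 2 := by gcongr
  linarith

/-- Close to the critical point, the descending manifold lies in a small cone around the unstable
directions. -/
lemma MorseCharts.eventually_cone [T2Space M] {ε R : ℝ} (c : MorseCharts G f (metricForm g) ε R)
    (hf : ContMDiff (𝓡 n) 𝓘(ℝ, ℝ) ∞ f) (hXs : SmoothField X)
    (hX : ∀ x (w : Euc n), metricForm g x (X x) w = -dfun f x w) (hΦ : IsFlow X Φ) {p : M}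
    (hp : p ∈ criticalPoints n f) {κ : ℝ} (hκ0 : 0 < κ) (hκ1 : κ ≤ 1) :
    ∀ᶠ x in 𝓝 p, Tendsto (fun t => Φ t x) atBot (𝓝 p) →
      ⟪diagL (coneWeight κ (c.d p)) (c.e p x), c.e p x⟫ ≤ 0 := by
  obtain ⟨μ, hμ, hμd⟩ := exists_pos_le_abs (c.d_ne p hp)
  obtain ⟨hF0, hF⟩ := c.hasStrictFDerivAt_chartField hX hf hXs hp
  obtain ⟨r, hr, hball⟩ := Metric.nhds_basis_closedBall.mem_iff.1
    (hF.hasFDerivAt.isLittleO.def (c := μ * κ ^ 2) (by positivity))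
  filter_upwards [c.exists_trapping hf hXs hX hΦ hp hr] with x hx hlim
  have h1 := hx hlim
  have h2 := inner_coneWeight_nonpos (F := chartField (c.e p) X) hκ0.le hκ1 hμ.le hμd (r := r)
    (fun y hy => by
      have h3 : ‖chartField (c.e p) X y - chartField (c.e p) X 0 -
        diagL (fun i => -c.d p i) (y - 0)‖ ≤ μ * κ ^ 2 * ‖y - 0‖ :=
          hball (mem_closedBall_zero_iff.2 hy)
      rwa [hF0, sub_zero, sub_zero] at h3) (y := fun t => c.e p (Φ t x))
    (fun t ht => hasDerivAt_chart (c.mem_atlas p hp) (hΦ.curve x t) (h1 t ht).1)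
    (fun t ht => (h1 t ht).2) (by
      have h3 := ((c.e p).continuousAt (c.mem_source p hp)).tendsto.comp hlim
      rwa [c.apply_self p hp] at h3)
  simpa only [hΦ.zero] using h2

end Trapping

end EquivariantMorse

namespace EquivariantMorse

/-! ### The tangent space of the descending manifold -/

section DescendingTangentSpace

open Set Filter
open scoped RealInnerProductSpace

variable {n : ℕ} {M : Type*} [TopologicalSpace M] [ChartedSpace (Euc n) M]
  [IsManifold (𝓡 n) ∞ M] {g : SmoothMetric n M} {f : M → ℝ}
  {X : (x : M) → TangentSpace (𝓡 n) x} {Φ : ℝ → M → M} {G : Type*} [Group G] [MulAction G M]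
  [SmoothAction n G M] [T2Space M]

/-- An integral curve on `(-∞, 0)` which is continuous at `0` is the orbit of its endpoint. -/
lemma IsFlow.eq_of_curve_neg (hX : SmoothField X) (hΦ : IsFlow X Φ) {γ : ℝ → M}
    (hγ : ∀ t < 0, HasMFDerivAt 𝓘(ℝ, ℝ) (𝓡 n) γ t ((1 : ℝ →L[ℝ] ℝ).smulRight (X (γ t))))
    (hc : ContinuousWithinAt γ (Iio 0) 0) {t : ℝ} (ht : t < 0) : Φ t (γ 0) = γ t := by
  have h1 : EqOn γ (fun s => Φ (s - t) (γ t)) (Ioo (t - 1) 0) := by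
    refine isMIntegralCurveOn_Ioo_eqOn_of_contMDiff_boundaryless (I := 𝓡 n) (t₀ := t)
      ⟨by linarith, ht⟩ (hX.of_le (by simp)) (fun s hs => (hγ s hs.2).hasMFDerivWithinAt)
      (((hΦ.curve (γ t)).comp_add (-t)).isMIntegralCurveOn _) ?_
    simp [hΦ.zero]
  have h2 : Tendsto (fun s => Φ (s - t) (γ t)) (𝓝[<] 0) (𝓝 (Φ (0 - t) (γ t))) :=
    ((hΦ.continuous.comp ((continuous_id.sub continuous_const).prodMk
      continuous_const)).tendsto 0).mono_left nhdsWithin_le_nhds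
  have h3 : γ 0 = Φ (0 - t) (γ t) := by
    refine tendsto_nhds_unique hc (h2.congr' ?_)
    filter_upwards [Ioo_mem_nhdsLT (show t - 1 < 0 by linarith)] with s hs using (h1 hs).symm
  rw [h3, ← hΦ.add]
  simp [hΦ.zero]

/-- Points of the descending manifold with prescribed unstable components. -/
lemma MorseCharts.exists_mem_unstable {ε R : ℝ} (c : MorseCharts G f (metricForm g) ε R)
    (hf : ContMDiff (𝓡 n) 𝓘(ℝ, ℝ) ∞ f) (hXs : SmoothField X)
    (hX : ∀ x (w : Euc n), metricForm g x (X x) w = -dfun f x w) (hΦ : IsFlow X Φ) {p : M}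
    (hp : p ∈ criticalPoints n f) {W : Set M} (hW : W ∈ 𝓝 p) :
    ∃ δ > 0, ∀ u : Euc n, ‖u‖ ≤ δ → ∃ y ∈ (c.e p).target, (c.e p).symm y ∈ W ∧
      Tendsto (fun t => Φ t ((c.e p).symm y)) atBot (𝓝 p) ∧ ∀ i, ¬0 < c.d p i → y i = u i := by
  have he := c.mem_atlas p hp
  have hps := c.mem_source p hp
  have hp0 := c.apply_self p hp
  have h0 : (0 : Euc n) ∈ (c.e p).target := hp0 ▸ (c.e p).map_source hps
  have hsymm : (c.e p).symm 0 = p := by rw [← hp0, (c.e p).left_inv hps]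
  obtain ⟨hF0, hF⟩ := c.hasStrictFDerivAt_chartField hX hf hXs hp
  set e := c.e p
  set F := chartField e X
  set D := diagL fun i => -c.d p i
  set T := EuclideanSpace.equiv (Fin n) ℝ
  have hTs : T.symm 0 = 0 := map_zero _
  have hes := e.continuousAt_symm h0
  rw [ContinuousAt, hsymm] at hes
  have hnhds : e.target ∩ e.symm ⁻¹' W ∈ 𝓝 (T.symm 0) := by
    rw [hTs]
    exact inter_mem (e.open_target.mem_nhds h0) (hes hW)
  obtain ⟨r, hr, hrW⟩ := Metric.nhds_basis_closedBall.mem_iff.1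
    (T.symm.continuous.continuousAt hnhds)
  let N : (Fin n → ℝ) → Fin n → ℝ := fun z => T (F (T.symm z) - D (T.symm z))
  have hN0 : N 0 = 0 := by
    simp only [N, hTs, hF0, map_zero, sub_zero]
  have hN : HasStrictFDerivAt N (0 : (Fin n → ℝ) →L[ℝ] Fin n → ℝ) 0 := by
    have h1 : HasStrictFDerivAt (fun y => F y - D y) (D - D) (T.symm 0) := by
      rw [hTs]
      exact hF.sub D.hasStrictFDerivAt
    refine (T.hasStrictFDerivAt.comp (0 : Fin n → ℝ)
      (h1.comp (0 : Fin n → ℝ) T.symm.hasStrictFDerivAt)).congr_fderiv ?_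
    rw [sub_self, ContinuousLinearMap.zero_comp, ContinuousLinearMap.comp_zero]
  obtain ⟨δ, hδ, hsol⟩ := exists_backward_solution (lam := fun i => -c.d p i)
    (fun i => neg_ne_zero.2 (c.d_ne p hp i)) hN0 hN hr
  obtain ⟨δ', hδ', hTδ⟩ := Metric.nhds_basis_closedBall.mem_iff.1
    (T.continuous.continuousAt (x := 0) (by
      rw [map_zero]
      exact Metric.closedBall_mem_nhds (0 : Fin n → ℝ) hδ))
  refine ⟨δ', hδ', fun u hu => ?_⟩
  obtain ⟨x, hxc, hxd, hxr, hxlim, hxu⟩ := hsol (T u)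
    (mem_closedBall_zero_iff.1 (hTδ (mem_closedBall_zero_iff.2 hu)))
  have hmem : ∀ t ≤ 0, T.symm (x t) ∈ e.target ∧ e.symm (T.symm (x t)) ∈ W := fun t ht =>
    hrW (mem_closedBall_zero_iff.2 (hxr t ht))
  have hder : ∀ t < 0, HasDerivAt (fun t => T.symm (x t)) (F (T.symm (x t))) t := by
    intro t ht
    refine (T.symm.hasFDerivAt.comp_hasDerivAt t (hxd t ht)).congr_deriv ?_
    ext i
    change -c.d p i * x t i + (F (T.symm (x t)) i - -c.d p i * x t i) = F (T.symm (x t)) i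
    ring
  have hflow : ∀ t < 0, Φ t (e.symm (T.symm (x 0))) = e.symm (T.symm (x t)) := fun t ht =>
    hΦ.eq_of_curve_neg hXs (γ := fun t => e.symm (T.symm (x t)))
      (fun s hs => hasMFDerivAt_chart_symm he (hder s hs) (hmem s hs.le).1)
      (ContinuousAt.comp_of_eq (e.continuousAt_symm (hmem 0 le_rfl).1)
        (T.symm.continuous.comp hxc).continuousAt rfl).continuousWithinAt ht
  refine ⟨T.symm (x 0), (hmem 0 le_rfl).1, (hmem 0 le_rfl).2, ?_, fun i hi => ?_⟩
  · have h1 : Tendsto (fun t => T.symm (x t)) atBot (𝓝 0) := by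
      have h2 := (T.symm.continuous.tendsto 0).comp hxlim
      rwa [hTs] at h2
    refine (hes.comp h1).congr' ?_
    filter_upwards [Iio_mem_atBot (0 : ℝ)] with t ht using (hflow t ht).symm
  · exact hxu i (neg_pos.2 (lt_of_le_of_ne (not_lt.1 hi) (c.d_ne p hp i)))

lemma totalSpace_mk_eq {p q : M} {v w : Euc n} (hpq : p = q) (hvw : v = w) :
    (⟨p, v⟩ : TangentBundle (𝓡 n) M) = ⟨q, w⟩ := by
  subst hpq
  subst hvw
  rfl

/-- The tangent space of the descending manifold is the negative eigenspace of the Hessian. -/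
theorem MorseCharts.mem_descendingTangentSpace_iff [CompactSpace M] {ε R : ℝ}
    (c : MorseCharts G f (metricForm g) ε R) (hf : ContMDiff (𝓡 n) 𝓘(ℝ, ℝ) ∞ f) {p : M}
    (hp : p ∈ criticalPoints n f) (v : Euc n) :
    v ∈ descendingTangentSpace g f p ↔
      signL (c.d p) (dchart (c.e p) p v) = -dchart (c.e p) p v := by
  obtain ⟨X, hXs, hX⟩ := exists_negGradient g hf
  obtain ⟨Φ, hΦ⟩ := exists_isFlow hXs
  have he := c.mem_atlas p hp
  have hps := c.mem_source p hp
  have hp0 := c.apply_self p hp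
  have h0 : (0 : Euc n) ∈ (c.e p).target := hp0 ▸ (c.e p).map_source hps
  have hsymm : (c.e p).symm 0 = p := by rw [← hp0, (c.e p).left_inv hps]
  have hcone := fun κ h1 h2 => c.eventually_cone hf hXs hX hΦ hp (κ := κ) h1 h2
  have hD := fun x => mem_descendingManifold_iff hXs hX hΦ (p := p) (x := x)
  set e := c.e p
  rw [signL_eq_neg_iff (c.d_ne p hp)]
  constructor
  -- Near `p` the curve lies in the cone of any given width `κ`. Dividing by the parameter, the
  -- components of the velocity with `d i > 0` are at most `κ ‖w‖` for every `κ`.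
  · rintro ⟨γ, hγ, hγD, hvel⟩
    have hγ0 : γ 0 = p := congrArg Bundle.TotalSpace.proj hvel
    have hγv : (mfderiv 𝓘(ℝ, ℝ) (𝓡 n) γ 0 (1 : ℝ) : Euc n) = v := congrArg vec hvel
    have hγs : γ 0 ∈ e.source := hγ0 ▸ hps
    have hz : HasDerivAt (fun s => e (γ s)) (dchart e p v) 0 := by
      have h1 := ((mdifferentiable_of_mem_maximalAtlas he).mdifferentiableAt hγs).hasMFDerivAt
      have h2 : HasFDerivAt (fun s => e (γ s)) ((mfderiv (𝓡 n) (𝓡 n) e (γ 0)).comp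
          (mfderiv 𝓘(ℝ, ℝ) (𝓡 n) γ 0) : ℝ →L[ℝ] Euc n) 0 :=
        hasMFDerivAt_iff_hasFDerivAt.1 (h1.comp 0 hγ.hasMFDerivAt)
      refine hasDerivAt_iff_hasFDerivAt.2 (h2.congr_fderiv ?_)
      ext1
      change dchart e (γ 0) (mfderiv 𝓘(ℝ, ℝ) (𝓡 n) γ 0 (1 : ℝ)) = (1 : ℝ) • dchart e p v
      rw [one_smul]
      refine (congrArg (dchart e (γ 0)) hγv).trans ?_
      rw [hγ0]
    have hz0 : e (γ 0) = 0 := by rw [hγ0, hp0]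
    have hslope := hasDerivAt_iff_tendsto_slope_zero.1 hz
    simp only [zero_add, hz0, sub_zero] at hslope
    intro i hi
    set w := dchart e p v
    have hle : ∀ κ : ℝ, 0 < κ → κ ≤ 1 → |w i| ≤ κ * ‖w‖ := by
      intro κ h1 h2
      have hlim1 : Tendsto (fun s : ℝ => |(s⁻¹ • e (γ s)) i|) (𝓝[≠] 0) (𝓝 |w i|) :=
        (((EuclideanSpace.proj i : Euc n →L[ℝ] ℝ).continuous.tendsto w).comp hslope).abs
      refine le_of_tendsto_of_tendsto hlim1 (hslope.norm.const_mul κ) ?_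
      have hγc : Tendsto γ (𝓝[≠] 0) (𝓝 p) := by
        have h3 : Tendsto γ (𝓝 0) (𝓝 (γ 0)) := hγ.continuousAt
        rw [hγ0] at h3
        exact h3.mono_left nhdsWithin_le_nhds
      filter_upwards [hγc.eventually (hcone κ h1 h2)] with s hs
      have h4 := abs_apply_le_of_cone h1.le (hs ((hD _).1 (hγD s))) hi
      rw [PiLp.smul_apply, smul_eq_mul, abs_mul, norm_smul, Real.norm_eq_abs]
      calc |s⁻¹| * |e (γ s) i| ≤ |s⁻¹| * (κ * ‖e (γ s)‖) := by gcongr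
        _ = _ := by ring
    have hlim : Tendsto (fun κ : ℝ => κ * ‖w‖) (𝓝[>] 0) (𝓝 0) := by
      have h1 : Tendsto (fun κ : ℝ => κ * ‖w‖) (𝓝 0) (𝓝 (0 * ‖w‖)) :=
        tendsto_id.mul_const _
      rw [zero_mul] at h1
      exact h1.mono_left nhdsWithin_le_nhds
    have h1 : |w i| ≤ 0 := by
      refine ge_of_tendsto hlim ?_
      filter_upwards [Ioc_mem_nhdsGT one_pos] with κ hκ using hle κ hκ.1 hκ.2
    exact abs_nonpos_iff.1 h1
  · intro hv
    set w := dchart e p v with hw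
    obtain ⟨δ, hδ, hδW⟩ := c.exists_mem_unstable hf hXs hX hΦ hp (hcone 1 one_pos le_rfl)
    -- The points with unstable part `s • w` are chosen without any regularity in `s`. The thin
    -- cones alone give `h (s • w) - s • w = o(s)`, and differentiability at zero suffices.
    choose! h htar hcone1 hlim hcoord using hδW
    have hsub : ∀ κ : ℝ, 0 < κ → ∀ s : ℝ, ‖s • w‖ ≤ δ →
        ⟪diagL (coneWeight κ (c.d p)) (h (s • w)), h (s • w)⟫ ≤ 0 →
        ‖h (s • w) - s • w‖ ≤ κ * ‖s • w‖ := fun κ hκ s hs hc =>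
      norm_sub_le_of_cone hκ.le hc (fun i hi => by
        rw [PiLp.smul_apply, hv i hi, smul_zero]) (hcoord _ hs)
    have hsub1 : ∀ s : ℝ, ‖s • w‖ ≤ δ → ‖h (s • w) - s • w‖ ≤ ‖s • w‖ := fun s hs => by
      have h1 := hcone1 _ hs (hlim _ hs)
      rw [e.right_inv (htar _ hs)] at h1
      simpa using hsub 1 one_pos s hs h1
    have hh0 : h ((0 : ℝ) • w) = 0 := by
      have h1 := hsub1 0 (by simpa using hδ.le)
      simpa using h1
    have hsmall : ∀ᶠ s : ℝ in 𝓝 0, ‖s • w‖ ≤ δ := by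
      have h1 : Tendsto (fun s : ℝ => ‖s • w‖) (𝓝 0) (𝓝 ‖(0 : ℝ) • w‖) :=
        (continuous_id.smul continuous_const).norm.tendsto 0
      exact (h1.eventually (gt_mem_nhds (by simpa using hδ))).mono fun s hs => hs.le
    have htend : Tendsto (fun s : ℝ => e.symm (h (s • w))) (𝓝 0) (𝓝 p) := by
      have h1 : Tendsto (fun s : ℝ => s • w) (𝓝 0) (𝓝 0) := by
        have h2 : Tendsto (fun s : ℝ => s • w) (𝓝 0) (𝓝 ((0 : ℝ) • w)) :=
          (continuous_id.smul continuous_const).tendsto 0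
        rwa [zero_smul] at h2
      have h3 : Tendsto (fun s : ℝ => h (s • w) - s • w) (𝓝 0) (𝓝 0) :=
        squeeze_zero_norm' (hsmall.mono hsub1) (by simpa using h1.norm)
      have h4 : Tendsto (fun s : ℝ => h (s • w)) (𝓝 0) (𝓝 0) := by
        simpa using h3.add h1
      have h5 := e.continuousAt_symm h0
      rw [ContinuousAt, hsymm] at h5
      exact h5.comp h4
    have hder : HasDerivAt (fun s : ℝ => h (s • w)) w 0 := by
      rw [hasDerivAt_iff_isLittleO_nhds_zero]
      simp only [zero_add, hh0, sub_zero]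
      refine Asymptotics.isLittleO_iff.2 fun κ hκ => ?_
      have hκ2 : 0 < min 1 (κ / (‖w‖ + 1)) := lt_min one_pos (by positivity)
      filter_upwards [hsmall, htend.eventually (hcone _ hκ2 (min_le_left _ _))] with s hs hsc
      have h1 := hsc (hlim _ hs)
      rw [e.right_inv (htar _ hs)] at h1
      refine (hsub _ hκ2 s hs h1).trans ?_
      rw [norm_smul]
      have h2 : min 1 (κ / (‖w‖ + 1)) * ‖w‖ ≤ κ := by
        have h3 : min 1 (κ / (‖w‖ + 1)) * (‖w‖ + 1) ≤ κ := by
          rw [← le_div_iff₀ (by positivity)]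
          exact min_le_right _ _
        nlinarith
      calc _ = min 1 (κ / (‖w‖ + 1)) * ‖w‖ * ‖s‖ := by ring
        _ ≤ κ * ‖s‖ := by gcongr
    classical
    have hpD : p ∈ descendingManifold g f p := by
      refine ⟨fun _ => p, fun t => ⟨mdifferentiableAt_const, fun u => ?_⟩, rfl, tendsto_const_nhds⟩
      have h1 : mfderiv (𝓡 n) 𝓘(ℝ, ℝ) f p = 0 := hp
      rw [h1, mfderiv_const]
      have h2 : ∀ u : Euc n, metricForm g p (0 : Euc n) u = -(0 : ℝ) := fun u => by simp
      exact h2 u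
    -- The curve must lie in the descending manifold for all parameters, so it rests at `p` where no
    -- point has been chosen.
    set γ : ℝ → M := fun s => if ‖s • w‖ ≤ δ then e.symm (h (s • w)) else p with hγ
    have hγe : γ =ᶠ[𝓝 0] fun s => e.symm (h (s • w)) := by
      filter_upwards [hsmall] with s hs
      rw [hγ]
      simp only [if_pos hs]
    have hmf : HasMFDerivAt 𝓘(ℝ, ℝ) (𝓡 n) γ 0
        ((dchartSymm e (h ((0 : ℝ) • w))).comp ((1 : ℝ →L[ℝ] ℝ).smulRight w)) := by
      have h1 : HasMFDerivAt 𝓘(ℝ, ℝ) (𝓡 n) (fun s : ℝ => h (s • w)) 0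
          ((1 : ℝ →L[ℝ] ℝ).smulRight w) := hasMFDerivAt_iff_hasFDerivAt.2 hder.hasFDerivAt
      have h2 : h ((0 : ℝ) • w) ∈ e.target := hh0 ▸ h0
      exact (HasMFDerivAt.comp (g := e.symm) 0 ((mdifferentiable_of_mem_maximalAtlas
        he).mdifferentiableAt_symm h2).hasMFDerivAt h1).congr_of_eventuallyEq hγe
    refine ⟨γ, hmf.mdifferentiableAt, fun t => ?_, ?_⟩
    · simp only [hγ]
      split_ifs with ht
      · exact (hD _).2 (hlim _ ht)
      · exact hpD
    · have hγ0 : γ 0 = p := by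
        refine hγe.self_of_nhds.trans ?_
        change e.symm (h ((0 : ℝ) • w)) = p
        rw [hh0, hsymm]
      have h1 : dchartSymm e 0 w = v := by
        have h2 := dchartSymm_dchart he hps v
        rwa [hp0] at h2
      refine totalSpace_mk_eq hγ0 ?_
      have h3 : (mfderiv 𝓘(ℝ, ℝ) (𝓡 n) γ 0 (1 : ℝ) : Euc n) =
          dchartSymm e (h ((0 : ℝ) • w)) ((1 : ℝ) • w) :=
        congrArg (fun L : ℝ →L[ℝ] Euc n => L 1) hmf.mfderiv
      refine h3.trans ?_
      rw [hh0, one_smul, h1]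

end DescendingTangentSpace

end EquivariantMorse

/-! ### Assembly of the four statements -/

theorem mainTheorem6 {n : ℕ} {G M : Type*} [Group G] [Finite G]
    [TopologicalSpace M] [T2Space M] [CompactSpace M]
    [ChartedSpace (EuclideanSpace ℝ (Fin n)) M] [IsManifold (𝓡 n) ∞ M]
    [MulAction G M] [SmoothAction n G M]
    (f : M → ℝ) (hf : IsEquivariantMorse n G f) :
    -- sublevel sets with no critical values between them
    (∀ a b : ℝ, a < b → criticalValues n f ∩ Set.Icc a b = ∅ →
      InclusionIsEquivariantHomotopyEquiv G {x | f x ≤ a} {x | f x ≤ b}) ∧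
    -- just below a critical value
    (∀ a c : ℝ, a < c → criticalValues n f ∩ Set.Icc a c = {c} →
      ∀ U : M → Set M, (∀ p ∈ criticalPointsAt n f c, U p ∈ 𝓝 p) →
      ∃ B : M → Set M,
        (∀ p ∈ criticalPointsAt n f c, IsOpenCoordinateBall n p (B p) ∧ B p ⊆ U p) ∧
        (∀ σ : G, ∀ p ∈ criticalPointsAt n f c, (fun x => σ • x) '' B p = B (σ • p)) ∧
        InclusionIsEquivariantHomotopyEquiv G {x | f x ≤ a}
          ({x | f x ≤ c} \ ⋃ p ∈ criticalPointsAt n f c, B p)) ∧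
    -- just above a critical value
    (∀ c b : ℝ, c < b → criticalValues n f ∩ Set.Icc c b = {c} →
      ∀ U : M → Set M, (∀ p ∈ criticalPointsAt n f c, U p ∈ 𝓝 p) →
      ∃ B : M → Set M,
        (∀ p ∈ criticalPointsAt n f c, IsClosedCoordinateBall n p (B p) ∧ B p ⊆ U p) ∧
        (∀ σ : G, ∀ p ∈ criticalPointsAt n f c, (fun x => σ • x) '' B p = B (σ • p)) ∧
        InclusionIsEquivariantHomotopyEquiv G
          ({x | f x ≤ c} ∪ ⋃ p ∈ criticalPointsAt n f c, B p) {x | f x ≤ b}) ∧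
    -- crossing a critical value
    (∀ a b c : ℝ, a < c → c < b → criticalValues n f ∩ Set.Icc a b = {c} →
      ∀ (g : SmoothMetric n M) (hg : IsInvariantMetric G g),
      ∃ (φ : EquivariantMap G (descendingSpheres hf hg c) (sublevel hf a))
        (Φ : EquivariantMap G (CellAttachment hf hg a c φ) (sublevel hf b)),
        IsEquivariantHomotopyEquiv Φ ∧
        ∀ x : sublevel hf a, (Φ.toFun (Adjunction.base _ φ x) : M) = x) := by
  cases nonempty_fintype G
  refine ⟨fun a b hab hreg => sublevel_inclusion_of_regular hf hab hreg,
    fun a c hac hcrit U hU => sublevel_inclusion_below hf hac hcrit hU,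
    fun c b hcb hcrit U hU => sublevel_inclusion_above hf hcb hcrit hU,
    fun a b c hac hcb hcrit g hg => ?_⟩
  -- The model is built from charts that diagonalise the given metric along with the Hessian; this
  -- links its discs to the descending manifolds of `-∇f`.
  obtain ⟨m⟩ := exists_levelModel hf (invariantForm_metricForm hg) hac hcb
  exact exists_cellAttachment hf hg hac hcb hcrit m fun p hp v =>
    m.charts.mem_descendingTangentSpace_iff hf.smooth hp.1 v
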